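/- Conventions. A Lie groupoid $\Gamma\rightrightarrows M$ has target $\alpha$ and source $\beta$; the product $xy$ is defined when $\beta(x)=\alpha(y)$. Its Lie algebroid is $A=\ker\alpha_*|_M$. For $\varphi\in\Gamma(\wedge^kA)$, $\overleftarrow{\varphi}$ is the left-invariant $k$-vector field on $\Gamma$ with value $\varphi$ along the units, and $\overrightarrow{\varphi}$ is the right-invariant one with value $\wedge^k(-i_*)\varphi$ along the units, $i$ being the inversion (so that, on a Lie group, both have the same value at $1$). The Schouten bracket $[\cdot,\cdot]$ extends the Lie bracket of vector fields by $[a,b\wedge c]=[a,b]\wedge c+(-1)^{(|a|+1)|b|}\,b\wedge[a,c]$. A bivector field $\Pi$ on $\Gamma$ is multiplicative if $(\mu,\nu)\mapsto\Pi(\mu,\nu)$ is a 1-cocycle on the groupoid $T^*\Gamma\times_\Gamma T^*\Gamma\rightrightarrows A^*\times_MA^*$; equivalently, the graph of the multiplication is coisotropic for $\Pi\oplus\Pi\oplus(-\Pi)$. A quasi-Poisson groupoid $(\Gamma\rightrightarrows M,\Pi,\varphi)$ is a Lie groupoid with a (smooth) multiplicative bivector field $\Pi$ on $\Gamma$ and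 a (smooth) section $\varphi\in\Gamma(\wedge^3A)$ such that $$\tfrac12[\Pi,\Pi]=\overleftarrow{\varphi}-\overrightarrow{\varphi},\qquad [\Pi,\overleftarrow{\varphi}]=0 .$$ Theorem. Let $G$ be a connected and simply connected (finite-dimensional real) Lie group with Lie algebra $\mathfrak g$, and let $K$ be a non-degenerate symmetric bilinear form on $\mathfrak g$ that is invariant, i.e. $K([x,y],z)=K(x,[y,z])$ for all $x,y,z\in\mathfrak g$. Let $(e_i)_{i=1}^n$ be a basis of $\mathfrak g$ and $(e^i)_{i=1}^n$ its $K$-dual family, $K(e_i,e^j)=\delta_{ij}$ (so $e^i=e_i$ if the basis is orthonormal). Let $G\times G\rightrightarrows G$ be the transformation groupoid of the conjugation action: $$\alpha(g,s)=gsg^{-1},\qquad \beta(g,s)=s,\qquad (g,hth^{-1})\cdot(h,t)=(gh,t).$$ Let $\Pi$ be the bivector field on $G\times G$ given by $$\Pi(g,s)=\frac12\sum_{i=1}^n\Big(\overleftarrow{e_i}^{\,2}\wedge\overrightarrow{e^i}^{\,2}-\overleftarrow{e_i}^{\,2}\wedge\overleftarrow{e^i}^{\,1}-\overrightarrow{(\mathrm{Ad}_{g^{-1}}e_i)}^{\,2}\wedge\overrightarrow{e^i}^{\,1}\Big),$$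 where $\overleftarrow{v}$ and $\overrightarrow{v}$ are the left- and right-invariant vector fields on $G$ with value $v$ at $1$, the last superscript $1$ or $2$ tells on which factor of $G\times G$ the vector field lives (the coordinates being $g$ and $s$), and $v\wedge w=v\otimes w-w\otimes v$. Then the 3-form $\Omega=\frac14K(\cdot,[\cdot,\cdot])\in\wedge^3\mathfrak g^*$ is $\mathrm{Ad}$-invariant, i.e. it defines a bi-invariant 3-form on $G$; and $(G\times G\rightrightarrows G,\Pi,\Omega)$ is a quasi-Poisson groupoid. Here $\Omega$ is regarded as a constant section of $\wedge^3A$, by means of the isomorphism $\mathfrak g^*\cong\mathfrak g$ given by $K$ and of the trivialization $\mathfrak g\times G\cong A$ that sends $(v,s)$ to $\frac{d}{dt}\big|_{t=0}\big(\exp(tv),\exp(-tv)\,s\exp(tv)\big)$. -/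

import Mathlib

open scoped Manifold ContDiff

noncomputable section

namespace QuasiPoisson

section LinearAlgebra

/-- The exterior power `⋀ᵏ V` of a finite-dimensional real vector space `V`, realised as the
space of alternating `k`-forms on the dual `V*`. -/
abbrev MultiVec (k : ℕ) (V : Type*) [AddCommGroup V] [Module ℝ V] : Type _ :=
  (Module.Dual ℝ V) [⋀^Fin k]→ₗ[ℝ] ℝ

variable {V W : Type*} [AddCommGroup V] [Module ℝ V] [AddCommGroup W] [Module ℝ W]

/-- The decomposable `k`-vector `v₁ ∧ ⋯ ∧ vₖ`, i.e. `(θ₁, …, θₖ) ↦ det (θᵢ(vⱼ))`; in particular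
`(v ∧ w)(θ, η) = θ(v) η(w) - θ(w) η(v)`. -/
def wedge {k : ℕ} (v : Fin k → V) : MultiVec k V :=
  Matrix.detRowAlternating.compLinearMap (LinearMap.pi fun j => Module.Dual.eval ℝ V (v j))

/-- The push-forward `⋀ᵏ f : ⋀ᵏ V → ⋀ᵏ W` along a linear map `f : V → W`. -/
def MultiVec.map {k : ℕ} (f : V →ₗ[ℝ] W) (P : MultiVec k V) : MultiVec k W :=
  P.compLinearMap f.dualMap

end LinearAlgebra

section MultivectorFields

variable {E : Type*} [NormedAddCommGroup E] [NormedSpace ℝ E] {H : Type*} [TopologicalSpace H]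
  (I : ModelWithCorners ℝ E H) {M : Type*} [TopologicalSpace M] [ChartedSpace H M]

variable (M) in
/-- (Not necessarily smooth) `k`-vector fields on `M`. -/
abbrev MultivectorField (k : ℕ) : Type _ := (x : M) → MultiVec k (TangentSpace I x)

/-- The differential `df(x)`, as a covector at `x`. -/
def differential (f : M → ℝ) (x : M) : Module.Dual ℝ (TangentSpace I x) :=
  (mvfderiv I f x).toLinearMap

variable {I}

/-- The function `P(df₁, …, dfₖ)`. -/
def MultivectorField.apply {k : ℕ} (P : MultivectorField I M k) (f : Fin k → M → ℝ) : M → ℝ :=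
  fun x => P x fun i => differential I (f i) x

/-- A `k`-vector field `P` is smooth if `P(df₁, …, dfₖ)` is smooth for all local smooth
functions `f₁, …, fₖ`. -/
def MultivectorField.IsSmooth {k : ℕ} (P : MultivectorField I M k) : Prop :=
  ∀ U : Set M, IsOpen U → ∀ f : Fin k → M → ℝ,
    (∀ i, ContMDiffOn I 𝓘(ℝ, ℝ) ∞ (f i) U) → ContMDiffOn I 𝓘(ℝ, ℝ) ∞ (P.apply f) U

/-- The composition product `P ∘ Q` of a `(k+1)`-vector field and an `(l+1)`-vector field, viewed
as multiderivations of functions: the full antisymmetrisation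
`∑ ± P(f_{σ 1}, …, f_{σ k}, Q(f_{σ (k+1)}, …, f_{σ (k+l+1)}))` over the `(k, l+1)`-shuffles,
written as a sum over all permutations divided by `k! (l+1)!`. -/
def insertion {k l n : ℕ} (h : k + (l + 1) = n) (P : MultivectorField I M (k + 1))
    (Q : MultivectorField I M (l + 1)) (f : Fin n → M → ℝ) : M → ℝ := fun x =>
  ((k.factorial : ℝ) * ((l + 1).factorial : ℝ))⁻¹ *
    ∑ σ : Equiv.Perm (Fin n), ((Equiv.Perm.sign σ : ℤ) : ℝ) *
      P.apply (Fin.snoc (α := fun _ => M → ℝ)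
        (fun i : Fin k => f (σ (Fin.cast h (Fin.castAdd (l + 1) i))))
        (Q.apply fun j : Fin (l + 1) => f (σ (Fin.cast h (Fin.natAdd k j))))) x

/-- The Schouten bracket of a `(k+1)`-vector field and an `(l+1)`-vector field, as a multiderivation
of functions: `[P, Q] = P ∘ Q - (-1)^{kl} Q ∘ P`.  This is the sign convention of the Gerstenhaber
algebra of multivector fields, with `[a, b ∧ c] = [a, b] ∧ c + (-1)^{(|a|+1)|b|} b ∧ [a, c]`;
for example `[X ∧ Y, X ∧ Y] = 2 X ∧ Y ∧ [X, Y]`. -/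
def schouten {k l : ℕ} (P : MultivectorField I M (k + 1)) (Q : MultivectorField I M (l + 1))
    (f : Fin (k + l + 1) → M → ℝ) : M → ℝ := fun x =>
  insertion (by omega) P Q f x - (-1) ^ (k * l) * insertion (by omega) Q P f x

/-- `[P, Q] = R`: the multivector field `R` is the Schouten bracket of `P` and `Q`, that is, it acts
on local smooth functions by the multiderivation `schouten P Q`. -/
def IsSchoutenBracket {k l : ℕ} (P : MultivectorField I M (k + 1))
    (Q : MultivectorField I M (l + 1)) (R : MultivectorField I M (k + l + 1)) : Prop :=
  ∀ U : Set M, IsOpen U → ∀ f : Fin (k + l + 1) → M → ℝ,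
    (∀ i, ContMDiffOn I 𝓘(ℝ, ℝ) ∞ (f i) U) → ∀ x ∈ U, schouten P Q f x = R.apply f x

end MultivectorFields

/-- A groupoid `Γ ⇉ M` with target map `α = tgt` and source map `β = src`; the product `mul x y`
is meaningful only if `β(x) = α(y)`, its values elsewhere are irrelevant. -/
structure GroupoidStr (Γ M : Type*) where
  tgt : Γ → M
  src : Γ → M
  mul : Γ → Γ → Γ
  one : M → Γ
  inv : Γ → Γ
  tgt_mul : ∀ x y, src x = tgt y → tgt (mul x y) = tgt x
  src_mul : ∀ x y, src x = tgt y → src (mul x y) = src y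
  mul_assoc : ∀ x y z, src x = tgt y → src y = tgt z → mul (mul x y) z = mul x (mul y z)
  tgt_one : ∀ u, tgt (one u) = u
  src_one : ∀ u, src (one u) = u
  one_mul : ∀ x, mul (one (tgt x)) x = x
  mul_one : ∀ x, mul x (one (src x)) = x
  tgt_inv : ∀ x, tgt (inv x) = src x
  src_inv : ∀ x, src (inv x) = tgt x
  mul_inv : ∀ x, mul x (inv x) = one (tgt x)
  inv_mul : ∀ x, mul (inv x) x = one (src x)

section LieGroupoids

variable {E : Type*} [NormedAddCommGroup E] [NormedSpace ℝ E] {H : Type*} [TopologicalSpace H]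
  (I : ModelWithCorners ℝ E H) {Γ : Type*} [TopologicalSpace Γ] [ChartedSpace H Γ]
  {E' : Type*} [NormedAddCommGroup E'] [NormedSpace ℝ E'] {H' : Type*} [TopologicalSpace H']
  (J : ModelWithCorners ℝ E' H') {M : Type*} [TopologicalSpace M] [ChartedSpace H' M]

/-- The set `Γ₂ ⊆ Γ × Γ` of composable pairs. -/
def GroupoidStr.composable {Γ M : Type*} (𝒢 : GroupoidStr Γ M) : Set (Γ × Γ) :=
  {p | 𝒢.src p.1 = 𝒢.tgt p.2}

/-- A groupoid `Γ ⇉ M` on (finite-dimensional) smooth manifolds is a Lie groupoid if all structure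
maps are smooth and source and target are submersions (so that `Γ₂` is an embedded submanifold). -/
structure IsLieGroupoid (𝒢 : GroupoidStr Γ M) : Prop where
  isManifold_arrows : IsManifold I ∞ Γ
  isManifold_base : IsManifold J ∞ M
  smooth_tgt : ContMDiff I J ∞ 𝒢.tgt
  smooth_src : ContMDiff I J ∞ 𝒢.src
  submersion_tgt : ∀ x, Function.Surjective (mfderiv I J 𝒢.tgt x)
  submersion_src : ∀ x, Function.Surjective (mfderiv I J 𝒢.src x)
  smooth_mul : ContMDiffOn (I.prod I) I ∞ (fun p : Γ × Γ => 𝒢.mul p.1 p.2) 𝒢.composable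
  smooth_one : ContMDiff J I ∞ 𝒢.one
  smooth_inv : ContMDiff I I ∞ 𝒢.inv

/-- The derivative `Tm` of the multiplication `m : Γ₂ → Γ` at a composable pair `(x, y)`.  It is
meaningful (and determined by `m` on `Γ₂`) on the tangent vectors to `Γ₂`, i.e. on the pairs
`(v, w)` with `β_* v = α_* w`; it is only used on those. -/
def tangentMul (𝒢 : GroupoidStr Γ M) (x y : Γ) :
    TangentSpace I x × TangentSpace I y →ₗ[ℝ] TangentSpace I (𝒢.mul x y) :=
  ContinuousLinearMap.toLinearMap
    (mfderivWithin (I.prod I) I (fun p : Γ × Γ => 𝒢.mul p.1 p.2) 𝒢.composable (x, y) :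
      TangentSpace (I.prod I) (x, y) →L[ℝ] TangentSpace I (𝒢.mul x y))

/-- The composition relation of the cotangent groupoid `T*Γ ⇉ A*`, for covectors `ξ`, `η`, `δ` at
`x`, `y` and `xy`: `(ξ, η, -δ)` is conormal to the graph of the multiplication. -/
def CotangentComp (𝒢 : GroupoidStr Γ M) (x y : Γ) (ξ : Module.Dual ℝ (TangentSpace I x))
    (η : Module.Dual ℝ (TangentSpace I y)) (δ : Module.Dual ℝ (TangentSpace I (𝒢.mul x y))) :
    Prop :=
  ∀ (v : TangentSpace I x) (w : TangentSpace I y),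
    (mfderiv I J 𝒢.src x v : E') = mfderiv I J 𝒢.tgt y w →
      ξ v + η w = δ (tangentMul I 𝒢 x y (v, w))

/-- A `k`-vector field `P` on `Γ` is multiplicative if `(μ₁, …, μₖ) ↦ P(μ₁, …, μₖ)` is a
1-cocycle on the groupoid `T*Γ ×_Γ ⋯ ×_Γ T*Γ`; equivalently, the graph of the multiplication is
coisotropic with respect to `P ⊕ P ⊕ (-1)^{k-1} P`. -/
def IsMultiplicative (𝒢 : GroupoidStr Γ M) {k : ℕ} (P : MultivectorField I Γ k) : Prop :=
  ∀ x y, 𝒢.src x = 𝒢.tgt y → ∀ (ξ : Fin k → Module.Dual ℝ (TangentSpace I x))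
    (η : Fin k → Module.Dual ℝ (TangentSpace I y))
    (δ : Fin k → Module.Dual ℝ (TangentSpace I (𝒢.mul x y))),
    (∀ i, CotangentComp I J 𝒢 x y (ξ i) (η i) (δ i)) → P (𝒢.mul x y) δ = P x ξ + P y η

/-- The fibre `A_u = ker α_* ⊆ T_{1_u} Γ` of the Lie algebroid `A`. -/
def algebroidFiber (𝒢 : GroupoidStr Γ M) (u : M) : Submodule ℝ (TangentSpace I (𝒢.one u)) :=
  LinearMap.ker (mfderiv I J 𝒢.tgt (𝒢.one u)).toLinearMap

/-- (Not necessarily smooth) sections of `⋀ᵏ A`. -/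
abbrev AlgebroidSection (𝒢 : GroupoidStr Γ M) (k : ℕ) : Type _ :=
  (u : M) → MultiVec k (algebroidFiber I J 𝒢 u)

variable {I J}

/-- Smoothness of a section of `⋀ᵏ A`, a subbundle of the restriction of `⋀ᵏ TΓ` to the units. -/
def AlgebroidSection.IsSmooth {𝒢 : GroupoidStr Γ M} {k : ℕ} (φ : AlgebroidSection I J 𝒢 k) :
    Prop :=
  ∀ U : Set Γ, IsOpen U → ∀ f : Fin k → Γ → ℝ, (∀ i, ContMDiffOn I 𝓘(ℝ, ℝ) ∞ (f i) U) →
    ContMDiffOn J 𝓘(ℝ, ℝ) ∞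
      (fun u => (φ u).map (algebroidFiber I J 𝒢 u).subtype
        fun i => differential I (f i) (𝒢.one u)) (𝒢.one ⁻¹' U)

variable (I J)

/-- The left translation `A_{β(x)} → T_x Γ`, `v ↦ (L_x)_* v`, i.e. `v ↦ Tm(0_x, v)`
(recall `x · 1_{β(x)} = x`). -/
def leftTranslation (𝒢 : GroupoidStr Γ M) (x : Γ) :
    algebroidFiber I J 𝒢 (𝒢.src x) →ₗ[ℝ] TangentSpace I x :=
  ((tangentMul I 𝒢 x (𝒢.one (𝒢.src x)) :
      TangentSpace I x × TangentSpace I (𝒢.one (𝒢.src x)) →ₗ[ℝ] TangentSpace I x).comp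
    (LinearMap.inr ℝ (TangentSpace I x) (TangentSpace I (𝒢.one (𝒢.src x))))).comp
    (algebroidFiber I J 𝒢 (𝒢.src x)).subtype

/-- The projection `ker α_* → ker β_*` at a unit `1_u` along the tangent space of the manifold of
units, `v ↦ v - (ε ∘ β)_* v`.  It equals `v ↦ -i_* v` for the inversion `i`; for a Lie group it is
the identity. -/
def toSourceFiber (𝒢 : GroupoidStr Γ M) (u : M) :
    algebroidFiber I J 𝒢 u →ₗ[ℝ] TangentSpace I (𝒢.one u) :=
  (LinearMap.id - ContinuousLinearMap.toLinearMap
    (mfderiv I I (fun y => 𝒢.one (𝒢.src y)) (𝒢.one u) :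
      TangentSpace I (𝒢.one u) →L[ℝ] TangentSpace I (𝒢.one u))).comp
    (algebroidFiber I J 𝒢 u).subtype

/-- The right translation `A_{α(x)} → T_x Γ`: the vector of `ker β_*` corresponding to `v` is
translated by `R_x`, i.e. `v ↦ Tm(v - (ε ∘ β)_* v, 0_x)` (recall `1_{α(x)} · x = x`). -/
def rightTranslation (𝒢 : GroupoidStr Γ M) (x : Γ) :
    algebroidFiber I J 𝒢 (𝒢.tgt x) →ₗ[ℝ] TangentSpace I x :=
  ((tangentMul I 𝒢 (𝒢.one (𝒢.tgt x)) x :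
      TangentSpace I (𝒢.one (𝒢.tgt x)) × TangentSpace I x →ₗ[ℝ] TangentSpace I x).comp
    (LinearMap.inl ℝ (TangentSpace I (𝒢.one (𝒢.tgt x))) (TangentSpace I x))).comp
    (toSourceFiber I J 𝒢 (𝒢.tgt x))

variable {I J}

/-- The left-invariant `k`-vector field on `Γ` defined by a section of `⋀ᵏ A`. -/
def leftInvariant {𝒢 : GroupoidStr Γ M} {k : ℕ} (φ : AlgebroidSection I J 𝒢 k) :
    MultivectorField I Γ k :=
  fun x => (φ (𝒢.src x)).map (leftTranslation I J 𝒢 x)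

/-- The right-invariant `k`-vector field on `Γ` defined by a section of `⋀ᵏ A`. -/
def rightInvariant {𝒢 : GroupoidStr Γ M} {k : ℕ} (φ : AlgebroidSection I J 𝒢 k) :
    MultivectorField I Γ k :=
  fun x => (φ (𝒢.tgt x)).map (rightTranslation I J 𝒢 x)

variable (I J)

/-- `(Γ ⇉ M, Π, φ)` is a quasi-Poisson groupoid: `Γ ⇉ M` is a Lie groupoid, `Π` a multiplicative
bivector field on `Γ`, `φ` a section of `⋀³ A`, and `½ [Π, Π]` is the difference of the left- and
right-invariant trivector fields of `φ`, while `Π` commutes with the left-invariant one. -/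
structure IsQuasiPoissonGroupoid (𝒢 : GroupoidStr Γ M) (P : MultivectorField I Γ 2)
    (φ : AlgebroidSection I J 𝒢 3) : Prop where
  isLieGroupoid : IsLieGroupoid I J 𝒢
  smooth_bivector : P.IsSmooth
  smooth_section : φ.IsSmooth
  multiplicative : IsMultiplicative I J 𝒢 P
  bracket_self : IsSchoutenBracket (k := 1) (l := 1) P P
    ((2 : ℝ) • (leftInvariant φ - rightInvariant φ))
  bracket_section : IsSchoutenBracket (k := 1) (l := 2) P (leftInvariant φ) 0

end LieGroupoids

section Conjugation

variable {E : Type*} [NormedAddCommGroup E] [NormedSpace ℝ E] {H : Type*} [TopologicalSpace H]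
  {I : ModelWithCorners ℝ E H} {G : Type*} [TopologicalSpace G] [ChartedSpace H G] [Group G]

/-- A smooth Lie group has the regularity required by Mathlib's Lie algebra of a Lie group. -/
instance instLieGroupMinSmoothness [LieGroup I ∞ G] : LieGroup I (minSmoothness ℝ 3) G :=
  LieGroup.of_le (n := ∞) (by rw [minSmoothness_of_isRCLikeNormedField]; exact ENat.LEInfty.out)

variable (G) in
/-- The transformation groupoid `G × G ⇉ G` of the conjugation action of `G` on itself:
`α(g, s) = g s g⁻¹`, `β(g, s) = s`, `(g, h t h⁻¹) · (h, t) = (g h, t)`. -/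
def conjGroupoid : GroupoidStr (G × G) G where
  tgt p := p.1 * p.2 * p.1⁻¹
  src p := p.2
  mul p q := (p.1 * q.1, q.2)
  one s := (1, s)
  inv p := (p.1⁻¹, p.1 * p.2 * p.1⁻¹)
  tgt_mul x y h := by
    change x.2 = y.1 * y.2 * y.1⁻¹ at h
    change x.1 * y.1 * y.2 * (x.1 * y.1)⁻¹ = x.1 * x.2 * x.1⁻¹
    rw [h]; group
  src_mul _ _ _ := rfl
  mul_assoc _ _ _ _ _ := by simp [_root_.mul_assoc]
  tgt_one _ := by simp
  src_one _ := rfl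
  one_mul _ := by simp
  mul_one _ := by simp
  tgt_inv x := by
    change x.1⁻¹ * (x.1 * x.2 * x.1⁻¹) * x.1⁻¹⁻¹ = x.2
    group
  src_inv _ := rfl
  mul_inv _ := by simp
  inv_mul _ := by simp

/-- The right-invariant vector field on `G` with value `v` at the identity. -/
def rightInvariantVectorField (v : GroupLieAlgebra I G) (g : G) : TangentSpace I g :=
  (mfderiv I I (fun h : G => h * g) (1 : G) v : TangentSpace I ((1 : G) * g))

variable (I) in
/-- The adjoint action `Ad_g`, the derivative at the identity of `h ↦ g h g⁻¹`. -/
def adjointAction (g : G) : GroupLieAlgebra I G →L[ℝ] GroupLieAlgebra I G :=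
  (mfderiv I I (fun h : G => g * h * g⁻¹) (1 : G) :
    TangentSpace I (1 : G) →L[ℝ] TangentSpace I (g * 1 * g⁻¹))

variable (I) in
/-- The infinitesimal conjugation action: the value at `s` of the fundamental vector field
`d/dt (exp(tv) s exp(-tv))` of `v`. -/
def conjField (s : G) : GroupLieAlgebra I G →L[ℝ] TangentSpace I s :=
  (mfderiv I I (fun g : G => g * s * g⁻¹) (1 : G) :
    TangentSpace I (1 : G) →L[ℝ] TangentSpace I (1 * s * 1⁻¹))

/-- A tangent vector of the first factor of `G × G`. -/
def inFirst (p : G × G) (v : TangentSpace I p.1) : TangentSpace (I.prod I) p :=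
  ((v, 0) : TangentSpace I p.1 × TangentSpace I p.2)

/-- A tangent vector of the second factor of `G × G`. -/
def inSecond (p : G × G) (v : TangentSpace I p.2) : TangentSpace (I.prod I) p :=
  ((0, v) : TangentSpace I p.1 × TangentSpace I p.2)

/-- The bivector field
`½ ∑ᵢ (←eᵢ² ∧ →eⁱ² - ←eᵢ² ∧ ←eⁱ¹ - →(Ad_{g⁻¹} eᵢ)² ∧ →eⁱ¹)` at `(g, s)`, where the arrows `←`, `→`
are left- and right-invariant extensions on `G`, the last superscript is the factor of `G × G`, and
`(eⁱ)` is the family `e'` (the dual basis of `(eᵢ)`, hence equal to it if `(eᵢ)` is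
orthonormal). -/
def conjBivector {ι : Type*} [Fintype ι] (e e' : ι → GroupLieAlgebra I G) :
    MultivectorField (I.prod I) (G × G) 2 := fun p =>
  (1 / 2 : ℝ) • ∑ i,
    (wedge ![inSecond p (mulInvariantVectorField (e i) p.2),
        inSecond p (rightInvariantVectorField (e' i) p.2)]
      - wedge ![inSecond p (mulInvariantVectorField (e i) p.2),
        inFirst p (mulInvariantVectorField (e' i) p.1)]
      - wedge ![inSecond p (rightInvariantVectorField (adjointAction I p.1⁻¹ (e i)) p.2),
        inFirst p (rightInvariantVectorField (e' i) p.1)])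

/-- The tangent vector `d/dt (exp(tv), exp(-tv) s exp(tv))` of `G × G` at the unit `(1, s)`. -/
def constantVector (s : G) :
    GroupLieAlgebra I G →ₗ[ℝ] TangentSpace (I.prod I) ((conjGroupoid G).one s) :=
  LinearMap.prod (LinearMap.id : GroupLieAlgebra I G →ₗ[ℝ] TangentSpace I (1 : G))
    (-(conjField I s).toLinearMap : GroupLieAlgebra I G →ₗ[ℝ] TangentSpace I s)

theorem constantVector_mem [LieGroup I ∞ G] (s : G) (v : GroupLieAlgebra I G) :
    constantVector s v ∈ algebroidFiber (I.prod I) I (conjGroupoid G) s := by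
  have hG : ContMDiff (I.prod I) I ∞ (fun p : G × G => p.1 * p.2 * p.1⁻¹) :=
    (contMDiff_fst.mul contMDiff_snd).mul contMDiff_fst.inv
  have hd : MDifferentiableAt (I.prod I) I (fun p : G × G => p.1 * p.2 * p.1⁻¹) ((1 : G), s) :=
    (hG ((1 : G), s)).mdifferentiableAt (by simp)
  have hid : (fun z : G => (1 : G) * z * (1 : G)⁻¹) = id := by ext z; simp
  have h2 : mfderiv I I (fun z : G => (1 : G) * z * (1 : G)⁻¹) s = ContinuousLinearMap.id ℝ E := by
    rw [hid]; exact mfderiv_id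
  have key := mfderiv_prod_eq_add_apply (v := constantVector s v) hd
  refine key.trans ((congrArg (fun L : E →L[ℝ] E => @id E (conjField I s v) + L (-@id E (conjField I s v)))
    h2).trans ?_)
  exact add_neg_cancel (G := E) (conjField I s v)

/-- The constant section of the Lie algebroid `A` of `conjGroupoid G` defined by an element `v` of
the Lie algebra, under `A ≅ 𝔤 × G`: its value at `s` is `d/dt (exp(tv), exp(-tv) s exp(tv))`. -/
def constantSection [LieGroup I ∞ G] (s : G) :
    GroupLieAlgebra I G →ₗ[ℝ] algebroidFiber (I.prod I) I (conjGroupoid G) s :=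
  LinearMap.codRestrict _ (constantVector s) (constantVector_mem s)

/-- The 3-form `Ω = ¼ K(·, [·, ·])` on the Lie algebra, for an invariant bilinear form `K`. -/
def cartanForm [FiniteDimensional ℝ E] [LieGroup I ∞ G]
    (K : LinearMap.BilinForm ℝ (GroupLieAlgebra I G))
    (hinv : ∀ x y z, K ⁅x, y⁆ z = K x ⁅y, z⁆) :
    (GroupLieAlgebra I G) [⋀^Fin 3]→ₗ[ℝ] ℝ :=
  haveI : CompleteSpace E := FiniteDimensional.complete ℝ E
  { toFun := fun v => (1 / 4 : ℝ) * K (v 0) ⁅v 1, v 2⁆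
    map_update_add' := by
      intro _ m i x y
      have h : i = 0 ∨ i = 1 ∨ i = 2 := by omega
      have h01 : (0 : Fin 3) ≠ 1 := by omega
      have h02 : (0 : Fin 3) ≠ 2 := by omega
      have h12 : (1 : Fin 3) ≠ 2 := by omega
      rcases h with rfl | rfl | rfl <;>
        simp only [Function.update_self, Function.update_of_ne h01, Function.update_of_ne h01.symm,
          Function.update_of_ne h02, Function.update_of_ne h02.symm, Function.update_of_ne h12,
          Function.update_of_ne h12.symm, map_add, LinearMap.add_apply, add_lie, lie_add, mul_add]
    map_update_smul' := by
      intro _ m i c x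
      have h : i = 0 ∨ i = 1 ∨ i = 2 := by omega
      have h01 : (0 : Fin 3) ≠ 1 := by omega
      have h02 : (0 : Fin 3) ≠ 2 := by omega
      have h12 : (1 : Fin 3) ≠ 2 := by omega
      rcases h with rfl | rfl | rfl <;>
        simp only [Function.update_self, Function.update_of_ne h01, Function.update_of_ne h01.symm,
          Function.update_of_ne h02, Function.update_of_ne h02.symm, Function.update_of_ne h12,
          Function.update_of_ne h12.symm, map_smul, LinearMap.smul_apply, smul_lie, lie_smul,
          smul_eq_mul, mul_left_comm]
    map_eq_zero_of_eq' := by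
      intro v i j hij hne
      have h01 : ∀ x z, K x ⁅x, z⁆ = 0 := fun x z => by rw [← hinv, lie_self]; simp
      have h02 : ∀ x z, K x ⁅z, x⁆ = 0 := fun x z => by
        rw [← lie_skew, map_neg, h01, neg_zero]
      fin_cases i <;> fin_cases j <;> simp at hij hne ⊢ <;> simp [hij, h01, h02] }

/-- The section of `⋀³ A` of `conjGroupoid G` defined by the 3-form `Ω = ¼ K(·, [·, ·])`: the
isomorphism `𝔤 ≅ 𝔤*` given by `K` turns `Ω` into an element of `⋀³ 𝔤`, and this into a constant
section of `⋀³ A`. -/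
def cartanSection [FiniteDimensional ℝ E] [LieGroup I ∞ G]
    (K : LinearMap.BilinForm ℝ (GroupLieAlgebra I G))
    (hnd : K.Nondegenerate) (hinv : ∀ x y z, K ⁅x, y⁆ z = K x ⁅y, z⁆) :
    AlgebroidSection (I.prod I) I (conjGroupoid G) 3 :=
  haveI : FiniteDimensional ℝ (GroupLieAlgebra I G) := inferInstanceAs (FiniteDimensional ℝ E)
  fun s => MultiVec.map (constantSection s)
    ((cartanForm K hinv).compLinearMap (K.toDual hnd).symm.toLinearMap)

end Conjugation

end QuasiPoisson

end

open QuasiPoisson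

/-! For u in 𝔤 let X₀(u), X₁(u), X₂(u) be the fields on G × G generated by right translation of the
first factor, right translation of the second factor and left translation of the second factor.
Fields with different indices commute, and [X_r(u), X_r(v)] = ε_r X_r([u,v]) with ε = (1, 1, -1)
(`fieldDeriv_frameMap_comm`).

Since G is connected, the invariance of K under ad integrates to invariance under Ad
(`bilinForm_adjointAction`). So ∑ eᵢ ⊗ eⁱ is Ad-invariant, and the twist by Ad_{g⁻¹} in the last
term of Π disappears once the right-invariant fields of the first factor are written through X₀.
Thus Π = ½ (X₀∧X₁ + X₀∧X₂ + X₁∧X₂), contracted by K, with constant coefficients. A covector δ at (g,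
s) is encoded by vectors z_r in 𝔤 with K(z_r, u) = δ(X_r(u)) (`coframe`). As X₂(u) = X₁(Ad_{s⁻¹} u),
they satisfy z₁ = Ad_{s⁻¹} z₂. All claims become algebra in these vectors (`conjBivector_apply`).

Bracket of Π with itself: the left-invariant fields of the groupoid are Y = X₀ + X₁ - X₂, and the
right-invariant ones are X₀ up to Ad. With constant coefficients [Π, Π] involves only the
commutators of the X_r. The result differs from the wanted trivector by a multiple of K(z₁,[z₁,z₁])
- K(z₂,[z₂,z₂]) (polarised), which vanishes because z₁ and z₂ are related by Ad
(`sum_perm_frameCoeff`, `schouten_conjBivector_self`).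

Bracket of Π with the section: [Y(u), X_r(v)] = X_r([u,v]) for every r, so ad-invariance of K says
that Y(u) preserves Π. A trivector with constant coefficients in the Y(u) then commutes with Π
(`schouten_bivector_trivector`).

Multiplicativity: differentiating products of composable pairs along suitable maps from G expresses
the z_r of the product, and z₀ of the second factor, through the z_r of the two factors. The cross
terms then cancel, again by z₁ = Ad_{s⁻¹} z₂ (`isMultiplicative_conjBivector`). -/

noncomputable section

namespace QuasiPoisson

open Set Filter Topology VectorField

/-! ### Calculus on manifolds: mixed partials, commutators of fields, vanishing derivatives -/

section Calculus

variable {E : Type*} [NormedAddCommGroup E] [NormedSpace ℝ E] {H : Type*} [TopologicalSpace H]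
  {I : ModelWithCorners ℝ E H} {M : Type*} [TopologicalSpace M] [ChartedSpace H M]
  {E' : Type*} [NormedAddCommGroup E'] [NormedSpace ℝ E'] {H' : Type*} [TopologicalSpace H']
  {J : ModelWithCorners ℝ E' H'} {N : Type*} [TopologicalSpace N] [ChartedSpace H' N]
  {F : Type*} [NormedAddCommGroup F] [NormedSpace ℝ F]

theorem mvfderiv_comp_apply' {f : N → M} {g : M → F} {y : M} (x : N)
    (hg : MDifferentiableAt I 𝓘(ℝ, F) g y) (hf : MDifferentiableAt J I f x) (hy : f x = y)
    (v : TangentSpace J x) :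
    mvfderiv J (fun z => g (f z)) x v = mvfderiv I g y (mfderiv J I f x v : E) := by
  subst hy
  exact mfderiv_comp_apply x hg hf v

theorem mvfderiv_congr {f g : M → F} {x : M} (h : f =ᶠ[𝓝 x] g) :
    mvfderiv I f x = mvfderiv I g x := by
  have h1 : (mfderiv I 𝓘(ℝ, F) f x : E →L[ℝ] F) = mfderiv I 𝓘(ℝ, F) g x := h.mfderiv_eq
  ext v
  exact congrArg (fun L : E →L[ℝ] F => L v) h1

/-- Differentiation at a fixed point in one variable depends smoothly on the other variable. -/
theorem contMDiffAt_mvfderiv_param [IsManifold I ∞ M] [IsManifold J ∞ N] {f : N → M → F} {x : N} {y : M}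
    (hf : ContMDiffAt (J.prod I) 𝓘(ℝ, F) ∞ (Function.uncurry f) (x, y)) (v : TangentSpace I y) :
    ContMDiffAt J 𝓘(ℝ, F) ∞ (fun z => mvfderiv I (f z) y v) x := by
  have : IsManifold I 1 M := .of_le (n := ∞) (by simp)
  have : IsManifold J 1 N := .of_le (n := ∞) (by simp)
  have h : ContMDiffAt J 𝓘(ℝ, F) ∞ (fun z => inTangentCoordinates I 𝓘(ℝ, F) (fun _ => y)
      (fun z => f z y) (fun z => mfderiv I 𝓘(ℝ, F) (f z) y) x z v) x :=
    ContMDiffAt.mfderiv_apply (E := E) (m := ∞) (n := ∞) (x₀ := x) f (fun _ => y) id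
      (fun _ => v) hf contMDiffAt_const contMDiffAt_id contMDiffAt_const (by simp)
  -- The tangent coordinates differ from the plain derivative by two coordinate changes. Both are
  -- trivial: the source point is fixed at `y`, and the vector space `F` has a single chart.
  refine h.congr_of_eventuallyEq (Eventually.of_forall fun z => ?_)
  have h1 := inTangentCoordinates_eq (I := I) (I' := 𝓘(ℝ, F)) (x₀ := x) (x := z) (fun _ => y)
    (fun z => f z y) (fun z => mfderiv I 𝓘(ℝ, F) (f z) y) (mem_chart_source H y) (by simp [chartAt_self_eq])
  refine Eq.trans ?_ (congrArg (fun L : E →L[ℝ] F => L v) h1).symm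
  have h2 := (tangentBundleCore I M).coordChange_self (achart H y) y (mem_chart_source H y) v
  have h3 : (tangentBundleCore 𝓘(ℝ, F) F).coordChange (achart F (f z y)) (achart F (f x y))
      (f z y) = ContinuousLinearMap.id ℝ F := by
    ext w
    exact (tangentBundleCore 𝓘(ℝ, F) F).coordChange_self (achart F (f z y)) (f z y) (mem_chart_source F (f z y)) w
  exact ((congrArg (fun L : F →L[ℝ] F => L _) h3).trans
    (congrArg (mfderiv I 𝓘(ℝ, F) (f z) y : E → F) h2)).symm

theorem mvfderiv_eq_fderiv [I.Boundaryless] {f : M → F} {x : M}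
    (hf : MDifferentiableAt I 𝓘(ℝ, F) f x) (v : TangentSpace I x) :
    mvfderiv I f x v =
      fderiv ℝ (fun a => f ((extChartAt I x).symm a)) (extChartAt I x x) (v : E) := by
  rw [hf.mvfderiv, I.range_eq_univ, fderivWithin_univ]
  rfl

/-- Mixed partial derivatives on a product of manifolds commute. -/
theorem mvfderiv_comm [I.Boundaryless] [J.Boundaryless] [IsManifold I ∞ M] [IsManifold J ∞ N]
    {f : M → N → F} {x : M} {y : N}
    (hf : ContMDiffAt (I.prod J) 𝓘(ℝ, F) ∞ (Function.uncurry f) (x, y))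
    (u : TangentSpace I x) (v : TangentSpace J y) :
    mvfderiv I (fun a => mvfderiv J (f a) y v) x u =
      mvfderiv J (fun b => mvfderiv I (fun a => f a b) x u) y v := by
  set φ := extChartAt I x
  set ψ := extChartAt J y
  set g : E × E' → F := fun p => f (φ.symm p.1) (ψ.symm p.2) with hg
  have hφ : ContMDiffAt 𝓘(ℝ, E) I ∞ φ.symm (φ x) :=
    (contMDiffOn_extChartAt_symm x).contMDiffAt (extChartAt_target_mem_nhds x)
  have hψ : ContMDiffAt 𝓘(ℝ, E') J ∞ ψ.symm (ψ y) :=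
    (contMDiffOn_extChartAt_symm y).contMDiffAt (extChartAt_target_mem_nhds y)
  have hxx : φ.symm (φ x) = x := extChartAt_to_inv x
  have hyy : ψ.symm (ψ y) = y := extChartAt_to_inv y
  have hgc : ContDiffAt ℝ ∞ g (φ x, ψ y) := by
    rw [← contMDiffAt_iff_contDiffAt]
    refine ContMDiffAt.comp_of_eq (I' := I.prod J) (g := Function.uncurry f)
      (f := fun p : E × E' => (φ.symm p.1, ψ.symm p.2)) hf ?_ (by simp [hxx, hyy])
    exact (hφ.comp_of_eq contDiff_fst.contMDiff.contMDiffAt rfl).prodMk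
      (hψ.comp_of_eq contDiff_snd.contMDiff.contMDiffAt rfl)
  have hd : ∀ᶠ p in 𝓝 (φ x, ψ y), DifferentiableAt ℝ g p :=
    ((hgc.of_le (m := 1) (by simp)).eventually (by simp)).mono
      fun p hp => hp.differentiableAt (by simp)
  have hm : ∀ᶠ p in 𝓝 (x, y), ContMDiffAt (I.prod J) 𝓘(ℝ, F) 1 (Function.uncurry f) p := by
    have : IsManifold I 1 M := .of_le (n := ∞) (by simp)
    have : IsManifold J 1 N := .of_le (n := ∞) (by simp)
    exact (contMDiffAt_iff_contMDiffAt_nhds (by simp)).1 (hf.of_le (m := 1) (by simp))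
  have hφc : ContinuousAt φ x := continuousAt_extChartAt x
  have hψc : ContinuousAt ψ y := continuousAt_extChartAt y
  -- An equality at `x` alone would not survive the outer derivative, so the inner derivative is
  -- identified with a partial derivative of `g` on a neighbourhood.
  have h1 : ∀ᶠ a in 𝓝 x, mvfderiv J (f a) y v = fderiv ℝ g (φ a, ψ y) ((0 : E), (v : E')) := by
    have e1 : Tendsto (fun a : M => (a, y)) (𝓝 x) (𝓝 (x, y)) :=
      Continuous.tendsto' (by fun_prop) _ _ rfl
    have e2 : Tendsto (fun a : M => (φ a, ψ y)) (𝓝 x) (𝓝 (φ x, ψ y)) :=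
      hφc.prodMk continuousAt_const
    filter_upwards [e1.eventually hm, e2.eventually hd, extChartAt_source_mem_nhds (I := I) x]
      with a ha1 ha2 ha3
    have ha4 : MDifferentiableAt J 𝓘(ℝ, F) (f a) y :=
      (ContMDiffAt.comp_of_eq (g := Function.uncurry f) (f := fun b : N => (a, b)) ha1
        (contMDiffAt_const.prodMk contMDiffAt_id) rfl).mdifferentiableAt (by simp)
    rw [mvfderiv_eq_fderiv ha4]
    have e3 : (fun b => f a (ψ.symm b)) = fun b => g (φ a, b) := by
      funext b; simp only [hg]; rw [φ.left_inv ha3]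
    have e4 := ha2.hasFDerivAt.comp (ψ y) (hasFDerivAt_prodMk_right (𝕜 := ℝ) (φ a) (ψ y))
    exact congrArg (fun L : E' →L[ℝ] F => L v) ((congrArg (fun k => fderiv ℝ k (ψ y)) e3).trans
      e4.fderiv)
  have h2 : ∀ᶠ b in 𝓝 y, mvfderiv I (fun a => f a b) x u =
      fderiv ℝ g (φ x, ψ b) ((u : E), (0 : E')) := by
    have e1 : Tendsto (fun b : N => (x, b)) (𝓝 y) (𝓝 (x, y)) :=
      Continuous.tendsto' (by fun_prop) _ _ rfl
    have e2 : Tendsto (fun b : N => (φ x, ψ b)) (𝓝 y) (𝓝 (φ x, ψ y)) :=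
      continuousAt_const.prodMk hψc
    filter_upwards [e1.eventually hm, e2.eventually hd, extChartAt_source_mem_nhds (I := J) y]
      with b hb1 hb2 hb3
    have hb4 : MDifferentiableAt I 𝓘(ℝ, F) (fun a => f a b) x :=
      (ContMDiffAt.comp_of_eq (g := Function.uncurry f) (f := fun a : M => (a, b)) hb1
        (contMDiffAt_id.prodMk contMDiffAt_const) rfl).mdifferentiableAt (by simp)
    rw [mvfderiv_eq_fderiv hb4]
    have e3 : (fun a => f (φ.symm a) b) = fun a => g (a, ψ b) := by
      funext a; simp only [hg]; rw [ψ.left_inv hb3]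
    have e4 := hb2.hasFDerivAt.comp (φ x) (hasFDerivAt_prodMk_left (𝕜 := ℝ) (φ x) (ψ b))
    exact congrArg (fun L : E →L[ℝ] F => L u) ((congrArg (fun k => fderiv ℝ k (φ x)) e3).trans
      e4.fderiv)
  have hg' : DifferentiableAt ℝ (fderiv ℝ g) (φ x, ψ y) :=
    (hgc.fderiv_right (m := ∞) (by simp)).differentiableAt (by simp)
  have h0 : ∀ w : E × E', HasFDerivAt (fun p => fderiv ℝ g p w)
      ((ContinuousLinearMap.apply ℝ F w).comp (fderiv ℝ (fderiv ℝ g) (φ x, ψ y))) (φ x, ψ y) :=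
    fun w => (ContinuousLinearMap.apply ℝ F w).hasFDerivAt.comp _ hg'.hasFDerivAt
  have h3 : mvfderiv I (fun a => fderiv ℝ g (φ a, ψ y) ((0 : E), (v : E'))) x u =
      fderiv ℝ (fderiv ℝ g) (φ x, ψ y) ((u : E), (0 : E')) ((0 : E), (v : E')) := by
    have e1 := (h0 ((0 : E), (v : E'))).comp (φ x) (hasFDerivAt_prodMk_left (𝕜 := ℝ) (φ x) (ψ y))
    rw [mvfderiv_eq_fderiv]
    · refine congrArg (fun L : E →L[ℝ] F => L u) (Eq.trans ?_ e1.fderiv)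
      refine Filter.EventuallyEq.fderiv_eq ?_
      filter_upwards [extChartAt_target_mem_nhds (I := I) x] with c hc
      simp only [Function.comp]
      rw [φ.right_inv hc]
    · exact e1.differentiableAt.mdifferentiableAt.comp x
        (mdifferentiableAt_extChartAt (mem_chart_source H x))
  have h4 : mvfderiv J (fun b => fderiv ℝ g (φ x, ψ b) ((u : E), (0 : E'))) y v =
      fderiv ℝ (fderiv ℝ g) (φ x, ψ y) ((0 : E), (v : E')) ((u : E), (0 : E')) := by
    have e1 := (h0 ((u : E), (0 : E'))).comp (ψ y) (hasFDerivAt_prodMk_right (𝕜 := ℝ) (φ x) (ψ y))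
    rw [mvfderiv_eq_fderiv]
    · refine congrArg (fun L : E' →L[ℝ] F => L v) (Eq.trans ?_ e1.fderiv)
      refine Filter.EventuallyEq.fderiv_eq ?_
      filter_upwards [extChartAt_target_mem_nhds (I := J) y] with c hc
      simp only [Function.comp]
      rw [ψ.right_inv hc]
    · exact e1.differentiableAt.mdifferentiableAt.comp y
        (mdifferentiableAt_extChartAt (mem_chart_source H' y))
  rw [mvfderiv_congr h1, mvfderiv_congr h2, h3, h4]
  exact hgc.isSymmSndFDerivAt (by simpa using ENat.LEInfty.out) _ _

/-- In a chart, V(Wf) is D²f(V, W) + Df(DW · V); the second-order parts cancel by symmetry of D²f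
and the rest is Df of the bracket. This links the chart definition of the bracket to
multiderivations of functions. -/
theorem mvfderiv_mlieBracket [I.Boundaryless] [CompleteSpace E] [IsManifold I ∞ M]
    {f : M → F} {x : M} {V W : (x : M) → TangentSpace I x}
    (hf : ContMDiffAt I 𝓘(ℝ, F) ∞ f x)
    (hV : MDifferentiableAt I I.tangent (fun y => (V y : TangentBundle I M)) x)
    (hW : MDifferentiableAt I I.tangent (fun y => (W y : TangentBundle I M)) x) :
    mvfderiv I f x (mlieBracket I V W x) =
      mvfderiv I (fun y => mvfderiv I f y (W y)) x (V x) -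
        mvfderiv I (fun y => mvfderiv I f y (V y)) x (W x) := by
  have hI1 : IsManifold I 1 M := .of_le (n := ∞) (by simp)
  have hI2 : IsManifold I 2 M := .of_le (n := ∞) ENat.LEInfty.out
  set φ := extChartAt I x
  set V' : E → E := fun a => (mfderivWithin 𝓘(ℝ, E) I φ.symm (range I) a).inverse (V (φ.symm a))
    with hV'
  set W' : E → E := fun a => (mfderivWithin 𝓘(ℝ, E) I φ.symm (range I) a).inverse (W (φ.symm a))
    with hW'
  set g : E → F := fun a => f (φ.symm a)
  have hxx : φ.symm (φ x) = x := extChartAt_to_inv x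
  have hgc : ContDiffAt ℝ ∞ g (φ x) := by
    rw [← contMDiffAt_iff_contDiffAt]
    exact hf.comp_of_eq ((contMDiffOn_extChartAt_symm x).contMDiffAt
      (extChartAt_target_mem_nhds x)) hxx
  have hVd : DifferentiableAt ℝ V' (φ x) := by
    rw [← mdifferentiableWithinAt_univ] at hV
    exact hV.differentiableWithinAt_mpullbackWithin_vectorField.differentiableAt
      (by simp [I.range_eq_univ])
  have hWd : DifferentiableAt ℝ W' (φ x) := by
    rw [← mdifferentiableWithinAt_univ] at hW
    exact hW.differentiableWithinAt_mpullbackWithin_vectorField.differentiableAt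
      (by simp [I.range_eq_univ])
  have hfd : ∀ᶠ y in 𝓝 x, MDifferentiableAt I 𝓘(ℝ, F) f y :=
    ((contMDiffAt_iff_contMDiffAt_nhds (by simp)).1 (hf.of_le (m := 1) (by simp))).mono
      fun y hy => hy.mdifferentiableAt (by simp)
  have hxt : φ x ∈ φ.target := mem_extChartAt_target x
  have hs : ∀ a ∈ φ.target, MDifferentiableAt 𝓘(ℝ, E) I φ.symm a := fun a ha =>
    ((contMDiffOn_extChartAt_symm (n := 1) x).contMDiffAt
      (extChartAt_target_mem_nhds' ha)).mdifferentiableAt (by simp)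
  have key : ∀ (U : (x : M) → TangentSpace I x), ∀ᶠ a in 𝓝 (φ x),
      mvfderiv I f (φ.symm a) (U (φ.symm a)) = fderiv ℝ g a
        ((mfderivWithin 𝓘(ℝ, E) I φ.symm (range I) a).inverse (U (φ.symm a)) : E) := by
    intro U
    have hc : Tendsto φ.symm (𝓝 (φ x)) (𝓝 x) := by
      have := (continuousAt_extChartAt_symm (I := I) x).tendsto
      rwa [extChartAt_to_inv] at this
    filter_upwards [hc.eventually hfd, extChartAt_target_mem_nhds (I := I) x] with a ha hat
    have h1 := mvfderiv_comp_apply' (J := 𝓘(ℝ, E)) a ha (hs a hat) rfl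
      ((mfderivWithin 𝓘(ℝ, E) I φ.symm (range I) a).inverse (U (φ.symm a)))
    have h2 : mfderiv 𝓘(ℝ, E) I φ.symm a
        ((mfderivWithin 𝓘(ℝ, E) I φ.symm (range I) a).inverse (U (φ.symm a))) =
        U (φ.symm a) := by
      rw [I.range_eq_univ, mfderivWithin_univ]
      have h3 := isInvertible_mfderivWithin_extChartAt_symm (I := I) hat
      rw [I.range_eq_univ, mfderivWithin_univ] at h3
      exact h3.self_apply_inverse _
    refine ((congrArg (mvfderiv I f (φ.symm a)) h2).symm.trans h1.symm).trans ?_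
    exact congrArg (fun L : E →L[ℝ] F => L _) (mfderiv_eq_fderiv (f := g) (x := a))
  -- The tangent space at `x` is identified with `E` through the preferred chart at `x`, so the
  -- pulled-back fields have the values of `V` and `W` themselves at the centre.
  have hL : (mfderivWithin 𝓘(ℝ, E) I φ.symm (range I) (φ x)).inverse =
      (ContinuousLinearMap.id ℝ E : E →L[ℝ] E) := by
    have h1 := mfderivWithin_extChartAt_symm_comp_mfderiv_extChartAt (I := I) hxt
    have h2 := mfderiv_extChartAt_comp_mfderivWithin_extChartAt_symm (I := I) hxt
    rw [ContinuousLinearMap.inverse_eq h1 h2, hxx]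
    exact mfderiv_extChartAt_self
  have hat : ∀ U : (x : M) → TangentSpace I x,
      (mfderivWithin 𝓘(ℝ, E) I φ.symm (range I) (φ x)).inverse (U (φ.symm (φ x))) = (U x : E) := by
    intro U
    have h1 : (U (φ.symm (φ x)) : E) = U x := by rw [hxx]
    exact (congrArg (fun L : E →L[ℝ] E => L (U (φ.symm (φ x)))) hL).trans h1
  have hg' : DifferentiableAt ℝ (fderiv ℝ g) (φ x) :=
    (hgc.fderiv_right (m := ∞) (by simp)).differentiableAt (by simp)
  have second : ∀ (U Z : (x : M) → TangentSpace I x) (U' : E → E),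
      (U' = fun a => (mfderivWithin 𝓘(ℝ, E) I φ.symm (range I) a).inverse (U (φ.symm a))) →
      DifferentiableAt ℝ U' (φ x) →
      mvfderiv I (fun y => mvfderiv I f y (U y)) x (Z x) =
        fderiv ℝ (fderiv ℝ g) (φ x) (Z x : E) (U x : E) +
          fderiv ℝ g (φ x) (fderiv ℝ U' (φ x) (Z x : E)) := by
    intro U Z U' hU hUd
    have e1 := hg'.hasFDerivAt.clm_apply hUd.hasFDerivAt
    have e2 : (fun y => mvfderiv I f y (U y)) =ᶠ[𝓝 x] fun y => fderiv ℝ g (φ y) (U' (φ y)) := by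
      filter_upwards [(continuousAt_extChartAt x).eventually (key U),
        extChartAt_source_mem_nhds (I := I) x] with y hy hys
      subst hU
      refine Eq.trans ?_ hy
      rw [φ.left_inv hys]
    rw [mvfderiv_congr e2, mvfderiv_comp_apply' (f := φ) (I := 𝓘(ℝ, E)) (y := φ x)
      (g := fun a => fderiv ℝ g a (U' a)) x e1.differentiableAt.mdifferentiableAt
      (mdifferentiableAt_extChartAt (mem_chart_source H x)) rfl]
    have e3 : (mfderiv I 𝓘(ℝ, E) φ x (Z x) : E) = Z x :=
      congrArg (fun L : E →L[ℝ] E => L (Z x)) (mfderiv_extChartAt_self (I := I) (x := x))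
    refine ((congrArg (mvfderiv 𝓘(ℝ, E) (fun a => fderiv ℝ g a (U' a)) (φ x)) e3).trans
      (congrArg (fun L : E →L[ℝ] F => L (Z x)) (mfderiv_eq_fderiv.trans e1.fderiv))).trans ?_
    have e4 : U' (φ x) = U x := by subst hU; exact hat U
    rw [← e4, add_comm]
    rfl
  have hfin : mvfderiv I f x (mlieBracket I V W x) =
      fderiv ℝ g (φ x) (fderiv ℝ W' (φ x) (V x : E) - fderiv ℝ V' (φ x) (W x : E)) := by
    rw [mvfderiv_eq_fderiv hfd.self_of_nhds]
    refine congrArg (fderiv ℝ g (φ x)) ?_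
    rw [mlieBracket, mlieBracketWithin_apply, mfderiv_extChartAt_self,
      preimage_univ, univ_inter]
    have e1 : lieBracketWithin ℝ V' W' univ (φ x) =
        fderiv ℝ W' (φ x) (V x : E) - fderiv ℝ V' (φ x) (W x : E) := by
      rw [lieBracketWithin_univ, lieBracket_eq]
      have e2 : V' (φ x) = V x := hat V
      have e3 : W' (φ x) = W x := hat W
      rw [← e2, ← e3]
    refine (congrArg (fun L : E →L[ℝ] E => L _) ContinuousLinearMap.inverse_id).trans ?_
    refine Eq.trans ?_ e1
    have e4 := I.range_eq_univ
    exact congrArg (fun s => lieBracketWithin ℝ V' W' s (φ x)) e4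
  rw [second W V W' hW' hWd, second V W V' hV' hVd, hfin, map_sub,
    hgc.isSymmSndFDerivAt (by simpa using ENat.LEInfty.out) (V x : E) (W x : E)]
  abel

/-- A chart ball is convex, so the function is constant on it; local constancy and connectedness
finish the argument. -/
theorem eq_of_mvfderiv_eq_zero [I.Boundaryless] [PreconnectedSpace M] [IsManifold I ∞ M]
    {f : M → F} (hf : MDifferentiable I 𝓘(ℝ, F) f) (h : ∀ x, mvfderiv I f x = 0) (x y : M) :
    f x = f y := by
  have hI1 : IsManifold I 1 M := .of_le (n := ∞) (by simp)
  refine IsLocallyConstant.apply_eq_of_preconnectedSpace ?_ x y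
  rw [IsLocallyConstant.iff_eventually_eq]
  intro x
  set φ := extChartAt I x
  obtain ⟨r, hr, hb⟩ := Metric.isOpen_iff.1 (isOpen_extChartAt_target (I := I) x) (φ x)
    (mem_extChartAt_target x)
  have h0 : ∀ a ∈ Metric.ball (φ x) r, HasFDerivAt (fun a => f (φ.symm a)) (0 : E →L[ℝ] F) a := by
    intro a ha
    have e1 : MDifferentiableAt 𝓘(ℝ, E) I φ.symm a :=
      ((contMDiffOn_extChartAt_symm (n := 1) x).contMDiffAt
        (extChartAt_target_mem_nhds' (hb ha))).mdifferentiableAt (by simp)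
    have e2 := ((hf (φ.symm a)).comp a e1).hasMFDerivAt.hasFDerivAt
    have e3 : (mfderiv 𝓘(ℝ, E) 𝓘(ℝ, F) (f ∘ φ.symm) a : E →L[ℝ] F) = 0 := by
      ext v
      have := mvfderiv_comp_apply' a (hf (φ.symm a)) e1 rfl v
      rw [h] at this
      exact this
    exact e3 ▸ e2
  have hball : ∀ᶠ y in 𝓝 x, φ y ∈ Metric.ball (φ x) r :=
    (continuousAt_extChartAt x).eventually (Metric.ball_mem_nhds _ hr)
  filter_upwards [hball, extChartAt_source_mem_nhds (I := I) x] with y hy hys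
  have := (convex_ball (φ x) r).is_const_of_fderivWithin_eq_zero (𝕜 := ℝ)
    (f := fun a => f (φ.symm a)) (fun a ha => (h0 a ha).differentiableAt.differentiableWithinAt)
    (fun a ha => by
      rw [fderivWithin_of_isOpen Metric.isOpen_ball ha]; exact (h0 a ha).fderiv) hy
      (Metric.mem_ball_self hr)
  rwa [φ.left_inv hys, extChartAt_to_inv] at this

end Calculus

open Set Filter Topology

/-! ### Reindexing of antisymmetrised and iterated sums -/

theorem sum_perm_sign_mul_comp {n : ℕ} (τ : Equiv.Perm (Fin n)) (t : Equiv.Perm (Fin n) → ℝ) :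
    ∑ σ, ((Equiv.Perm.sign σ : ℤ) : ℝ) * t (σ * τ) =
      ((Equiv.Perm.sign τ : ℤ) : ℝ) * ∑ σ, ((Equiv.Perm.sign σ : ℤ) : ℝ) * t σ := by
  rw [Finset.mul_sum, ← Equiv.sum_comp (Equiv.mulRight τ)
    fun σ => ((Equiv.Perm.sign τ : ℤ) : ℝ) * (((Equiv.Perm.sign σ : ℤ) : ℝ) * t σ)]
  refine Finset.sum_congr rfl fun σ _ => ?_
  have h : ((Equiv.Perm.sign τ : ℤ) : ℝ) * ((Equiv.Perm.sign τ : ℤ) : ℝ) = 1 := by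
    norm_cast; rw [Int.units_mul_self]; rfl
  simp only [Equiv.coe_mulRight, Equiv.Perm.sign_mul, Units.val_mul, Int.cast_mul]
  linear_combination (-((Equiv.Perm.sign σ : ℤ) : ℝ) * t (σ * τ)) * h

theorem sum_four_reverse {κ : Type*} [Fintype κ] (t : κ → κ → κ → κ → ℝ) :
    ∑ a, ∑ b, ∑ c, ∑ d, t a b c d = ∑ a, ∑ b, ∑ c, ∑ d, t d c b a := by
  calc _ = ∑ b, ∑ a, ∑ c, ∑ d, t a b c d := Finset.sum_comm
    _ = ∑ b, ∑ c, ∑ a, ∑ d, t a b c d := Finset.sum_congr rfl fun _ _ => Finset.sum_comm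
    _ = ∑ b, ∑ c, ∑ d, ∑ a, t a b c d := Finset.sum_congr rfl fun _ _ =>
      Finset.sum_congr rfl fun _ _ => Finset.sum_comm
    _ = ∑ c, ∑ b, ∑ d, ∑ a, t a b c d := Finset.sum_comm
    _ = ∑ c, ∑ d, ∑ b, ∑ a, t a b c d := Finset.sum_congr rfl fun _ _ => Finset.sum_comm
    _ = ∑ d, ∑ c, ∑ b, ∑ a, t a b c d := Finset.sum_comm

theorem sum_three_swap {κ : Type*} [Fintype κ] (t : κ → κ → κ → ℝ) :
    ∑ i, ∑ j, ∑ k, t i j k = ∑ i, ∑ j, ∑ k, t j i k :=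
  Finset.sum_comm

theorem sum_three_rotate {κ : Type*} [Fintype κ] (t : κ → κ → κ → ℝ) :
    ∑ i, ∑ j, ∑ k, t i j k = ∑ i, ∑ j, ∑ k, t k i j :=
  Finset.sum_comm.trans (Finset.sum_congr rfl fun _ _ => Finset.sum_comm)

theorem sum_two_three_comm {κ κ' : Type*} [Fintype κ] [Fintype κ'] (t : κ → κ → κ' → κ' → κ' → ℝ) :
    ∑ a, ∑ b, ∑ i, ∑ j, ∑ k, t a b i j k = ∑ i, ∑ j, ∑ k, ∑ a, ∑ b, t a b i j k := by
  have h : ∀ s : κ → κ' → κ' → κ' → ℝ, ∑ b, ∑ i, ∑ j, ∑ k, s b i j k =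
      ∑ i, ∑ j, ∑ k, ∑ b, s b i j k := fun s =>
    Finset.sum_comm.trans (Finset.sum_congr rfl fun _ _ => Finset.sum_comm.trans
      (Finset.sum_congr rfl fun _ _ => Finset.sum_comm))
  rw [Finset.sum_congr rfl fun a _ => h (t a)]
  exact h fun a i j k => ∑ b, t a b i j k

/-! ### Schouten brackets of multivector fields with constant coefficients in given fields -/

section Fields

variable {E : Type*} [NormedAddCommGroup E] [NormedSpace ℝ E] {H : Type*} [TopologicalSpace H]
  {I : ModelWithCorners ℝ E H} {M : Type*} [TopologicalSpace M] [ChartedSpace H M]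

/-- The derivative `V f` of a function along a vector field. -/
def fieldDeriv (V : (x : M) → TangentSpace I x) (f : M → ℝ) (x : M) : ℝ :=
  differential I f x (V x)

/-- A vector field that maps local smooth functions to local smooth functions. -/
def IsSmoothField (V : (x : M) → TangentSpace I x) : Prop :=
  ∀ U : Set M, IsOpen U → ∀ f : M → ℝ, ContMDiffOn I 𝓘(ℝ, ℝ) ∞ f U →
    ContMDiffOn I 𝓘(ℝ, ℝ) ∞ (fieldDeriv V f) U

theorem mdifferentiableAt_of_contMDiffOn {U : Set M} (hU : IsOpen U) {f : M → ℝ}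
    (hf : ContMDiffOn I 𝓘(ℝ, ℝ) ∞ f U) {x : M} (hx : x ∈ U) : MDifferentiableAt I 𝓘(ℝ, ℝ) f x :=
  (hf.contMDiffAt (hU.mem_nhds hx)).mdifferentiableAt (by simp)

theorem fieldDeriv_mul (V : (x : M) → TangentSpace I x) {f g : M → ℝ} {x : M}
    (hf : MDifferentiableAt I 𝓘(ℝ, ℝ) f x) (hg : MDifferentiableAt I 𝓘(ℝ, ℝ) g x) :
    fieldDeriv V (fun y => f y * g y) x = fieldDeriv V f x * g x + f x * fieldDeriv V g x := by
  have h := mvfderiv_mul hf hg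
  have h2 := congrArg (fun L : TangentSpace I x →L[ℝ] ℝ => L (V x)) h
  refine h2.trans ?_
  simp only [add_apply, smul_apply, smul_eq_mul]
  simp only [fieldDeriv, differential, ContinuousLinearMap.coe_coe]
  ring

theorem mdifferentiableAt_sum {α : Type*} (s : Finset α) {f : α → M → ℝ} {x : M}
    (hf : ∀ i ∈ s, MDifferentiableAt I 𝓘(ℝ, ℝ) (f i) x) :
    MDifferentiableAt I 𝓘(ℝ, ℝ) (fun y => ∑ i ∈ s, f i y) x ∧
      ∀ V : (x : M) → TangentSpace I x,
        fieldDeriv V (fun y => ∑ i ∈ s, f i y) x = ∑ i ∈ s, fieldDeriv V (f i) x := by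
  classical
  induction s using Finset.induction_on with
  | empty =>
    simp only [Finset.sum_empty]
    refine ⟨mdifferentiableAt_const, fun V => ?_⟩
    have := mvfderiv_const (I := I) (x := x) (0 : ℝ)
    exact congrArg (fun L : TangentSpace I x →L[ℝ] ℝ => L (V x)) this
  | insert a s ha ih =>
    obtain ⟨h1, h2⟩ := ih fun i hi => hf i (Finset.mem_insert_of_mem hi)
    have h3 := hf a (Finset.mem_insert_self a s)
    simp only [Finset.sum_insert ha]
    refine ⟨h3.add h1, fun V => ?_⟩
    have := mvfderiv_add h3 h1
    rw [← h2 V]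
    exact congrArg (fun L : TangentSpace I x →L[ℝ] ℝ => L (V x)) this

theorem fieldDeriv_const_mul (V : (x : M) → TangentSpace I x) (c : ℝ) {f : M → ℝ} {x : M}
    (hf : MDifferentiableAt I 𝓘(ℝ, ℝ) f x) :
    fieldDeriv V (fun y => c * f y) x = c * fieldDeriv V f x := by
  rw [fieldDeriv_mul V mdifferentiableAt_const hf]
  have : fieldDeriv V (fun _ => c) x = 0 := by
    have := mvfderiv_const (I := I) (x := x) c
    exact congrArg (fun L : TangentSpace I x →L[ℝ] ℝ => L (V x)) this
  rw [this]; ring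

variable {κ κ' : Type*} [Fintype κ] [Fintype κ'] {X : κ → (x : M) → TangentSpace I x} {m : κ → κ → ℝ}
  {Y : κ' → (x : M) → TangentSpace I x} {q : κ' → κ' → κ' → ℝ}
  {P : MultivectorField I M 2} {Q : MultivectorField I M 3}

theorem isSmooth_bivector (hX : ∀ a, IsSmoothField (X a))
    (hP : ∀ x δ, P x δ = ∑ a, ∑ b, m a b * (δ 0 (X a x) * δ 1 (X b x))) : P.IsSmooth := by
  intro U hU f hf
  have : P.apply f = fun x => ∑ a, ∑ b, m a b * (fieldDeriv (X a) (f 0) x * fieldDeriv (X b) (f 1) x) :=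
    funext fun x => hP x _
  rw [this]
  refine contMDiffOn_finsetSum fun a _ => contMDiffOn_finsetSum fun b _ => ?_
  exact contMDiffOn_const.mul ((hX a U hU _ (hf 0)).mul (hX b U hU _ (hf 1)))

/-- The Leibniz rule leaves terms with one iterated derivative. Since `m` is constant and
antisymmetric, these terms pair up under antisymmetrisation into commutators of the fields `X a`,
whatever linear relations hold between them. -/
theorem schouten_bivector_self (hX : ∀ a, IsSmoothField (X a)) (hm : ∀ a b, m a b = -m b a)
    (hP : ∀ x δ, P x δ = ∑ a, ∑ b, m a b * (δ 0 (X a x) * δ 1 (X b x)))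
    {U : Set M} (hU : IsOpen U) {f : Fin 3 → M → ℝ} (hf : ∀ i, ContMDiffOn I 𝓘(ℝ, ℝ) ∞ (f i) U)
    {x : M} (hx : x ∈ U) :
    schouten (k := 1) (l := 1) P P f x = ∑ σ : Equiv.Perm (Fin 3), ((Equiv.Perm.sign σ : ℤ) : ℝ) *
      ∑ a, ∑ b, ∑ c, ∑ d, m a b * m c d * (fieldDeriv (X a) (f (σ 0)) x *
        (fieldDeriv (X b) (fieldDeriv (X c) (f (σ 1))) x -
          fieldDeriv (X c) (fieldDeriv (X b) (f (σ 1))) x) * fieldDeriv (X d) (f (σ 2)) x) := by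
  have hPa : ∀ g : Fin 2 → M → ℝ, P.apply g = fun x =>
      ∑ a, ∑ b, m a b * (fieldDeriv (X a) (g 0) x * fieldDeriv (X b) (g 1) x) :=
    fun g => funext fun x => hP x _
  have hd : ∀ a i, MDifferentiableAt I 𝓘(ℝ, ℝ) (fieldDeriv (X a) (f i)) x := fun a i =>
    mdifferentiableAt_of_contMDiffOn hU (hX a U hU _ (hf i)) hx
  have hPd : ∀ b i j, fieldDeriv (X b) (fun x =>
      ∑ c, ∑ d, m c d * (fieldDeriv (X c) (f i) x * fieldDeriv (X d) (f j) x)) x =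
      ∑ c, ∑ d, m c d * (fieldDeriv (X b) (fieldDeriv (X c) (f i)) x * fieldDeriv (X d) (f j) x +
        fieldDeriv (X c) (f i) x * fieldDeriv (X b) (fieldDeriv (X d) (f j)) x) := by
    intro b i j
    have h1 : ∀ c d, MDifferentiableAt I 𝓘(ℝ, ℝ)
        (fun x => fieldDeriv (X c) (f i) x * fieldDeriv (X d) (f j) x) x :=
      fun c d => (hd c i).mul (hd d j)
    have h2 : ∀ c d, MDifferentiableAt I 𝓘(ℝ, ℝ)
        (fun x => m c d * (fieldDeriv (X c) (f i) x * fieldDeriv (X d) (f j) x)) x :=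
      fun c d => mdifferentiableAt_const.mul (h1 c d)
    rw [(mdifferentiableAt_sum _ fun c _ => (mdifferentiableAt_sum _ fun d _ => h2 c d).1).2]
    refine Finset.sum_congr rfl fun c _ => ?_
    rw [(mdifferentiableAt_sum _ fun d _ => h2 c d).2]
    refine Finset.sum_congr rfl fun d _ => ?_
    rw [fieldDeriv_const_mul _ _ (h1 c d), fieldDeriv_mul _ (hd c i) (hd d j)]
  set t : Equiv.Perm (Fin 3) → ℝ := fun σ => ∑ a, ∑ b, ∑ c, ∑ d, m a b * m c d *
    (fieldDeriv (X a) (f (σ 0)) x * fieldDeriv (X b) (fieldDeriv (X c) (f (σ 1))) x *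
      fieldDeriv (X d) (f (σ 2)) x) with ht
  -- The factor is 1/(1!·2!). The two summands come from the derivative hitting either factor of the
  -- inner bracket, made alike by antisymmetry of `m`.
  have hins : ∀ h : 1 + (1 + 1) = 3, insertion h P P f x =
      2⁻¹ * ∑ σ : Equiv.Perm (Fin 3), ((Equiv.Perm.sign σ : ℤ) : ℝ) *
        (t σ - t (σ * Equiv.swap 1 2)) := by
    intro h
    unfold insertion
    congr 1
    · simp
    refine Finset.sum_congr rfl fun σ _ => ?_
    congr 1
    have h0 : Fin.cast h (Fin.castAdd (1 + 1) (0 : Fin 1)) = 0 := rfl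
    have h1 : Fin.cast h (Fin.natAdd 1 (0 : Fin 2)) = 1 := rfl
    have h2 : Fin.cast h (Fin.natAdd 1 (1 : Fin 2)) = 2 := rfl
    have h4 : ∀ (F : Fin 1 → M → ℝ) (G : M → ℝ), P.apply (Fin.snoc (α := fun _ => M → ℝ) F G) x =
        ∑ a, ∑ b, m a b * (fieldDeriv (X a) (F 0) x * fieldDeriv (X b) G x) :=
      fun F G => congrFun (hPa _) x
    rw [h4, hPa]
    simp only [h0, h1, h2, hPd, ht, Equiv.Perm.mul_apply, Equiv.swap_apply_left,
      Equiv.swap_apply_right, Equiv.swap_apply_of_ne_of_ne (show (0 : Fin 3) ≠ 1 by decide)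
        (show (0 : Fin 3) ≠ 2 by decide), Finset.mul_sum]
    simp only [← Finset.sum_sub_distrib]
    refine Finset.sum_congr rfl fun a _ => Finset.sum_congr rfl fun b _ => ?_
    simp only [mul_add, Finset.sum_add_distrib, sub_eq_add_neg]
    congr 1
    · refine Finset.sum_congr rfl fun c _ => Finset.sum_congr rfl fun d _ => ?_
      ring
    · rw [Finset.sum_comm]
      refine Finset.sum_congr rfl fun d _ => Finset.sum_congr rfl fun c _ => ?_
      rw [hm c d]
      ring
  -- Reading the four indices backwards changes two signs and exchanges the outer slots, so the
  -- second half of the commutator is `t` at a transposed permutation.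
  have h3 : ∀ σ, ∑ a, ∑ b, ∑ c, ∑ d, m a b * m c d * (fieldDeriv (X a) (f (σ 0)) x *
        (fieldDeriv (X b) (fieldDeriv (X c) (f (σ 1))) x -
          fieldDeriv (X c) (fieldDeriv (X b) (f (σ 1))) x) * fieldDeriv (X d) (f (σ 2)) x) =
      t σ - t (σ * Equiv.swap 0 2) := by
    intro σ
    simp only [ht, Equiv.Perm.mul_apply, Equiv.swap_apply_left, Equiv.swap_apply_right,
      Equiv.swap_apply_of_ne_of_ne (show (1 : Fin 3) ≠ 0 by decide)
        (show (1 : Fin 3) ≠ 2 by decide)]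
    rw [sum_four_reverse fun a b c d => m a b * m c d * (fieldDeriv (X a) (f (σ 2)) x *
      fieldDeriv (X b) (fieldDeriv (X c) (f (σ 1))) x * fieldDeriv (X d) (f (σ 0)) x)]
    simp only [← Finset.sum_sub_distrib]
    refine Finset.sum_congr rfl fun a _ => Finset.sum_congr rfl fun b _ =>
      Finset.sum_congr rfl fun c _ => Finset.sum_congr rfl fun d _ => ?_
    rw [hm d c, hm b a]
    ring
  have e1 := sum_perm_sign_mul_comp (Equiv.swap (1 : Fin 3) 2) t
  have e2 := sum_perm_sign_mul_comp (Equiv.swap (0 : Fin 3) 2) t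
  rw [Equiv.Perm.sign_swap (by decide)] at e1 e2
  rw [Finset.sum_congr rfl fun σ _ => congrArg (_ * ·) (h3 σ)]
  -- Both transpositions are odd, and -(-1)^{kl} = 1 for k = l = 1, so both sides equal 2 ∑ sgn(σ)
  -- t(σ).
  simp only [schouten, hins, mul_sub, Finset.sum_sub_distrib, e1, e2]
  simp
  ring

/-- The hypothesis `hinv` says that the Lie derivative of P along each `Y k` vanishes. It lets a
derivative Y_k of P(f, g) be moved onto the arguments, after which Q ∘ P and P ∘ Q are multiples of
the same antisymmetrised sum. -/
theorem schouten_bivector_trivector (hX : ∀ a, IsSmoothField (X a)) (hY : ∀ i, IsSmoothField (Y i))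
    (hP : ∀ x δ, P x δ = ∑ a, ∑ b, m a b * (δ 0 (X a x) * δ 1 (X b x)))
    (hQ : ∀ x δ, Q x δ = ∑ i, ∑ j, ∑ k, q i j k * (δ 0 (Y i x) * δ 1 (Y j x) * δ 2 (Y k x)))
    (hq : ∀ i j k, q i j k = -q j i k) (hq' : ∀ i j k, q i j k = q j k i)
    {U : Set M} (hU : IsOpen U)
    (hinv : ∀ f g : M → ℝ, ContMDiffOn I 𝓘(ℝ, ℝ) ∞ f U → ContMDiffOn I 𝓘(ℝ, ℝ) ∞ g U →
      ∀ x ∈ U, ∀ k, ∑ a, ∑ b, m a b *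
        (fieldDeriv (Y k) (fieldDeriv (X a) f) x * fieldDeriv (X b) g x +
          fieldDeriv (X a) f x * fieldDeriv (Y k) (fieldDeriv (X b) g) x) =
        ∑ a, ∑ b, m a b * (fieldDeriv (X a) (fieldDeriv (Y k) f) x * fieldDeriv (X b) g x +
          fieldDeriv (X a) f x * fieldDeriv (X b) (fieldDeriv (Y k) g) x))
    (hm : ∀ a b, m a b = -m b a)
    {f : Fin 4 → M → ℝ} (hf : ∀ i, ContMDiffOn I 𝓘(ℝ, ℝ) ∞ (f i) U) {x : M} (hx : x ∈ U) :
    schouten (k := 1) (l := 2) P Q f x = 0 := by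
  have hPa : ∀ g : Fin 2 → M → ℝ, P.apply g = fun x =>
      ∑ a, ∑ b, m a b * (fieldDeriv (X a) (g 0) x * fieldDeriv (X b) (g 1) x) :=
    fun g => funext fun x => hP x _
  have hQa : ∀ g : Fin 3 → M → ℝ, Q.apply g = fun x =>
      ∑ i, ∑ j, ∑ k, q i j k *
        (fieldDeriv (Y i) (g 0) x * fieldDeriv (Y j) (g 1) x * fieldDeriv (Y k) (g 2) x) :=
    fun g => funext fun x => hQ x _
  have hd : ∀ a i, MDifferentiableAt I 𝓘(ℝ, ℝ) (fieldDeriv (X a) (f i)) x := fun a i =>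
    mdifferentiableAt_of_contMDiffOn hU (hX a U hU _ (hf i)) hx
  have hdY : ∀ a i, MDifferentiableAt I 𝓘(ℝ, ℝ) (fieldDeriv (Y a) (f i)) x := fun a i =>
    mdifferentiableAt_of_contMDiffOn hU (hY a U hU _ (hf i)) hx
  have hPd : ∀ V : (x : M) → TangentSpace I x, ∀ i j, fieldDeriv V (fun x =>
      ∑ c, ∑ d, m c d * (fieldDeriv (X c) (f i) x * fieldDeriv (X d) (f j) x)) x =
      ∑ c, ∑ d, m c d * (fieldDeriv V (fieldDeriv (X c) (f i)) x * fieldDeriv (X d) (f j) x +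
        fieldDeriv (X c) (f i) x * fieldDeriv V (fieldDeriv (X d) (f j)) x) := by
    intro V i j
    have h1 : ∀ c d, MDifferentiableAt I 𝓘(ℝ, ℝ)
        (fun x => fieldDeriv (X c) (f i) x * fieldDeriv (X d) (f j) x) x :=
      fun c d => (hd c i).mul (hd d j)
    have h2 : ∀ c d, MDifferentiableAt I 𝓘(ℝ, ℝ)
        (fun x => m c d * (fieldDeriv (X c) (f i) x * fieldDeriv (X d) (f j) x)) x :=
      fun c d => mdifferentiableAt_const.mul (h1 c d)
    rw [(mdifferentiableAt_sum _ fun c _ => (mdifferentiableAt_sum _ fun d _ => h2 c d).1).2]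
    refine Finset.sum_congr rfl fun c _ => ?_
    rw [(mdifferentiableAt_sum _ fun d _ => h2 c d).2]
    refine Finset.sum_congr rfl fun d _ => ?_
    rw [fieldDeriv_const_mul _ _ (h1 c d), fieldDeriv_mul _ (hd c i) (hd d j)]
  have hQd : ∀ V : (x : M) → TangentSpace I x, ∀ r s t, fieldDeriv V (fun x =>
      ∑ i, ∑ j, ∑ k, q i j k *
        (fieldDeriv (Y i) (f r) x * fieldDeriv (Y j) (f s) x * fieldDeriv (Y k) (f t) x)) x =
      ∑ i, ∑ j, ∑ k, q i j k * (fieldDeriv V (fieldDeriv (Y i) (f r)) x *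
          fieldDeriv (Y j) (f s) x * fieldDeriv (Y k) (f t) x +
        fieldDeriv (Y i) (f r) x * fieldDeriv V (fieldDeriv (Y j) (f s)) x *
          fieldDeriv (Y k) (f t) x +
        fieldDeriv (Y i) (f r) x * fieldDeriv (Y j) (f s) x *
          fieldDeriv V (fieldDeriv (Y k) (f t)) x) := by
    intro V r s t
    have h0 : ∀ i j, MDifferentiableAt I 𝓘(ℝ, ℝ)
        (fun x => fieldDeriv (Y i) (f r) x * fieldDeriv (Y j) (f s) x) x :=
      fun i j => (hdY i r).mul (hdY j s)
    have h1 : ∀ i j k, MDifferentiableAt I 𝓘(ℝ, ℝ) (fun x => fieldDeriv (Y i) (f r) x *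
        fieldDeriv (Y j) (f s) x * fieldDeriv (Y k) (f t) x) x :=
      fun i j k => (h0 i j).mul (hdY k t)
    have h2 : ∀ i j k, MDifferentiableAt I 𝓘(ℝ, ℝ) (fun x => q i j k * (fieldDeriv (Y i) (f r) x *
        fieldDeriv (Y j) (f s) x * fieldDeriv (Y k) (f t) x)) x :=
      fun i j k => mdifferentiableAt_const.mul (h1 i j k)
    have h3 := fun i j => mdifferentiableAt_sum Finset.univ fun k _ => h2 i j k
    have h4 := fun i => mdifferentiableAt_sum Finset.univ fun j _ => (h3 i j).1
    rw [(mdifferentiableAt_sum _ fun i _ => (h4 i).1).2]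
    refine Finset.sum_congr rfl fun i _ => ?_
    rw [(h4 i).2]
    refine Finset.sum_congr rfl fun j _ => ?_
    rw [(h3 i j).2]
    refine Finset.sum_congr rfl fun k _ => ?_
    rw [fieldDeriv_const_mul _ _ (h1 i j k), fieldDeriv_mul _ (h0 i j) (hdY k t),
      fieldDeriv_mul _ (hdY i r) (hdY j s)]
    ring
  -- `p r s k` is P(f_r, Y_k f_s), and `w` is the one type of term to which both compositions
  -- reduce.
  set p : Fin 4 → Fin 4 → κ' → ℝ := fun r s k => ∑ a, ∑ b, m a b *
    (fieldDeriv (X a) (f r) x * fieldDeriv (X b) (fieldDeriv (Y k) (f s)) x) with hp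
  set w : Equiv.Perm (Fin 4) → ℝ := fun σ => ∑ i, ∑ j, ∑ k, q i j k *
    (p (σ 0) (σ 1) i * fieldDeriv (Y j) (f (σ 2)) x * fieldDeriv (Y k) (f (σ 3)) x) with hw
  set τ₁ : Equiv.Perm (Fin 4) := Equiv.swap 1 2
  set τ₂ : Equiv.Perm (Fin 4) := Equiv.swap 1 2 * Equiv.swap 1 3
  set τ₃ : Equiv.Perm (Fin 4) := Equiv.swap 0 2 * Equiv.swap 1 3
  set τ₄ : Equiv.Perm (Fin 4) := Equiv.swap 2 3 * τ₃
  -- The factor is 1/(1!·3!). The derivative hits one of three factors, and the symmetries of `q`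
  -- bring that factor to the first slot.
  have hPQ : ∀ h : 1 + (2 + 1) = 4, insertion h P Q f x =
      6⁻¹ * ∑ σ : Equiv.Perm (Fin 4), ((Equiv.Perm.sign σ : ℤ) : ℝ) *
        (w σ - w (σ * τ₁) + w (σ * τ₂)) := by
    intro h
    unfold insertion
    congr 1
    · simp [Nat.factorial]
    refine Finset.sum_congr rfl fun σ _ => ?_
    congr 1
    have h0 : Fin.cast h (Fin.castAdd (2 + 1) (0 : Fin 1)) = 0 := rfl
    have h1 : Fin.cast h (Fin.natAdd 1 (0 : Fin 3)) = 1 := rfl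
    have h2 : Fin.cast h (Fin.natAdd 1 (1 : Fin 3)) = 2 := rfl
    have h3 : Fin.cast h (Fin.natAdd 1 (2 : Fin 3)) = 3 := rfl
    have h4 : ∀ (F : Fin 1 → M → ℝ) (G : M → ℝ), P.apply (Fin.snoc (α := fun _ => M → ℝ) F G) x =
        ∑ a, ∑ b, m a b * (fieldDeriv (X a) (F 0) x * fieldDeriv (X b) G x) :=
      fun F G => congrFun (hPa _) x
    have v1 : (σ * τ₁) 0 = σ 0 ∧ (σ * τ₁) 1 = σ 2 ∧ (σ * τ₁) 2 = σ 1 ∧ (σ * τ₁) 3 = σ 3 :=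
      ⟨congrArg σ (by decide), congrArg σ (by decide), congrArg σ (by decide),
        congrArg σ (by decide)⟩
    have v2 : (σ * τ₂) 0 = σ 0 ∧ (σ * τ₂) 1 = σ 3 ∧ (σ * τ₂) 2 = σ 1 ∧ (σ * τ₂) 3 = σ 2 :=
      ⟨congrArg σ (by decide), congrArg σ (by decide), congrArg σ (by decide),
        congrArg σ (by decide)⟩
    rw [h4, hQa]
    simp only [h0, h1, h2, h3, hQd, hw, v1, v2]
    rw [sum_three_swap fun i j k => q i j k * (p (σ 0) (σ 2) i * fieldDeriv (Y j) (f (σ 1)) x *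
      fieldDeriv (Y k) (f (σ 3)) x),
      sum_three_rotate fun i j k => q i j k * (p (σ 0) (σ 3) i * fieldDeriv (Y j) (f (σ 1)) x *
      fieldDeriv (Y k) (f (σ 2)) x)]
    simp only [hp, Finset.mul_sum, Finset.sum_mul, ← Finset.sum_sub_distrib,
      ← Finset.sum_add_distrib]
    rw [sum_two_three_comm]
    refine Finset.sum_congr rfl fun i _ => Finset.sum_congr rfl fun j _ =>
      Finset.sum_congr rfl fun k _ => Finset.sum_congr rfl fun a _ =>
      Finset.sum_congr rfl fun b _ => ?_
    rw [hq j i k, ← hq' k i j]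
    ring
  have hQP : ∀ h : 2 + (1 + 1) = 4, insertion h Q P f x =
      4⁻¹ * ∑ σ : Equiv.Perm (Fin 4), ((Equiv.Perm.sign σ : ℤ) : ℝ) *
        (w (σ * τ₃) - w (σ * τ₄)) := by
    intro h
    unfold insertion
    congr 1
    · norm_num [Nat.factorial]
    refine Finset.sum_congr rfl fun σ _ => ?_
    congr 1
    have h0 : Fin.cast h (Fin.castAdd (1 + 1) (0 : Fin 2)) = 0 := rfl
    have h1 : Fin.cast h (Fin.castAdd (1 + 1) (1 : Fin 2)) = 1 := rfl
    have h2 : Fin.cast h (Fin.natAdd 2 (0 : Fin 2)) = 2 := rfl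
    have h3 : Fin.cast h (Fin.natAdd 2 (1 : Fin 2)) = 3 := rfl
    have h4 : ∀ (F : Fin 2 → M → ℝ) (G : M → ℝ), Q.apply (Fin.snoc (α := fun _ => M → ℝ) F G) x =
        ∑ i, ∑ j, ∑ k, q i j k * (fieldDeriv (Y i) (F 0) x * fieldDeriv (Y j) (F 1) x *
          fieldDeriv (Y k) G x) :=
      fun F G => congrFun (hQa _) x
    have v1 : (σ * τ₃) 0 = σ 2 ∧ (σ * τ₃) 1 = σ 3 ∧ (σ * τ₃) 2 = σ 0 ∧ (σ * τ₃) 3 = σ 1 :=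
      ⟨congrArg σ (by decide), congrArg σ (by decide), congrArg σ (by decide),
        congrArg σ (by decide)⟩
    have v2 : (σ * τ₄) 0 = σ 3 ∧ (σ * τ₄) 1 = σ 2 ∧ (σ * τ₄) 2 = σ 0 ∧ (σ * τ₄) 3 = σ 1 :=
      ⟨congrArg σ (by decide), congrArg σ (by decide), congrArg σ (by decide),
        congrArg σ (by decide)⟩
    -- This is P(Y_k f, g) + P(f, Y_k g), the first term rewritten with the antisymmetry of `m`.
    have hpk : ∀ k, ∑ a, ∑ b, m a b *
        (fieldDeriv (X a) (fieldDeriv (Y k) (f (σ 2))) x * fieldDeriv (X b) (f (σ 3)) x +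
          fieldDeriv (X a) (f (σ 2)) x * fieldDeriv (X b) (fieldDeriv (Y k) (f (σ 3))) x) =
        p (σ 2) (σ 3) k - p (σ 3) (σ 2) k := by
      intro k
      have h5 : p (σ 3) (σ 2) k = ∑ a, ∑ b, m b a *
          (fieldDeriv (X b) (f (σ 3)) x * fieldDeriv (X a) (fieldDeriv (Y k) (f (σ 2))) x) :=
        Finset.sum_comm
      rw [h5, hp]
      simp only [← Finset.sum_sub_distrib]
      refine Finset.sum_congr rfl fun a _ => Finset.sum_congr rfl fun b _ => ?_
      rw [hm b a]
      ring
    rw [h4, hPa]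
    simp only [h0, h1, h2, h3, hPd, hinv _ _ (hf _) (hf _) x hx, hpk, hw, v1, v2]
    rw [sum_three_rotate fun i j k => q i j k * (p (σ 2) (σ 3) i * fieldDeriv (Y j) (f (σ 0)) x *
      fieldDeriv (Y k) (f (σ 1)) x),
      sum_three_rotate fun i j k => q i j k * (p (σ 3) (σ 2) i * fieldDeriv (Y j) (f (σ 0)) x *
      fieldDeriv (Y k) (f (σ 1)) x)]
    simp only [← Finset.sum_sub_distrib]
    refine Finset.sum_congr rfl fun i _ => Finset.sum_congr rfl fun j _ =>
      Finset.sum_congr rfl fun k _ => ?_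
    rw [← hq' k i j]
    ring
  have e1 := sum_perm_sign_mul_comp τ₁ w
  have e2 := sum_perm_sign_mul_comp τ₂ w
  have e3 := sum_perm_sign_mul_comp τ₃ w
  have e4 := sum_perm_sign_mul_comp τ₄ w
  have s1 : Equiv.Perm.sign τ₁ = -1 := by decide
  have s2 : Equiv.Perm.sign τ₂ = 1 := by decide
  have s3 : Equiv.Perm.sign τ₃ = 1 := by decide
  have s4 : Equiv.Perm.sign τ₄ = -1 := by decide
  rw [s1] at e1
  rw [s2] at e2
  rw [s3] at e3
  rw [s4] at e4
  -- After reindexing, P ∘ Q carries the factor 3/6 and Q ∘ P the factor 2/4; since kl = 2 is even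
  -- they are subtracted.
  simp only [schouten, hPQ, hQP, mul_sub, mul_add, Finset.sum_sub_distrib, Finset.sum_add_distrib,
    e1, e2, e3, e4]
  simp
  ring

end Fields

/-! ### Vector fields generated by maps Φ : N × G → N, and their commutators -/

section ActionFields

variable {E : Type*} [NormedAddCommGroup E] [NormedSpace ℝ E] {H : Type*} [TopologicalSpace H]
  {I : ModelWithCorners ℝ E H} {G : Type*} [TopologicalSpace G] [ChartedSpace H G] [Group G]
  {E' : Type*} [NormedAddCommGroup E'] [NormedSpace ℝ E'] {H' : Type*} [TopologicalSpace H']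
  {J : ModelWithCorners ℝ E' H'} {N : Type*} [TopologicalSpace N] [ChartedSpace H' N]
  {F : Type*} [NormedAddCommGroup F] [NormedSpace ℝ F]

variable (I J) in
/-- The linear map `𝔤 → T_p N` given by the derivative of `h ↦ Φ p h` at `1`, where `Φ p 1 = p`. -/
def actionMap (Φ : N → G → N) (p : N) : GroupLieAlgebra I G →L[ℝ] TangentSpace J p :=
  (mfderiv I J (Φ p) (1 : G) : TangentSpace I (1 : G) →L[ℝ] TangentSpace J (Φ p 1))

theorem mulInvariantVectorField_one (u : GroupLieAlgebra I G) :
    (mulInvariantVectorField u (1 : G) : E) = u := by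
  have h : (fun x : G => (1 : G) * x) = id := by ext; simp
  have h2 : (mfderiv I I (fun x : G => (1 : G) * x) (1 : G) : E →L[ℝ] E) =
      ContinuousLinearMap.id ℝ E := by
    rw [h]; exact mfderiv_id
  exact congrArg (fun L : E →L[ℝ] E => L u) h2

variable [LieGroup I ∞ G]

/-- The bracket of the Lie algebra as a commutator of derivatives of functions. -/
theorem mvfderiv_lie [I.Boundaryless] [CompleteSpace E] {f : G → F}
    (hf : ContMDiffAt I 𝓘(ℝ, F) ∞ f 1) (u v : GroupLieAlgebra I G) :
    mvfderiv I f 1 ⁅u, v⁆ =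
      mvfderiv I (fun h => mvfderiv I (fun k => f (h * k)) 1 v) 1 u -
        mvfderiv I (fun h => mvfderiv I (fun k => f (h * k)) 1 u) 1 v := by
  have hI1 : IsManifold I 1 G := .of_le (n := ∞) (by simp)
  have hfd : ∀ᶠ y in 𝓝 (1 : G), MDifferentiableAt I 𝓘(ℝ, F) f y :=
    ((contMDiffAt_iff_contMDiffAt_nhds (by simp)).1 (hf.of_le (m := 1) (by simp))).mono
      fun y hy => hy.mdifferentiableAt (by simp)
  have key : ∀ w : GroupLieAlgebra I G, (fun h => mvfderiv I (fun k => f (h * k)) 1 w) =ᶠ[𝓝 (1 : G)]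
      fun h => mvfderiv I f h (mulInvariantVectorField w h) := by
    intro w
    filter_upwards [hfd] with h hh
    exact mvfderiv_comp_apply' (f := fun k => h * k) 1 hh
      ((contMDiff_mul_left (I := I) (n := ∞)).contMDiffAt.mdifferentiableAt (by simp)) (mul_one h) w
  rw [mvfderiv_congr (key u), mvfderiv_congr (key v), GroupLieAlgebra.bracket_def,
    mvfderiv_mlieBracket hf (mdifferentiableAt_mulInvariantVectorField u)
      (mdifferentiableAt_mulInvariantVectorField v)]
  congr 1
  · exact congrArg (mvfderiv I _ 1) (mulInvariantVectorField_one u)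
  · exact congrArg (mvfderiv I _ 1) (mulInvariantVectorField_one v)

variable {Φ Ψ : N → G → N} (hΦ : ContMDiff (J.prod I) J ∞ (Function.uncurry Φ))
  (hΦ1 : ∀ p, Φ p 1 = p) (hΨ : ContMDiff (J.prod I) J ∞ (Function.uncurry Ψ))
  (hΨ1 : ∀ p, Ψ p 1 = p)

omit [Group G] [LieGroup I ∞ G] in
include hΦ in
theorem contMDiff_action_right (p : N) : ContMDiff I J ∞ (Φ p) :=
  hΦ.comp (contMDiff_const.prodMk contMDiff_id)

omit [LieGroup I ∞ G] in
include hΦ hΦ1 in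
theorem mvfderiv_actionMap {f : N → F} {p : N} (hf : MDifferentiableAt J 𝓘(ℝ, F) f p)
    (u : GroupLieAlgebra I G) :
    mvfderiv J f p (actionMap I J Φ p u) = mvfderiv I (fun h => f (Φ p h)) 1 u :=
  (mvfderiv_comp_apply' (f := Φ p) 1 hf
    ((contMDiff_action_right hΦ p).contMDiffAt.mdifferentiableAt (by simp)) (hΦ1 p) u).symm

variable {U : Set N} (hU : IsOpen U) {f : N → ℝ} (hf : ContMDiffOn J 𝓘(ℝ, ℝ) ∞ f U)

omit [LieGroup I ∞ G] in
include hΦ hΦ1 hU hf in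
theorem fieldDeriv_actionMap {p : N} (hp : p ∈ U) (u : GroupLieAlgebra I G) :
    fieldDeriv (fun p => actionMap I J Φ p u) f p = mvfderiv I (fun h => f (Φ p h)) 1 u :=
  mvfderiv_actionMap hΦ hΦ1 (mdifferentiableAt_of_contMDiffOn hU hf hp) u

include hΦ hΦ1 hU hf in
theorem contMDiffOn_fieldDeriv_actionMap [IsManifold J ∞ N] (u : GroupLieAlgebra I G) :
    ContMDiffOn J 𝓘(ℝ, ℝ) ∞ (fieldDeriv (fun p => actionMap I J Φ p u) f) U := by
  intro p hp
  have h : ContMDiffAt J 𝓘(ℝ, ℝ) ∞ (fun p => mvfderiv I (fun h => f (Φ p h)) 1 u) p :=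
    contMDiffAt_mvfderiv_param (f := fun p h => f (Φ p h))
      (ContMDiffAt.comp_of_eq (hf.contMDiffAt (hU.mem_nhds hp)) hΦ.contMDiffAt (hΦ1 p)) u
  refine (h.congr_of_eventuallyEq ?_).contMDiffWithinAt
  filter_upwards [hU.mem_nhds hp] with y hy
  exact fieldDeriv_actionMap hΦ hΦ1 hU hf hy u

include hΦ hΦ1 in
theorem isSmoothField_actionMap [IsManifold J ∞ N] (u : GroupLieAlgebra I G) :
    IsSmoothField fun p => actionMap I J Φ p u :=
  fun _ hU _ hf => contMDiffOn_fieldDeriv_actionMap hΦ hΦ1 hU hf u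

include hΦ hΦ1 hΨ hΨ1 hU hf in
-- Iterated derivatives along generated fields become mixed derivatives at (1, 1) of a function on G
-- × G, so no bracket on `N` ever has to be computed.
theorem fieldDeriv_fieldDeriv_actionMap [IsManifold J ∞ N] {p : N} (hp : p ∈ U)
    (u v : GroupLieAlgebra I G) :
    fieldDeriv (fun p => actionMap I J Φ p u) (fieldDeriv (fun p => actionMap I J Ψ p v) f) p =
      mvfderiv I (fun h => mvfderiv I (fun k => f (Ψ (Φ p h) k)) 1 v) 1 u := by
  rw [fieldDeriv_actionMap hΦ hΦ1 hU (contMDiffOn_fieldDeriv_actionMap hΨ hΨ1 hU hf v) hp]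
  refine congrArg (fun L : E →L[ℝ] ℝ => L u) (mvfderiv_congr ?_)
  have h1 : ∀ᶠ h in 𝓝 (1 : G), Φ p h ∈ U :=
    (contMDiff_action_right hΦ p).continuous.continuousAt.eventually
      (hU.mem_nhds (by rw [hΦ1]; exact hp))
  filter_upwards [h1] with h hh
  exact fieldDeriv_actionMap hΨ hΨ1 hU hf hh v

include hΦ hΦ1 hΨ hΨ1 hU hf in
theorem fieldDeriv_comm_of_commute [I.Boundaryless] [IsManifold J ∞ N]
    (hcomm : ∀ p h k, Ψ (Φ p h) k = Φ (Ψ p k) h) {p : N} (hp : p ∈ U) (u v : GroupLieAlgebra I G) :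
    fieldDeriv (fun p => actionMap I J Φ p u) (fieldDeriv (fun p => actionMap I J Ψ p v) f) p =
      fieldDeriv (fun p => actionMap I J Ψ p v) (fieldDeriv (fun p => actionMap I J Φ p u) f) p := by
  rw [fieldDeriv_fieldDeriv_actionMap hΦ hΦ1 hΨ hΨ1 hU hf hp,
    fieldDeriv_fieldDeriv_actionMap hΨ hΨ1 hΦ hΦ1 hU hf hp]
  simp only [← hcomm]
  refine mvfderiv_comm (f := fun h k => f (Ψ (Φ p h) k)) ?_ u v
  have h1 : ContMDiff (I.prod I) J ∞ fun q : G × G => Ψ (Φ p q.1) q.2 :=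
    hΨ.comp ((hΦ.comp (contMDiff_const.prodMk contMDiff_fst)).prodMk contMDiff_snd)
  exact ContMDiffAt.comp_of_eq (hf.contMDiffAt (hU.mem_nhds hp)) h1.contMDiffAt
    (by simp [hΦ1, hΨ1])

include hΦ hΦ1 hU hf in
-- For a right action the function on G × G depends only on h * k, and `mvfderiv_lie` applies to h ↦
-- f(Φ p h).
theorem fieldDeriv_comm_of_rightAction [I.Boundaryless] [CompleteSpace E] [IsManifold J ∞ N]
    (hact : ∀ p h k, Φ (Φ p h) k = Φ p (h * k)) {p : N} (hp : p ∈ U) (u v : GroupLieAlgebra I G) :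
    fieldDeriv (fun p => actionMap I J Φ p u) (fieldDeriv (fun p => actionMap I J Φ p v) f) p -
      fieldDeriv (fun p => actionMap I J Φ p v) (fieldDeriv (fun p => actionMap I J Φ p u) f) p =
      fieldDeriv (fun p => actionMap I J Φ p ⁅u, v⁆) f p := by
  rw [fieldDeriv_fieldDeriv_actionMap hΦ hΦ1 hΦ hΦ1 hU hf hp,
    fieldDeriv_fieldDeriv_actionMap hΦ hΦ1 hΦ hΦ1 hU hf hp, fieldDeriv_actionMap hΦ hΦ1 hU hf hp]
  simp only [hact]
  refine (mvfderiv_lie (f := fun h => f (Φ p h)) ?_ u v).symm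
  exact ContMDiffAt.comp_of_eq (hf.contMDiffAt (hU.mem_nhds hp))
    (contMDiff_action_right hΦ p).contMDiffAt (hΦ1 p)

include hΦ hΦ1 hU hf in
-- The function now depends on k * h; exchanging the mixed partials gives the right-action formula
-- with u and v interchanged, whence the sign.
theorem fieldDeriv_comm_of_leftAction [I.Boundaryless] [CompleteSpace E] [IsManifold J ∞ N]
    (hact : ∀ p h k, Φ (Φ p h) k = Φ p (k * h)) {p : N} (hp : p ∈ U) (u v : GroupLieAlgebra I G) :
    fieldDeriv (fun p => actionMap I J Φ p u) (fieldDeriv (fun p => actionMap I J Φ p v) f) p -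
      fieldDeriv (fun p => actionMap I J Φ p v) (fieldDeriv (fun p => actionMap I J Φ p u) f) p =
      -fieldDeriv (fun p => actionMap I J Φ p ⁅u, v⁆) f p := by
  rw [fieldDeriv_fieldDeriv_actionMap hΦ hΦ1 hΦ hΦ1 hU hf hp,
    fieldDeriv_fieldDeriv_actionMap hΦ hΦ1 hΦ hΦ1 hU hf hp, fieldDeriv_actionMap hΦ hΦ1 hU hf hp]
  simp only [hact]
  have hs : ContMDiffAt I 𝓘(ℝ, ℝ) ∞ (fun h => f (Φ p h)) 1 :=
    ContMDiffAt.comp_of_eq (hf.contMDiffAt (hU.mem_nhds hp))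
      (contMDiff_action_right hΦ p).contMDiffAt (hΦ1 p)
  have hm : ContMDiffAt (I.prod I) 𝓘(ℝ, ℝ) ∞
      (Function.uncurry fun h k : G => f (Φ p (k * h))) (1, 1) :=
    ContMDiffAt.comp_of_eq (g := fun h => f (Φ p h)) (f := fun q : G × G => q.2 * q.1) hs
      (contMDiff_snd.mul contMDiff_fst).contMDiffAt (by simp)
  rw [mvfderiv_comm (f := fun h k : G => f (Φ p (k * h))) hm u v,
    mvfderiv_comm (f := fun h k : G => f (Φ p (k * h))) hm v u, mvfderiv_lie hs u v]
  abel

end ActionFields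

/-! ### The adjoint action and the Ad-invariance of K -/

section Adjoint

variable {E : Type*} [NormedAddCommGroup E] [NormedSpace ℝ E] {H : Type*} [TopologicalSpace H]
  {I : ModelWithCorners ℝ E H}
  {F : Type*} [NormedAddCommGroup F] [NormedSpace ℝ F]
  {F' : Type*} [NormedAddCommGroup F'] [NormedSpace ℝ F']

/-- The chain rule along the diagonal. It is the general Leibniz rule, used to separate several
occurrences of one group variable. -/
theorem mvfderiv_diag {M : Type*} [TopologicalSpace M] [ChartedSpace H M]
    {f : M → M → F} {x : M} (hf : MDifferentiableAt (I.prod I) 𝓘(ℝ, F) (Function.uncurry f) (x, x))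
    (w : TangentSpace I x) :
    mvfderiv I (fun y => f y y) x w =
      mvfderiv I (fun y => f y x) x w + mvfderiv I (fun y => f x y) x w := by
  have h1 : MDifferentiableAt I (I.prod I) (fun y : M => (y, y)) x :=
    mdifferentiableAt_id.prodMk mdifferentiableAt_id
  refine (mvfderiv_comp_apply' (f := fun y : M => (y, y)) (g := Function.uncurry f) x hf h1 rfl
    w).trans ?_
  have h2 : (mfderiv I (I.prod I) (fun y : M => (y, y)) x w : E × E) = (w, w) := by
    have h3 := mfderiv_prodMk (I := I) (I' := I) (I'' := I) (x := x) (f := fun y : M => y)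
      (g := fun y : M => y) mdifferentiableAt_id mdifferentiableAt_id
    have h4 : (mfderiv I I (fun y : M => y) x : E →L[ℝ] E) = ContinuousLinearMap.id ℝ E := mfderiv_id
    have h5 : (mfderiv I (I.prod I) (fun y : M => (y, y)) x : E →L[ℝ] E × E) =
      (ContinuousLinearMap.id ℝ E).prod (ContinuousLinearMap.id ℝ E) := by
      refine h3.trans ?_
      exact congrArg₂ (fun A B : E →L[ℝ] E => A.prod B) h4 h4
    exact congrArg (fun L : E →L[ℝ] E × E => L w) h5
  refine (congrArg (mvfderiv (I.prod I) (Function.uncurry f) (x, x)) h2).trans ?_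
  exact mfderiv_prod_eq_add_apply (I := I) (I' := I) (I'' := 𝓘(ℝ, F)) (v := ((w, w) : E × E)) hf

theorem mvfderiv_clm_comp {M : Type*} [TopologicalSpace M] [ChartedSpace H M] (L : F →L[ℝ] F')
    {f : M → F} {x : M} (hf : MDifferentiableAt I 𝓘(ℝ, F) f x) (w : TangentSpace I x) :
    mvfderiv I (fun y => L (f y)) x w = L (mvfderiv I f x w) := by
  rw [mvfderiv_comp_apply' (f := f) (g := L) (I := 𝓘(ℝ, F)) x
    L.differentiableAt.mdifferentiableAt hf rfl w]
  have h : (mvfderiv 𝓘(ℝ, F) L (f x) : F →L[ℝ] F') = L := mfderiv_eq_fderiv.trans L.fderiv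
  exact congrArg (fun A : F →L[ℝ] F' => A (mvfderiv I f x w)) h

theorem mvfderiv_bilinear {M : Type*} [TopologicalSpace M] [ChartedSpace H M]
    (B : F →L[ℝ] F →L[ℝ] F') {p q : M → F} {x : M} (hp : MDifferentiableAt I 𝓘(ℝ, F) p x)
    (hq : MDifferentiableAt I 𝓘(ℝ, F) q x) (w : TangentSpace I x) :
    mvfderiv I (fun y => B (p y) (q y)) x w =
      B (mvfderiv I p x w) (q x) + B (p x) (mvfderiv I q x w) := by
  have h1 : MDifferentiableAt (I.prod I) 𝓘(ℝ, F')
      (Function.uncurry fun y z : M => B (p y) (q z)) (x, x) := by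
    have h2 : MDifferentiableAt (I.prod I) 𝓘(ℝ, F →L[ℝ] F') (fun y : M × M => B (p y.1)) (x, x) :=
      MDifferentiableAt.comp (g := fun y => B (p y)) (f := Prod.fst) (x, x)
        (B.differentiableAt.mdifferentiableAt.comp x hp) mdifferentiableAt_fst
    exact h2.clm_apply (MDifferentiableAt.comp (f := Prod.snd) (x, x) hq mdifferentiableAt_snd)
  rw [mvfderiv_diag h1, mvfderiv_clm_comp (B (p x)) hq]
  congr 1
  exact mvfderiv_clm_comp (B.flip (q x)) hp w

variable {G : Type*} [TopologicalSpace G] [ChartedSpace H G] [Group G] [LieGroup I ∞ G]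

theorem contMDiff_conj (g : G) : ContMDiff I I ∞ fun h : G => g * h * g⁻¹ :=
  (contMDiff_const.mul contMDiff_id).mul contMDiff_const

theorem mvfderiv_adjointAction {f : G → F} (hf : MDifferentiableAt I 𝓘(ℝ, F) f 1) (g : G)
    (u : GroupLieAlgebra I G) :
    mvfderiv I f 1 (adjointAction I g u) = mvfderiv I (fun h => f (g * h * g⁻¹)) 1 u :=
  (mvfderiv_comp_apply' (f := fun h : G => g * h * g⁻¹) 1 hf
    ((contMDiff_conj g).contMDiffAt.mdifferentiableAt (by simp)) (by simp) u).symm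

theorem mvfderiv_extChartAt_one (u : GroupLieAlgebra I G) :
    mvfderiv I (extChartAt I (1 : G)) 1 u = (u : E) := by
  have : IsManifold I 1 G := .of_le (n := ∞) (by simp)
  exact congrArg (fun L : E →L[ℝ] E => L u) (mfderiv_extChartAt_self (I := I) (x := (1 : G)))

omit [LieGroup I ∞ G] in
theorem contMDiffAt_extChartAt_one : ContMDiffAt I 𝓘(ℝ, E) ∞ (extChartAt I (1 : G)) 1 :=
  contMDiffAt_extChartAt

omit [LieGroup I ∞ G] in
theorem mdifferentiableAt_extChartAt_one :
    MDifferentiableAt I 𝓘(ℝ, E) (extChartAt I (1 : G)) 1 :=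
  contMDiffAt_extChartAt_one.mdifferentiableAt (by simp)

/-- The chart at 1 serves as an E-valued test function, so identities in 𝔤 reduce to derivatives of
functions. -/
theorem eq_of_mvfderiv_extChartAt_one {u v : GroupLieAlgebra I G}
    (h : mvfderiv I (extChartAt I (1 : G)) 1 u = mvfderiv I (extChartAt I (1 : G)) 1 v) : u = v := by
  rw [mvfderiv_extChartAt_one, mvfderiv_extChartAt_one] at h
  exact h

/-- The map `g ↦ Ad_g u` with values in the model vector space. -/
def adjointOrbit (u : GroupLieAlgebra I G) (g : G) : E := adjointAction I g u

theorem adjointAction_eq (g : G) (u : GroupLieAlgebra I G) :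
    (adjointAction I g u : E) = mvfderiv I (fun h => extChartAt I (1 : G) (g * h * g⁻¹)) 1 u := by
  rw [← mvfderiv_adjointAction mdifferentiableAt_extChartAt_one, mvfderiv_extChartAt_one]

theorem adjointAction_mul (g h : G) (u : GroupLieAlgebra I G) :
    adjointAction I (g * h) u = adjointAction I g (adjointAction I h u) := by
  have hd : MDifferentiableAt I 𝓘(ℝ, E) (fun k => extChartAt I (1 : G) (g * k * g⁻¹)) 1 :=
    MDifferentiableAt.comp_of_eq (x := (1 : G)) mdifferentiableAt_extChartAt_one
      ((contMDiff_conj g).contMDiffAt.mdifferentiableAt (by simp)) (by simp)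
  refine (adjointAction_eq (I := I) (g * h) u).trans
    (Eq.trans ?_ (adjointAction_eq (I := I) g (adjointAction I h u)).symm)
  rw [mvfderiv_adjointAction hd]
  simp only [mul_inv_rev, mul_assoc]
  rfl

theorem adjointAction_one (u : GroupLieAlgebra I G) : adjointAction I (1 : G) u = u := by
  refine (adjointAction_eq (I := I) (1 : G) u).trans ?_
  simp only [one_mul, inv_one, mul_one]
  exact mvfderiv_extChartAt_one u

theorem adjointAction_adjointAction_inv (g : G) (u : GroupLieAlgebra I G) :
    adjointAction I g (adjointAction I g⁻¹ u) = u := by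
  rw [← adjointAction_mul, mul_inv_cancel, adjointAction_one]

theorem eventually_mdifferentiableAt {M : Type*} [TopologicalSpace M] [ChartedSpace H M]
    [IsManifold I ∞ M] {f : M → F} {x : M} (hf : ContMDiffAt I 𝓘(ℝ, F) ∞ f x) :
    ∀ᶠ y in 𝓝 x, MDifferentiableAt I 𝓘(ℝ, F) f y := by
  have : IsManifold I 1 M := .of_le (n := ∞) (by simp)
  exact ((contMDiffAt_iff_contMDiffAt_nhds (by simp)).1 (hf.of_le (m := 1) (by simp))).mono
    fun y hy => hy.mdifferentiableAt (by simp)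

theorem mvfderiv_mvfderiv_adjointAction {f : G → F} (hf : ContMDiffAt I 𝓘(ℝ, F) ∞ f 1) (g : G)
    (u v : GroupLieAlgebra I G) :
    mvfderiv I (fun h => mvfderiv I (fun k => f (h * k)) 1 (adjointAction I g v)) 1
        (adjointAction I g u) =
      mvfderiv I (fun h => mvfderiv I (fun k => f (g * (h * k) * g⁻¹)) 1 v) 1 u := by
  have h1 : ContMDiffAt (I.prod I) 𝓘(ℝ, F) ∞ (Function.uncurry fun h k : G => f (h * k)) (1, 1) :=
    ContMDiffAt.comp_of_eq (f := fun q : G × G => q.1 * q.2) hf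
      (contMDiff_fst.mul contMDiff_snd).contMDiffAt (by simp)
  rw [mvfderiv_adjointAction ((contMDiffAt_mvfderiv_param h1 _).mdifferentiableAt (by simp))]
  refine congrArg (fun L : E →L[ℝ] F => L u) (mvfderiv_congr ?_)
  have h2 : Tendsto (fun h : G => g * h * g⁻¹) (𝓝 1) (𝓝 1) := by
    have := (contMDiff_conj (I := I) g).continuous.tendsto 1
    simpa using this
  filter_upwards [h2.eventually (eventually_mdifferentiableAt hf)] with h hh
  have h3 : MDifferentiableAt I 𝓘(ℝ, F) (fun k => f (g * h * g⁻¹ * k)) 1 :=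
    MDifferentiableAt.comp_of_eq (x := (1 : G)) hh
      ((contMDiff_mul_left (I := I) (n := ∞)).contMDiffAt.mdifferentiableAt (by simp)) (by simp)
  rw [mvfderiv_adjointAction h3]
  simp only [mul_assoc, inv_mul_cancel_left]

/-- Conjugation is an automorphism: both sides are antisymmetrised second derivatives of (h, k) ↦
ψ(g h k g⁻¹), with ψ the chart at 1. -/
theorem adjointAction_lie [I.Boundaryless] [CompleteSpace E] (g : G) (u v : GroupLieAlgebra I G) :
    adjointAction I g ⁅u, v⁆ = ⁅adjointAction I g u, adjointAction I g v⁆ := by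
  refine eq_of_mvfderiv_extChartAt_one ?_
  have hs : ContMDiffAt I 𝓘(ℝ, E) ∞ (fun k => extChartAt I (1 : G) (g * k * g⁻¹)) 1 :=
    ContMDiffAt.comp_of_eq (x := (1 : G)) contMDiffAt_extChartAt_one
      (contMDiff_conj g).contMDiffAt (by simp)
  rw [mvfderiv_adjointAction mdifferentiableAt_extChartAt_one, mvfderiv_lie hs,
    mvfderiv_lie contMDiffAt_extChartAt_one,
    mvfderiv_mvfderiv_adjointAction contMDiffAt_extChartAt_one,
    mvfderiv_mvfderiv_adjointAction contMDiffAt_extChartAt_one]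

theorem contMDiff_adjointOrbit (u : GroupLieAlgebra I G) :
    ContMDiff I 𝓘(ℝ, E) ∞ (adjointOrbit u : G → E) := by
  intro g
  have h : (adjointOrbit u : G → E) = fun g =>
      mvfderiv I (fun h => extChartAt I (1 : G) (g * h * g⁻¹)) 1 u :=
    funext fun g => adjointAction_eq g u
  rw [h]
  refine contMDiffAt_mvfderiv_param (f := fun g h : G => extChartAt I (1 : G) (g * h * g⁻¹)) ?_ u
  exact ContMDiffAt.comp_of_eq (f := fun q : G × G => q.1 * q.2 * q.1⁻¹)
    contMDiffAt_extChartAt_one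
    ((contMDiff_fst.mul contMDiff_snd).mul contMDiff_fst.inv).contMDiffAt (by simp)

/-- Differentiate the constant function f(h h⁻¹) along the diagonal. -/
theorem mvfderiv_comp_inv {f : G → F} (hf : ContMDiffAt I 𝓘(ℝ, F) ∞ f 1)
    (w : GroupLieAlgebra I G) :
    mvfderiv I (fun h => f h⁻¹) 1 w = -mvfderiv I f 1 w := by
  have h1 : ContMDiffAt (I.prod I) 𝓘(ℝ, F) ∞ (Function.uncurry fun h k : G => f (h * k⁻¹)) (1, 1) :=
    ContMDiffAt.comp_of_eq (f := fun q : G × G => q.1 * q.2⁻¹) hf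
      (contMDiff_fst.mul contMDiff_snd.inv).contMDiffAt (by simp)
  have h2 := mvfderiv_diag (h1.mdifferentiableAt (by simp)) w
  simp only [mul_inv_cancel, inv_one, mul_one, one_mul] at h2
  have h3 : mvfderiv I (fun _ : G => f 1) 1 w = 0 :=
    congrArg (fun L : E →L[ℝ] F => L w) (mvfderiv_const (I := I) (x := (1 : G)) (f 1))
  rw [h3] at h2
  exact (neg_eq_of_add_eq_zero_right h2.symm).symm

/-- The derivative of Ad at 1 is ad. -/
theorem mvfderiv_adjointOrbit_one [I.Boundaryless] [CompleteSpace E] (u w : GroupLieAlgebra I G) :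
    mvfderiv I (adjointOrbit u : G → E) 1 w = (⁅w, u⁆ : GroupLieAlgebra I G) := by
  set ψ : G → E := (extChartAt I (1 : G) : G → E)
  have hψs : ContMDiffAt I 𝓘(ℝ, E) ∞ ψ 1 := contMDiffAt_extChartAt_one
  have h : (adjointOrbit u : G → E) = fun g =>
      mvfderiv I (fun h => ψ (g * h * g⁻¹)) 1 u :=
    funext fun g => adjointAction_eq g u
  rw [h]
  -- The two occurrences of g in g k g⁻¹ are separated as `a` and `b`: the first gives the term w u
  -- of the bracket, the second, through the inverse and an exchange of partials, the term -u w.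
  have h1 : ContMDiffAt (I.prod I) 𝓘(ℝ, E) ∞
      (Function.uncurry fun a b : G => mvfderiv I (fun k => ψ (a * k * b⁻¹)) 1 u) (1, 1) := by
    refine contMDiffAt_mvfderiv_param (J := I.prod I)
      (f := fun (q : G × G) (k : G) => ψ (q.1 * k * q.2⁻¹)) ?_ u
    exact ContMDiffAt.comp_of_eq (f := fun q : (G × G) × G => q.1.1 * q.2 * q.1.2⁻¹) hψs
      (((contMDiff_fst.comp contMDiff_fst).mul contMDiff_snd).mul
        (contMDiff_snd.comp contMDiff_fst).inv).contMDiffAt (by simp)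
  have h2 : ContMDiffAt (I.prod I) 𝓘(ℝ, E) ∞ (Function.uncurry fun b k : G => ψ (k * b)) (1, 1) :=
    ContMDiffAt.comp_of_eq (f := fun q : G × G => q.2 * q.1) hψs
      (contMDiff_snd.mul contMDiff_fst).contMDiffAt (by simp)
  rw [mvfderiv_diag (f := fun a b : G => mvfderiv I (fun k => ψ (a * k * b⁻¹)) 1 u)
    (h1.mdifferentiableAt (by simp))]
  simp only [inv_one, mul_one, one_mul]
  rw [mvfderiv_comp_inv (f := fun b : G => mvfderiv I (fun k => ψ (k * b)) 1 u)
    (contMDiffAt_mvfderiv_param h2 u), mvfderiv_comm (f := fun b k : G => ψ (k * b)) h2 w u,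
    ← sub_eq_add_neg, ← mvfderiv_lie hψs w u]
  exact mvfderiv_extChartAt_one _

/-- The derivative of K(Ad_g u, Ad_g v) at g = 1 is K([w,u],v) + K(u,[w,v]) = 0. Translation carries
this to every point, and connectedness of G makes the function constant. -/
theorem bilinForm_adjointAction [I.Boundaryless] [FiniteDimensional ℝ E] [PreconnectedSpace G]
    (K : LinearMap.BilinForm ℝ (GroupLieAlgebra I G)) (hinv : ∀ x y z, K ⁅x, y⁆ z = K x ⁅y, z⁆)
    (g : G) (u v : GroupLieAlgebra I G) :
    K (adjointAction I g u) (adjointAction I g v) = K u v := by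
  have : CompleteSpace E := FiniteDimensional.complete ℝ E
  let B : E →L[ℝ] E →L[ℝ] ℝ := LinearMap.toContinuousBilinearMap (𝕜 := ℝ) (E := E) (F := E) K
  have hs : ∀ u v : GroupLieAlgebra I G, ContMDiff I 𝓘(ℝ, ℝ) ∞
      fun g : G => K (adjointAction I g u) (adjointAction I g v) := fun u v =>
    ContMDiff.clm_apply (B.contMDiff.comp (contMDiff_adjointOrbit u)) (contMDiff_adjointOrbit v)
  have h1 : ∀ u v w : GroupLieAlgebra I G,
      mvfderiv I (fun g : G => K (adjointAction I g u) (adjointAction I g v)) 1 w = 0 := by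
    intro u v w
    have h2 := mvfderiv_bilinear (I := I) (x := (1 : G)) B
      (p := adjointOrbit u) (q := adjointOrbit v)
      ((contMDiff_adjointOrbit u).contMDiffAt.mdifferentiableAt (by simp))
      ((contMDiff_adjointOrbit v).contMDiffAt.mdifferentiableAt (by simp)) w
    refine h2.trans ?_
    rw [mvfderiv_adjointOrbit_one, mvfderiv_adjointOrbit_one]
    have h3 : ∀ u : GroupLieAlgebra I G, (adjointOrbit u (1 : G) : E) = u := adjointAction_one
    rw [h3, h3]
    change K ⁅w, u⁆ v + K u ⁅w, v⁆ = 0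
    rw [← hinv u w v, ← lie_skew u w, map_neg, LinearMap.neg_apply, add_neg_cancel]
  have h2 := eq_of_mvfderiv_eq_zero ((hs u v).mdifferentiable (by simp)) (fun x => ?_) g 1
  · simpa only [adjointAction_one] using h2
  ext w
  -- Since Ad_y = Ad_{y x⁻¹} Ad_x, the derivative at x is the one at 1 for the pair Ad_x u, Ad_x v.
  have h3 := mvfderiv_comp_apply' (f := fun y : G => y * x⁻¹)
    (g := fun h : G => K (adjointAction I h (adjointAction I x u))
      (adjointAction I h (adjointAction I x v))) x
    ((hs _ _).contMDiffAt.mdifferentiableAt (by simp))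
    ((contMDiff_mul_right (I := I) (n := ∞)).contMDiffAt.mdifferentiableAt (by simp))
    (mul_inv_cancel x) w
  simp only [← adjointAction_mul, inv_mul_cancel_right] at h3
  rw [h3]
  simp only [adjointAction_mul]
  exact h1 _ _ _

end Adjoint

/-! ### The generating fields X₀, X₁, X₂ on G × G -/

section Frame

variable {E : Type*} [NormedAddCommGroup E] [NormedSpace ℝ E] {H : Type*} [TopologicalSpace H]
  {I : ModelWithCorners ℝ E H}
  {E' : Type*} [NormedAddCommGroup E'] [NormedSpace ℝ E'] {H' : Type*} [TopologicalSpace H']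
  {J : ModelWithCorners ℝ E' H'} {N : Type*} [TopologicalSpace N] [ChartedSpace H' N]

theorem eq_of_mvfderiv_extChartAt_eq [IsManifold J ∞ N] {p : N} {v w : TangentSpace J p}
    (h : mvfderiv J (extChartAt J p) p v = mvfderiv J (extChartAt J p) p w) : v = w := by
  have : IsManifold J 1 N := .of_le (n := ∞) (by simp)
  have h2 : ∀ v : TangentSpace J p, mvfderiv J (extChartAt J p) p v = (v : E') := fun v =>
    congrArg (fun L : E' →L[ℝ] E' => L v) (mfderiv_extChartAt_self (I := J) (x := p))
  rw [h2, h2] at h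
  exact h

theorem mfderiv_prodMk_apply {M : Type*} [TopologicalSpace M] [ChartedSpace H M]
    {E₂ : Type*} [NormedAddCommGroup E₂] [NormedSpace ℝ E₂] {H₂ : Type*} [TopologicalSpace H₂]
    {J₂ : ModelWithCorners ℝ E₂ H₂} {N₂ : Type*} [TopologicalSpace N₂] [ChartedSpace H₂ N₂]
    {c : M → N} {d : M → N₂} {x : M} (hc : MDifferentiableAt I J c x)
    (hd : MDifferentiableAt I J₂ d x) (u : TangentSpace I x) :
    (mfderiv I (J.prod J₂) (fun y => (c y, d y)) x u : E' × E₂) =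
      ((mfderiv I J c x u : E'), (mfderiv I J₂ d x u : E₂)) :=
  congrArg (fun L : E →L[ℝ] E' × E₂ => L u) (mfderiv_prodMk hc hd)

theorem mfderiv_const_apply {M : Type*} [TopologicalSpace M] [ChartedSpace H M] (p : N) (x : M)
    (u : TangentSpace I x) : (mfderiv I J (fun _ : M => p) x u : E') = 0 :=
  congrArg (fun L : E →L[ℝ] E' => L u) (mfderiv_const (I := I) (I' := J) (c := p) (x := x))

variable {G : Type*} [TopologicalSpace G] [ChartedSpace H G] [Group G]

/-- The right translation action of `G` on the first factor of `G × G`. -/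
def rightMulFst (p : G × G) (h : G) : G × G := (p.1 * h, p.2)

/-- The left translation action of `G` on the first factor of `G × G`. -/
def leftMulFst (p : G × G) (h : G) : G × G := (h * p.1, p.2)

/-- The right translation action of `G` on the second factor of `G × G`. -/
def rightMulSnd (p : G × G) (h : G) : G × G := (p.1, p.2 * h)

/-- The left translation action of `G` on the second factor of `G × G`. -/
def leftMulSnd (p : G × G) (h : G) : G × G := (p.1, h * p.2)

/-- The right action of `G` on `G × G` by left translations of the groupoid `conjGroupoid G`. -/
def conjMul (p : G × G) (h : G) : G × G := (p.1 * h, h⁻¹ * p.2 * h)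

/-- The three actions whose infinitesimal generators form a frame of vector fields containing the
factors of `conjBivector`. -/
def frameAction : Fin 3 → G × G → G → G × G := ![rightMulFst, rightMulSnd, leftMulSnd]

omit [TopologicalSpace G] in
theorem frameAction_one (r : Fin 3) (p : G × G) : frameAction r p 1 = p := by
  fin_cases r <;> simp [frameAction, rightMulFst, rightMulSnd, leftMulSnd]

omit [TopologicalSpace G] in
theorem leftMulFst_one (p : G × G) : leftMulFst p 1 = p := by simp [leftMulFst]

omit [TopologicalSpace G] in
theorem conjMul_one (p : G × G) : conjMul p 1 = p := by simp [conjMul]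

section Smooth

variable [LieGroup I ∞ G]

theorem contMDiff_frameAction (r : Fin 3) :
    ContMDiff ((I.prod I).prod I) (I.prod I) ∞ (Function.uncurry (frameAction (G := G) r)) := by
  have h1 : ContMDiff ((I.prod I).prod I) I ∞ fun q : (G × G) × G => q.1.1 :=
    contMDiff_fst.comp contMDiff_fst
  have h2 : ContMDiff ((I.prod I).prod I) I ∞ fun q : (G × G) × G => q.1.2 :=
    contMDiff_snd.comp contMDiff_fst
  have h3 : ContMDiff ((I.prod I).prod I) I ∞ fun q : (G × G) × G => q.2 := contMDiff_snd
  fin_cases r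
  · exact (h1.mul h3).prodMk h2
  · exact h1.prodMk (h2.mul h3)
  · exact h1.prodMk (h3.mul h2)

theorem contMDiff_leftMulFst :
    ContMDiff ((I.prod I).prod I) (I.prod I) ∞ (Function.uncurry (leftMulFst (G := G))) :=
  (contMDiff_snd.mul (contMDiff_fst.comp contMDiff_fst)).prodMk (contMDiff_snd.comp contMDiff_fst)

theorem contMDiff_conjMul :
    ContMDiff ((I.prod I).prod I) (I.prod I) ∞ (Function.uncurry (conjMul (G := G))) :=
  ((contMDiff_fst.comp contMDiff_fst).mul contMDiff_snd).prodMk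
    ((contMDiff_snd.inv.mul (contMDiff_snd.comp contMDiff_fst)).mul contMDiff_snd)

variable (I) in
/-- The frame of vector fields on `G × G` generated by `frameAction`. -/
abbrev frameMap (r : Fin 3) (p : G × G) : GroupLieAlgebra I G →L[ℝ] TangentSpace (I.prod I) p :=
  actionMap I (I.prod I) (frameAction r) p

theorem inFirst_mulInvariantVectorField (p : G × G) (u : GroupLieAlgebra I G) :
    inFirst p (mulInvariantVectorField u p.1) = frameMap I 0 p u := by
  refine Eq.symm ((mfderiv_prodMk_apply (u := u) (c := fun h => p.1 * h) (d := fun _ => p.2)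
    ((contMDiff_mul_left (I := I) (n := ∞)).contMDiffAt.mdifferentiableAt (by simp)) mdifferentiableAt_const).trans ?_)
  exact congrArg (fun z : E => ((mfderiv I I (fun h => p.1 * h) (1 : G) u : E), z))
    (mfderiv_const_apply p.2 (1 : G) u)

theorem inSecond_mulInvariantVectorField (p : G × G) (u : GroupLieAlgebra I G) :
    inSecond p (mulInvariantVectorField u p.2) = frameMap I 1 p u := by
  refine Eq.symm ((mfderiv_prodMk_apply (u := u) (c := fun _ => p.1) (d := fun h => p.2 * h)
    mdifferentiableAt_const ((contMDiff_mul_left (I := I) (n := ∞)).contMDiffAt.mdifferentiableAt (by simp))).trans ?_)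
  exact congrArg (fun z : E => (z, (mfderiv I I (fun h => p.2 * h) (1 : G) u : E)))
    (mfderiv_const_apply p.1 (1 : G) u)

theorem inSecond_rightInvariantVectorField (p : G × G) (u : GroupLieAlgebra I G) :
    inSecond p (rightInvariantVectorField u p.2) = frameMap I 2 p u := by
  refine Eq.symm ((mfderiv_prodMk_apply (u := u) (c := fun _ => p.1) (d := fun h => h * p.2)
    mdifferentiableAt_const ((contMDiff_mul_right (I := I) (n := ∞)).contMDiffAt.mdifferentiableAt (by simp))).trans ?_)
  exact congrArg (fun z : E => (z, (mfderiv I I (fun h => h * p.2) (1 : G) u : E)))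
    (mfderiv_const_apply p.1 (1 : G) u)

theorem inFirst_rightInvariantVectorField (p : G × G) (u : GroupLieAlgebra I G) :
    inFirst p (rightInvariantVectorField u p.1) = actionMap I (I.prod I) leftMulFst p u := by
  refine Eq.symm ((mfderiv_prodMk_apply (u := u) (c := fun h => h * p.1) (d := fun _ => p.2)
    ((contMDiff_mul_right (I := I) (n := ∞)).contMDiffAt.mdifferentiableAt (by simp)) mdifferentiableAt_const).trans ?_)
  exact congrArg (fun z : E => ((mfderiv I I (fun h => h * p.1) (1 : G) u : E), z))
    (mfderiv_const_apply p.2 (1 : G) u)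

/-- Derivatives of two maps that differ by an inner automorphism. -/
theorem mfderiv_comp_conj {c d : G → N} (hd : MDifferentiableAt I J d 1) (g : G)
    (hcd : ∀ h, c h = d (g * h * g⁻¹)) (u : GroupLieAlgebra I G) :
    (mfderiv I J c 1 u : E') = mfderiv I J d 1 (adjointAction I g u) := by
  obtain rfl : c = fun h => d (g * h * g⁻¹) := funext hcd
  exact mfderiv_comp_apply_of_eq (x := (1 : G)) (f := fun h => g * h * g⁻¹) hd
    ((contMDiff_conj g).contMDiffAt.mdifferentiableAt (by simp)) (by simp) u

theorem mfderiv_comp_inv [IsManifold J ∞ N] {c : G → N} (hc : ContMDiffAt I J ∞ c 1)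
    (u : GroupLieAlgebra I G) :
    (mfderiv I J (fun h => c h⁻¹) 1 u : E') = -mfderiv I J c 1 u := by
  have h1 : ContMDiffAt I J ∞ (fun h : G => c h⁻¹) 1 :=
    ContMDiffAt.comp_of_eq (f := fun h : G => h⁻¹) hc contMDiff_id.inv.contMDiffAt inv_one
  have h2 : c (1 : G)⁻¹ = c 1 := by rw [inv_one]
  have hψ : ContMDiffAt J 𝓘(ℝ, E') ∞ (extChartAt J (c 1)) (c 1) := contMDiffAt_extChartAt
  have hd := hψ.mdifferentiableAt (n := ∞) (by simp)
  refine eq_of_mvfderiv_extChartAt_eq (J := J) (p := c 1) ?_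
  refine (mvfderiv_comp_apply' (f := fun h : G => c h⁻¹) (1 : G) hd
    (h1.mdifferentiableAt (by simp)) h2 u).symm.trans ?_
  rw [mvfderiv_comp_inv (f := fun h => extChartAt J (c 1) (c h)) (hψ.comp (1 : G) hc), map_neg,
    mvfderiv_comp_apply' (1 : G) hd (hc.mdifferentiableAt (by simp)) rfl]

/-- Because h g = g (g⁻¹ h g). This is what absorbs the factor Ad_{g⁻¹} of the bivector. -/
theorem actionMap_leftMulFst (p : G × G) (u : GroupLieAlgebra I G) :
    actionMap I (I.prod I) leftMulFst p u = frameMap I 0 p (adjointAction I p.1⁻¹ u) := by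
  refine mfderiv_comp_conj (d := frameAction 0 p)
    ((contMDiff_action_right (contMDiff_frameAction 0) p).contMDiffAt.mdifferentiableAt (by simp))
    p.1⁻¹ (fun h => ?_) u
  simp [leftMulFst, frameAction, rightMulFst, mul_assoc]

/-- Because h s = s (s⁻¹ h s). The three families thus span with redundancy, and this relation
drives all the cancellations. -/
theorem frameMap_two (p : G × G) (u : GroupLieAlgebra I G) :
    frameMap I 2 p u = frameMap I 1 p (adjointAction I p.2⁻¹ u) := by
  refine mfderiv_comp_conj (d := frameAction 1 p)
    ((contMDiff_action_right (contMDiff_frameAction 1) p).contMDiffAt.mdifferentiableAt (by simp))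
    p.2⁻¹ (fun h => ?_) u
  simp [frameAction, leftMulSnd, rightMulSnd, mul_assoc]

/-- Leibniz rule for the three occurrences of h in (g h, h⁻¹ s h); the inverse produces the minus
sign. -/
theorem actionMap_conjMul (p : G × G) (u : GroupLieAlgebra I G) :
    actionMap I (I.prod I) conjMul p u = frameMap I 0 p u + frameMap I 1 p u - frameMap I 2 p u := by
  have hψ : ContMDiffAt (I.prod I) 𝓘(ℝ, E × E) ∞ (extChartAt (I.prod I) p) p :=
    contMDiffAt_extChartAt
  have hd := hψ.mdifferentiableAt (n := ∞) (by simp)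
  set ψ := (extChartAt (I.prod I) p : G × G → E × E)
  refine eq_of_mvfderiv_extChartAt_eq (J := I.prod I) (p := p) ?_
  rw [map_sub, map_add, mvfderiv_actionMap contMDiff_conjMul conjMul_one hd,
    mvfderiv_actionMap (contMDiff_frameAction 0) (frameAction_one 0) hd,
    mvfderiv_actionMap (contMDiff_frameAction 1) (frameAction_one 1) hd,
    mvfderiv_actionMap (contMDiff_frameAction 2) (frameAction_one 2) hd]
  have h1 : ContMDiffAt (I.prod I) 𝓘(ℝ, E × E) ∞
      (Function.uncurry fun h k : G => ψ (p.1 * h, k⁻¹ * p.2 * k)) (1, 1) :=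
    ContMDiffAt.comp_of_eq (f := fun q : G × G => (p.1 * q.1, q.2⁻¹ * p.2 * q.2)) hψ
      ((contMDiff_const.mul contMDiff_fst).prodMk
        ((contMDiff_snd.inv.mul contMDiff_const).mul contMDiff_snd)).contMDiffAt (by simp)
  have h2 : ContMDiffAt (I.prod I) 𝓘(ℝ, E × E) ∞
      (Function.uncurry fun h k : G => ψ (p.1, k⁻¹ * p.2 * h)) (1, 1) :=
    ContMDiffAt.comp_of_eq (f := fun q : G × G => (p.1, q.2⁻¹ * p.2 * q.1)) hψ
      (contMDiff_const.prodMk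
        ((contMDiff_snd.inv.mul contMDiff_const).mul contMDiff_fst)).contMDiffAt (by simp)
  have h3 : ContMDiffAt I 𝓘(ℝ, E × E) ∞ (fun k : G => ψ (p.1, k * p.2)) 1 :=
    ContMDiffAt.comp_of_eq (f := fun k : G => (p.1, k * p.2)) hψ
      (contMDiff_const.prodMk (contMDiff_id.mul contMDiff_const)).contMDiffAt (by simp)
  refine (mvfderiv_diag (h1.mdifferentiableAt (by simp)) u).trans ?_
  rw [mvfderiv_diag (f := fun h k : G => ψ (p.1 * 1, k⁻¹ * p.2 * h))
    (by simpa only [mul_one] using h2.mdifferentiableAt (by simp)) u]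
  simp only [inv_one, one_mul, mul_one]
  rw [mvfderiv_comp_inv (f := fun k : G => ψ (p.1, k * p.2)) h3]
  rw [← add_assoc, ← sub_eq_add_neg]
  rfl

end Smooth

end Frame

/-! ### The conjugation groupoid: Lie groupoid axioms and translations of constant sections -/

section Groupoid

variable {E : Type*} [NormedAddCommGroup E] [NormedSpace ℝ E] {H : Type*} [TopologicalSpace H]
  {I : ModelWithCorners ℝ E H} {G : Type*} [TopologicalSpace G] [ChartedSpace H G] [Group G]
  [LieGroup I ∞ G]

theorem contMDiff_conjGroupoid_tgt : ContMDiff (I.prod I) I ∞ (conjGroupoid G).tgt :=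
  (contMDiff_fst.mul contMDiff_snd).mul contMDiff_fst.inv

theorem contMDiff_conjGroupoid_mul : ContMDiff ((I.prod I).prod (I.prod I)) (I.prod I) ∞
    fun p : (G × G) × (G × G) => (conjGroupoid G).mul p.1 p.2 :=
  ((contMDiff_fst.comp contMDiff_fst).mul (contMDiff_fst.comp contMDiff_snd)).prodMk
    (contMDiff_snd.comp contMDiff_snd)

theorem mfderiv_surjective_of_section {M N : Type*} {E₁ E₂ H₁ H₂ : Type*} [NormedAddCommGroup E₁]
    [NormedSpace ℝ E₁] [NormedAddCommGroup E₂] [NormedSpace ℝ E₂] [TopologicalSpace H₁]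
    [TopologicalSpace H₂] {I₁ : ModelWithCorners ℝ E₁ H₁} {I₂ : ModelWithCorners ℝ E₂ H₂}
    [TopologicalSpace M] [TopologicalSpace N] [ChartedSpace H₁ M] [ChartedSpace H₂ N]
    {f : M → N} {σ : N → M} {x : M} (hf : MDifferentiableAt I₁ I₂ f x)
    (hσ : MDifferentiableAt I₂ I₁ σ (f x)) (hx : σ (f x) = x) (hfσ : ∀ y, f (σ y) = y) :
    Function.Surjective (mfderiv I₁ I₂ f x) := by
  intro w
  refine ⟨(mfderiv I₂ I₁ σ (f x) w : E₁), ?_⟩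
  have h1 := mfderiv_comp_apply_of_eq (x := f x) (f := σ) hf hσ hx w
  have h2 : f ∘ σ = id := funext hfσ
  have h3 : (mfderiv I₂ I₂ (f ∘ σ) (f x) : E₂ →L[ℝ] E₂) = ContinuousLinearMap.id ℝ E₂ := by
    rw [h2]; exact mfderiv_id
  exact h1.symm.trans (congrArg (fun L : E₂ →L[ℝ] E₂ => L w) h3)

theorem isLieGroupoid_conjGroupoid : IsLieGroupoid (I.prod I) I (conjGroupoid G) where
  isManifold_arrows := inferInstance
  isManifold_base := inferInstance
  smooth_tgt := contMDiff_conjGroupoid_tgt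
  smooth_src := contMDiff_snd
  submersion_tgt x := by
    -- With the first factor fixed, the target is a conjugation, and conjugating back is a section
    -- through `x`.
    refine mfderiv_surjective_of_section (σ := fun s => (x.1, x.1⁻¹ * s * x.1))
      (contMDiff_conjGroupoid_tgt.contMDiffAt.mdifferentiableAt (by simp)) ?_ ?_ ?_
    · have : ContMDiff I (I.prod I) ∞ fun s : G => (x.1, x.1⁻¹ * s * x.1) :=
        contMDiff_const.prodMk ((contMDiff_const.mul contMDiff_id).mul contMDiff_const)
      exact this.contMDiffAt.mdifferentiableAt (by simp)
    · simp [conjGroupoid, mul_assoc]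
    · intro y
      simp [conjGroupoid, mul_assoc]
  submersion_src x :=
    mfderiv_surjective_of_section (σ := fun s => (x.1, s)) mdifferentiableAt_snd
      (mdifferentiableAt_const.prodMk mdifferentiableAt_id) rfl fun _ => rfl
  smooth_mul := contMDiff_conjGroupoid_mul.contMDiffOn
  smooth_one := contMDiff_const.prodMk contMDiff_id
  smooth_inv := contMDiff_fst.inv.prodMk contMDiff_conjGroupoid_tgt

/-- Composable pairs are probed by maps from G instead of curves, so that tangent vectors are always
indexed by 𝔤. -/
theorem tangentMul_mfderiv {c₁ c₂ : G → G × G} {x y : G × G}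
    (h₁ : MDifferentiableAt I (I.prod I) c₁ 1) (h₂ : MDifferentiableAt I (I.prod I) c₂ 1)
    (hx : c₁ 1 = x) (hy : c₂ 1 = y)
    (hc : ∀ h, (conjGroupoid G).src (c₁ h) = (conjGroupoid G).tgt (c₂ h))
    (u : GroupLieAlgebra I G) :
    (tangentMul (I.prod I) (conjGroupoid G) x y
      ((mfderiv I (I.prod I) c₁ 1 u : E × E), (mfderiv I (I.prod I) c₂ 1 u : E × E)) : E × E) =
      mfderiv I (I.prod I) (fun h => (conjGroupoid G).mul (c₁ h) (c₂ h)) 1 u := by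
  subst hx hy
  have hm : MDifferentiableWithinAt ((I.prod I).prod (I.prod I)) (I.prod I)
      (fun p : (G × G) × (G × G) => (conjGroupoid G).mul p.1 p.2) (conjGroupoid G).composable
      (c₁ 1, c₂ 1) :=
    (contMDiff_conjGroupoid_mul.contMDiffAt.mdifferentiableAt (by simp)).mdifferentiableWithinAt
  -- The chain rule along a map that lands in the composable pairs works for any choice of
  -- derivative within that set.
  have h3 := HasMFDerivWithinAt.comp (f := fun h : G => (c₁ h, c₂ h)) (1 : G)
    hm.hasMFDerivWithinAt (h₁.prodMk h₂).hasMFDerivAt.hasMFDerivWithinAt (s := univ)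
    fun h _ => hc h
  have h4 := (hasMFDerivWithinAt_univ.1 h3).mfderiv
  refine Eq.symm ((congrArg (fun L : E →L[ℝ] E × E => L u) h4).trans ?_)
  exact congrArg (fun z : (E × E) × (E × E) => (tangentMul (I.prod I) (conjGroupoid G) (c₁ 1) (c₂ 1) z : E × E))
    (mfderiv_prodMk_apply h₁ h₂ u)

theorem mfderiv_src_eq_mfderiv_tgt {c₁ c₂ : G → G × G} {x y : G × G}
    (h₁ : MDifferentiableAt I (I.prod I) c₁ 1) (h₂ : MDifferentiableAt I (I.prod I) c₂ 1)
    (hx : c₁ 1 = x) (hy : c₂ 1 = y)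
    (hc : ∀ h, (conjGroupoid G).src (c₁ h) = (conjGroupoid G).tgt (c₂ h))
    (u : GroupLieAlgebra I G) :
    (mfderiv (I.prod I) I (conjGroupoid G).src x (mfderiv I (I.prod I) c₁ 1 u : E × E) : E) =
      mfderiv (I.prod I) I (conjGroupoid G).tgt y (mfderiv I (I.prod I) c₂ 1 u : E × E) := by
  have e1 := mfderiv_comp_apply_of_eq (I' := I.prod I) (I'' := I) (g := (conjGroupoid G).src)
    (x := (1 : G)) mdifferentiableAt_snd h₁ hx u
  have e2 := mfderiv_comp_apply_of_eq (x := (1 : G)) (I' := I.prod I) (I'' := I)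
    (g := (conjGroupoid G).tgt)
    (contMDiff_conjGroupoid_tgt.contMDiffAt.mdifferentiableAt (by simp)) h₂ hy u
  refine e1.symm.trans (Eq.trans ?_ e2)
  have h3 : (conjGroupoid G).src ∘ c₁ = (conjGroupoid G).tgt ∘ c₂ := funext hc
  exact congrArg (fun f : G → G => (mfderiv I I f 1 u : E)) h3

theorem cotangentComp_mfderiv {c₁ c₂ : G → G × G} {x y : G × G}
    (h₁ : MDifferentiableAt I (I.prod I) c₁ 1) (h₂ : MDifferentiableAt I (I.prod I) c₂ 1)
    (hx : c₁ 1 = x) (hy : c₂ 1 = y)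
    (hc : ∀ h, (conjGroupoid G).src (c₁ h) = (conjGroupoid G).tgt (c₂ h))
    {ξ : Module.Dual ℝ (TangentSpace (I.prod I) x)} {η : Module.Dual ℝ (TangentSpace (I.prod I) y)}
    {δ : Module.Dual ℝ (TangentSpace (I.prod I) ((conjGroupoid G).mul x y))}
    (h : CotangentComp (I.prod I) I (conjGroupoid G) x y ξ η δ) (u : GroupLieAlgebra I G) :
    ξ (mfderiv I (I.prod I) c₁ 1 u : E × E) + η (mfderiv I (I.prod I) c₂ 1 u : E × E) =
      δ (mfderiv I (I.prod I) (fun h => (conjGroupoid G).mul (c₁ h) (c₂ h)) 1 u : E × E) :=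
  (h _ _ (mfderiv_src_eq_mfderiv_tgt h₁ h₂ hx hy hc u)).trans
    (congrArg δ (tangentMul_mfderiv h₁ h₂ hx hy hc u))

theorem constantVector_eq (s : G) (u : GroupLieAlgebra I G) :
    constantVector s u = actionMap I (I.prod I) conjMul ((1 : G), s) u := by
  have hc : ContMDiff I I ∞ fun h : G => h * s * h⁻¹ :=
    (contMDiff_id.mul contMDiff_const).mul contMDiff_id.inv
  have h1 := mfderiv_comp_inv hc.contMDiffAt u
  have h2 : (fun h : G => h⁻¹ * s * h⁻¹⁻¹) = fun h => h⁻¹ * s * h := by simp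
  rw [h2] at h1
  have h3 : (mfderiv I I (fun h : G => (1 : G) * h) 1 u : E) = u :=
    mulInvariantVectorField_one u
  refine Eq.symm ((mfderiv_prodMk_apply (u := u) (c := fun h : G => (1 : G) * h)
    (d := fun h => h⁻¹ * s * h)
    ((contMDiff_mul_left (I := I) (n := ∞)).contMDiffAt.mdifferentiableAt (by simp))
    (((contMDiff_id.inv.mul contMDiff_const).mul contMDiff_id).contMDiffAt.mdifferentiableAt
      (n := ∞) (by simp))).trans ?_)
  exact Prod.ext h3 h1

/-- Obtained by differentiating x · (h, h⁻¹ s h) = (g h, h⁻¹ s h) for x = (g, s). -/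
theorem leftTranslation_constantSection (x : G × G) (u : GroupLieAlgebra I G) :
    leftTranslation (I.prod I) I (conjGroupoid G) x
      (constantSection ((conjGroupoid G).src x) u) = actionMap I (I.prod I) conjMul x u := by
  have h1 := tangentMul_mfderiv (c₁ := fun _ => x) (c₂ := conjMul ((1 : G), x.2)) (x := x)
    mdifferentiableAt_const
    ((contMDiff_action_right contMDiff_conjMul _).contMDiffAt.mdifferentiableAt (by simp))
    rfl (conjMul_one _) (fun h => by simp [conjGroupoid, conjMul, mul_assoc]) u
  have h2 : (fun h => (conjGroupoid G).mul x (conjMul ((1 : G), x.2) h)) = conjMul x := by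
    funext h; simp [conjGroupoid, conjMul]
  rw [h2] at h1
  refine Eq.trans ?_ h1
  refine congrArg (fun z : (E × E) × (E × E) =>
    (tangentMul (I.prod I) (conjGroupoid G) x ((1 : G), x.2) z : E × E)) ?_
  exact Prod.ext (mfderiv_const_apply x (1 : G) u).symm (constantVector_eq x.2 u)

/-- Subtracting the part tangent to the units kills the second component and leaves (u, 0). -/
theorem toSourceFiber_constantSection (s : G) (u : GroupLieAlgebra I G) :
    toSourceFiber (I.prod I) I (conjGroupoid G) s (constantSection s u) =
      actionMap I (I.prod I) leftMulFst ((1 : G), s) u := by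
  have h1 : (mfderiv (I.prod I) (I.prod I) (fun p : G × G => ((1 : G), p.2)) ((1 : G), s)
      (constantVector s u) : E × E) = ((0 : E), (constantVector s u : E × E).2) := by
    refine (mfderiv_prodMk_apply (u := constantVector s u) (c := fun _ : G × G => (1 : G))
      (d := fun p : G × G => p.2) mdifferentiableAt_const mdifferentiableAt_snd).trans ?_
    refine Prod.ext (mfderiv_const_apply (1 : G) ((1 : G), s) (constantVector s u)) ?_
    exact congrArg (fun L : E × E →L[ℝ] E => L (constantVector s u)) mfderiv_snd
  have h2 : (mfderiv I I (fun h : G => h * (1 : G)) 1 u : E) = u := by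
    have h : (fun x : G => x * (1 : G)) = id := by ext; simp
    have h2 : (mfderiv I I (fun x : G => x * (1 : G)) (1 : G) : E →L[ℝ] E) =
        ContinuousLinearMap.id ℝ E := by
      rw [h]; exact mfderiv_id
    exact congrArg (fun L : E →L[ℝ] E => L u) h2
  have h3 := mfderiv_prodMk_apply (u := u) (c := fun h : G => h * (1 : G)) (d := fun _ : G => s)
    ((contMDiff_mul_right (I := I) (n := ∞)).contMDiffAt.mdifferentiableAt (by simp))
    (mdifferentiableAt_const (I := I) (I' := I))
  refine Eq.trans ?_ h3.symm
  refine (congrArg (fun z : E × E => @id (E × E) (constantVector s u) - z) h1).trans ?_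
  refine Prod.ext ?_ ?_
  · exact (sub_zero (G := E) _).trans h2.symm
  · exact (sub_self (G := E) _).trans (mfderiv_const_apply s (1 : G) u).symm

theorem rightTranslation_constantSection (x : G × G) (u : GroupLieAlgebra I G) :
    rightTranslation (I.prod I) I (conjGroupoid G) x
      (constantSection ((conjGroupoid G).tgt x) u) = actionMap I (I.prod I) leftMulFst x u := by
  have h1 := tangentMul_mfderiv (c₁ := leftMulFst ((1 : G), (conjGroupoid G).tgt x))
    (c₂ := fun _ => x) (y := x)
    ((contMDiff_action_right contMDiff_leftMulFst _).contMDiffAt.mdifferentiableAt (by simp))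
    mdifferentiableAt_const (leftMulFst_one _) rfl
    (fun h => by simp [conjGroupoid, leftMulFst]) u
  have h2 : (fun h => (conjGroupoid G).mul (leftMulFst ((1 : G), (conjGroupoid G).tgt x) h) x) =
      leftMulFst x := by
    funext h; simp [conjGroupoid, leftMulFst]
  rw [h2] at h1
  refine Eq.trans ?_ h1
  refine congrArg (fun z : (E × E) × (E × E) =>
    (tangentMul (I.prod I) (conjGroupoid G) ((1 : G), (conjGroupoid G).tgt x) x z : E × E)) ?_
  exact Prod.ext (toSourceFiber_constantSection _ u) (mfderiv_const_apply x (1 : G) u).symm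

end Groupoid

/-! ### Basis-free form of contractions with the dual bases -/

section InvariantForm

variable {V : Type*} [AddCommGroup V] [Module ℝ V] [FiniteDimensional ℝ V]
  {K : LinearMap.BilinForm ℝ V} (hnd : K.Nondegenerate)

/-- The isomorphism `V* ≅ V` given by a non-degenerate bilinear form. -/
abbrev sharp : Module.Dual ℝ V →ₗ[ℝ] V := (K.toDual hnd).symm.toLinearMap

theorem sharp_left (α : Module.Dual ℝ V) (v : V) : K (sharp hnd α) v = α v :=
  LinearMap.BilinForm.apply_toDual_symm_apply (hB := hnd) α v

theorem eq_sharp {α : Module.Dual ℝ V} {w : V} (h : ∀ v, K w v = α v) : w = sharp hnd α := by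
  refine (LinearEquiv.eq_symm_apply _).2 (LinearMap.ext fun v => ?_)
  exact h v

/-- For an isometry `A` the transpose is, through `sharp`, the inverse of `A`. -/
theorem apply_sharp_comp {A : V →ₗ[ℝ] V} (hA : ∀ u v, K (A u) (A v) = K u v)
    (hs : Function.Surjective A) (α : Module.Dual ℝ V) : A (sharp hnd (α.comp A)) = sharp hnd α := by
  obtain ⟨w, hw⟩ := hs (sharp hnd α)
  rw [← hw]
  congr 1
  refine (eq_sharp hnd fun v => ?_).symm
  rw [← hA, hw, sharp_left]; rfl

theorem sharp_comp_pairing {A : V →ₗ[ℝ] V} (hA : ∀ u v, K (A u) (A v) = K u v)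
    (hs : Function.Surjective A) (α β : Module.Dual ℝ V) :
    K (sharp hnd (α.comp A)) (sharp hnd (β.comp A)) = K (sharp hnd α) (sharp hnd β) := by
  rw [← hA, apply_sharp_comp hnd hA hs, apply_sharp_comp hnd hA hs]

variable {ι : Type*} [Fintype ι] [DecidableEq ι] {e : Module.Basis ι ℝ V} {e' : ι → V}

section

variable (hK : K.IsSymm) (he : ∀ i j, K (e i) (e' j) = if i = j then 1 else 0)
include hK he

theorem sharp_eq_sum (α : Module.Dual ℝ V) : sharp hnd α = ∑ i, α (e i) • e' i := by
  refine (eq_sharp hnd fun v => ?_).symm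
  have h : K (∑ i, α (e i) • e' i) = α := e.ext fun j => by
    rw [map_sum, LinearMap.sum_apply, Finset.sum_eq_single j]
    · rw [map_smul, LinearMap.smul_apply, hK.eq, he]; simp
    · intro i _ hij
      rw [map_smul, LinearMap.smul_apply, hK.eq, he, if_neg hij.symm, smul_zero]
    · simp
  rw [h]

theorem sum_mul_eq_sharp (α β : Module.Dual ℝ V) :
    ∑ i, α (e i) * β (e' i) = K (sharp hnd α) (sharp hnd β) := by
  rw [hK.eq, sharp_left, sharp_eq_sum hnd hK he α, map_sum]
  simp

/-- The Gram matrix of the dual family gives the coefficients of ∑ eᵢ ⊗ eⁱ in the basis `e` alone,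
the form required by the general bracket lemmas. -/
theorem sum_sum_gram (α β : Module.Dual ℝ V) :
    ∑ i, ∑ j, K (e' i) (e' j) * (α (e i) * β (e j)) = K (sharp hnd α) (sharp hnd β) := by
  rw [sharp_eq_sum hnd hK he α, sharp_eq_sum hnd hK he β, map_sum K,
    LinearMap.sum_apply]
  refine Finset.sum_congr rfl fun i _ => ?_
  rw [map_sum]
  refine Finset.sum_congr rfl fun j _ => ?_
  rw [map_smul, map_smul, LinearMap.smul_apply, smul_eq_mul, smul_eq_mul]
  ring

theorem sum_gram_gram (α β : Module.Dual ℝ V) (B : V →ₗ[ℝ] V →ₗ[ℝ] ℝ) :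
    ∑ i, ∑ j, ∑ k, ∑ l, K (e' i) (e' j) * K (e' k) (e' l) * (α (e i) * B (e j) (e k) * β (e l)) =
      B (sharp hnd α) (sharp hnd β) := by
  have h1 : ∀ i j, ∑ k, ∑ l,
      K (e' i) (e' j) * K (e' k) (e' l) * (α (e i) * B (e j) (e k) * β (e l)) =
      K (e' i) (e' j) * (α (e i) * B.flip (sharp hnd β) (e j)) := by
    intro i j
    rw [LinearMap.flip_apply, ← sharp_left hnd (B (e j)), ← sum_sum_gram hnd hK he,
      Finset.mul_sum, Finset.mul_sum]
    refine Finset.sum_congr rfl fun k _ => ?_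
    rw [Finset.mul_sum, Finset.mul_sum]
    refine Finset.sum_congr rfl fun l _ => ?_
    ring
  simp only [h1]
  rw [sum_sum_gram hnd hK he, hK.eq, sharp_left, LinearMap.flip_apply]

end

end InvariantForm

/-! ### The algebraic identity behind [Π, Π] -/

section InvariantTrilinear

variable {V : Type*} [LieRing V] [LieAlgebra ℝ V] {K : LinearMap.BilinForm ℝ V}

theorem invariant_rotate (hK : K.IsSymm) (hinv : ∀ x y z, K ⁅x, y⁆ z = K x ⁅y, z⁆) (u v w : V) :
    K u ⁅v, w⁆ = K v ⁅w, u⁆ := by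
  rw [hK.eq, hinv]

theorem invariant_swap (u v w : V) : K u ⁅v, w⁆ = -K u ⁅w, v⁆ := by
  rw [← lie_skew, map_neg]

theorem sum_perm_fin_three (F : Fin 3 → Fin 3 → Fin 3 → ℝ) :
    ∑ σ : Equiv.Perm (Fin 3), ((Equiv.Perm.sign σ : ℤ) : ℝ) * F (σ 0) (σ 1) (σ 2) =
      F 0 1 2 - F 0 2 1 + F 1 2 0 - F 1 0 2 + F 2 0 1 - F 2 1 0 := by
  have h : (Finset.univ : Finset (Equiv.Perm (Fin 3))) =
      {1, Equiv.swap 1 2, Equiv.swap 0 1 * Equiv.swap 1 2, Equiv.swap 0 1,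
        Equiv.swap 1 2 * Equiv.swap 0 1, Equiv.swap 0 2} := by decide
  have h1 : ∀ i j : Fin 3, i ≠ j → Equiv.Perm.sign (Equiv.swap i j) = -1 := fun i j =>
    Equiv.Perm.sign_swap
  rw [h, Finset.sum_insert (by decide), Finset.sum_insert (by decide),
    Finset.sum_insert (by decide), Finset.sum_insert (by decide), Finset.sum_insert (by decide),
    Finset.sum_singleton]
  simp only [Equiv.Perm.sign_mul, Equiv.Perm.sign_one, h1 1 2 (by decide), h1 0 1 (by decide),
    h1 0 2 (by decide), Equiv.Perm.mul_apply, Equiv.Perm.one_apply]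
  have e1 : ∀ k : Fin 3, Equiv.swap (1 : Fin 3) 2 k = ![0, 2, 1] k := by decide
  have e2 : ∀ k : Fin 3, Equiv.swap (0 : Fin 3) 1 k = ![1, 0, 2] k := by decide
  have e3 : ∀ k : Fin 3, Equiv.swap (0 : Fin 3) 2 k = ![2, 1, 0] k := by decide
  simp only [e1, e2, e3]
  simp
  ring

/-- The skew-symmetric coefficients of `conjBivector` with respect to `frameAction`. -/
def frameCoeff : Fin 3 → Fin 3 → ℝ := ![![0, 1 / 2, 1 / 2], ![-1 / 2, 0, 1 / 2], ![-1 / 2, -1 / 2, 0]]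

/-- The signs of the brackets of the frame generated by `frameAction`. -/
def frameSign : Fin 3 → ℝ := ![1, 1, -1]

/-- The left side is [Π, Π] on three covectors with z r i the r-th component of the i-th one; on the
right z₀ + z₁ - z₂ belongs to the left-invariant trivector and z₀ to the right-invariant one. -/
theorem sum_perm_frameCoeff (hK : K.IsSymm) (hinv : ∀ x y z, K ⁅x, y⁆ z = K x ⁅y, z⁆)
    (z : Fin 3 → Fin 3 → V) (h : K (z 1 0) ⁅z 1 1, z 1 2⁆ = K (z 2 0) ⁅z 2 1, z 2 2⁆) :
    ∑ σ : Equiv.Perm (Fin 3), ((Equiv.Perm.sign σ : ℤ) : ℝ) *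
      ∑ r, ∑ s, ∑ q, frameCoeff r s * frameCoeff s q *
        (frameSign s * K (z s (σ 1)) ⁅z r (σ 0), z q (σ 2)⁆) =
      2 * (1 / 4 * K (z 0 0 + z 1 0 - z 2 0) ⁅z 0 1 + z 1 1 - z 2 1, z 0 2 + z 1 2 - z 2 2⁆ -
        1 / 4 * K (z 0 0) ⁅z 0 1, z 0 2⁆) := by
  rw [sum_perm_fin_three fun i j k => ∑ r, ∑ s, ∑ q, frameCoeff r s * frameCoeff s q *
        (frameSign s * K (z s j) ⁅z r i, z q k⁆)]
  have h021 : ∀ r s q, K (z s 0) ⁅z r 2, z q 1⁆ = -K (z s 0) ⁅z q 1, z r 2⁆ :=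
    fun _ _ _ => invariant_swap _ _ _
  have h120 : ∀ r s q, K (z s 1) ⁅z r 2, z q 0⁆ = K (z q 0) ⁅z s 1, z r 2⁆ :=
    fun _ _ _ => (invariant_rotate hK hinv _ _ _).symm
  have h102 : ∀ r s q, K (z s 1) ⁅z r 0, z q 2⁆ = -K (z r 0) ⁅z s 1, z q 2⁆ :=
    fun _ _ _ => by rw [invariant_rotate hK hinv, invariant_swap]
  have h201 : ∀ r s q, K (z s 2) ⁅z r 0, z q 1⁆ = K (z r 0) ⁅z q 1, z s 2⁆ :=
    fun _ _ _ => invariant_rotate hK hinv _ _ _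
  have h210 : ∀ r s q, K (z s 2) ⁅z r 1, z q 0⁆ = -K (z q 0) ⁅z r 1, z s 2⁆ :=
    fun _ _ _ => by rw [← invariant_rotate hK hinv, invariant_swap]
  simp only [h021, h120, h102, h201, h210, Fin.sum_univ_three, frameCoeff, frameSign,
    Matrix.cons_val_zero, Matrix.cons_val_one, Matrix.cons_val, map_add, map_sub,
    LinearMap.add_apply, LinearMap.sub_apply, add_lie, lie_add, sub_lie, lie_sub]
  -- Terms with mixed indices agree. The left side has no unmixed terms, as `frameCoeff` vanishes on
  -- the diagonal, and the z₀ terms on the right cancel; the z₁ and z₂ terms are equal by `h`.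
  linear_combination (-1 / 2 : ℝ) * h

end InvariantTrilinear

theorem wedge_pair {V : Type*} [AddCommGroup V] [Module ℝ V] (v w : V)
    (δ : Fin 2 → Module.Dual ℝ V) :
    wedge ![v, w] δ = δ 0 v * δ 1 w - δ 0 w * δ 1 v := by
  refine (Matrix.det_fin_two _).trans ?_
  rfl

theorem MultiVec.sum_apply {V : Type*} [AddCommGroup V] [Module ℝ V] {k : ℕ} {ι : Type*}
    (s : Finset ι) (W : ι → MultiVec k V) (δ : Fin k → Module.Dual ℝ V) :
    (∑ i ∈ s, W i) δ = ∑ i ∈ s, W i δ :=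
  map_sum (⟨⟨fun P => P δ, rfl⟩, fun _ _ => rfl⟩ : MultiVec k V →+ ℝ) W s

/-! ### The bivector field in terms of the vectors z_r -/

section ConjBivector

variable {E : Type*} [NormedAddCommGroup E] [NormedSpace ℝ E] [FiniteDimensional ℝ E]
  {H : Type*} [TopologicalSpace H]
  {I : ModelWithCorners ℝ E H} {G : Type*} [TopologicalSpace G] [ChartedSpace H G] [Group G]

omit [TopologicalSpace G] in
theorem frameAction_comm {r s : Fin 3} (hrs : r ≠ s) (p : G × G) (h k : G) :
    frameAction s (frameAction r p h) k = frameAction r (frameAction s p k) h := by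
  fin_cases r <;> fin_cases s <;>
    simp_all [frameAction, rightMulFst, rightMulSnd, leftMulSnd, mul_assoc]

instance instFiniteDimensionalGroupLieAlgebra :
    FiniteDimensional ℝ (GroupLieAlgebra I G) := inferInstanceAs (FiniteDimensional ℝ E)

variable [LieGroup I ∞ G]

section Bracket

variable [I.Boundaryless] [CompleteSpace E] {U : Set (G × G)} (hU : IsOpen U) {f : G × G → ℝ}
  (hf : ContMDiffOn (I.prod I) 𝓘(ℝ, ℝ) ∞ f U) {p : G × G} (hp : p ∈ U)
include hU hf hp

omit [FiniteDimensional ℝ E] in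
theorem fieldDeriv_frameMap_comm (r s : Fin 3) (u v : GroupLieAlgebra I G) :
    fieldDeriv (fun p => frameMap I r p u) (fieldDeriv (fun p => frameMap I s p v) f) p -
      fieldDeriv (fun p => frameMap I s p v) (fieldDeriv (fun p => frameMap I r p u) f) p =
      if r = s then frameSign r * fieldDeriv (fun p => frameMap I r p ⁅u, v⁆) f p else 0 := by
  split_ifs with hrs
  · subst hrs
    have h : r = 0 ∨ r = 1 ∨ r = 2 := by omega
    rcases h with rfl | rfl | rfl
    · rw [fieldDeriv_comm_of_rightAction (contMDiff_frameAction 0) (frameAction_one 0) hU hf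
        (fun p h k => by simp [frameAction, rightMulFst, mul_assoc]) hp]
      simp [frameSign]
    · rw [fieldDeriv_comm_of_rightAction (contMDiff_frameAction 1) (frameAction_one 1) hU hf
        (fun p h k => by simp [frameAction, rightMulSnd, mul_assoc]) hp]
      simp [frameSign]
    · rw [fieldDeriv_comm_of_leftAction (contMDiff_frameAction 2) (frameAction_one 2) hU hf
        (fun p h k => by simp [frameAction, leftMulSnd, mul_assoc]) hp]
      simp [frameSign]
  · rw [sub_eq_zero]
    exact fieldDeriv_comm_of_commute (contMDiff_frameAction r) (frameAction_one r)
      (contMDiff_frameAction s) (frameAction_one s) hU hf (frameAction_comm hrs) hp u v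

end Bracket

variable {K : LinearMap.BilinForm ℝ (GroupLieAlgebra I G)} (hnd : K.Nondegenerate)

/-- The element of `𝔤 ≅ 𝔤*` given by the values of a covector on a frame field. -/
def coframe (r : Fin 3) (p : G × G) (δ : Module.Dual ℝ (TangentSpace (I.prod I) p)) :
    GroupLieAlgebra I G :=
  sharp hnd (δ.comp (frameMap I r p).toLinearMap)

variable [I.Boundaryless] [CompleteSpace E] [PreconnectedSpace G]
  (hK : K.IsSymm) (hinv : ∀ x y z, K ⁅x, y⁆ z = K x ⁅y, z⁆)
  {ι : Type*} [Fintype ι] [DecidableEq ι] {e : Module.Basis ι ℝ (GroupLieAlgebra I G)}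
  {e' : ι → GroupLieAlgebra I G} (he : ∀ i j, K (e i) (e' j) = if i = j then 1 else 0)

omit [FiniteDimensional ℝ E] [I.Boundaryless] [CompleteSpace E] [PreconnectedSpace G] in
theorem adjointAction_surjective (g : G) : Function.Surjective (adjointAction I g) := fun v =>
  ⟨adjointAction I g⁻¹ v, adjointAction_adjointAction_inv g v⟩

include hK hinv he

omit [CompleteSpace E] in
-- In the third term both entries of ∑ eᵢ ⊗ eⁱ carry Ad_{g⁻¹} once `actionMap_leftMulFst` is used,
-- and this isometry drops out of the contraction.
theorem conjBivector_apply (p : G × G) (δ : Fin 2 → Module.Dual ℝ (TangentSpace (I.prod I) p)) :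
    conjBivector e e' p δ = ∑ r, ∑ s, frameCoeff r s *
      K (coframe hnd r p (δ 0)) (coframe hnd s p (δ 1)) := by
  have h : ∀ (L L' : GroupLieAlgebra I G →ₗ[ℝ] TangentSpace (I.prod I) p),
      ∑ i, wedge ![L (e i), L' (e' i)] δ =
      K (sharp hnd ((δ 0).comp L)) (sharp hnd ((δ 1).comp L')) -
        K (sharp hnd ((δ 0).comp L')) (sharp hnd ((δ 1).comp L)) := by
    intro L L'
    rw [← sum_mul_eq_sharp hnd hK he, hK.eq (sharp hnd ((δ 0).comp L')),
      ← sum_mul_eq_sharp hnd hK he, ← Finset.sum_sub_distrib]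
    refine Finset.sum_congr rfl fun i _ => ?_
    rw [wedge_pair, mul_comm (δ 0 (L' (e' i)))]
    rfl
  set A := (adjointAction I p.1⁻¹).toLinearMap
  have hA : ∀ u v, K (A u) (A v) = K u v := bilinForm_adjointAction K hinv p.1⁻¹
  have hs : Function.Surjective A := adjointAction_surjective p.1⁻¹
  have h1 := h (frameMap I 1 p).toLinearMap (frameMap I 2 p).toLinearMap
  have h2 := h (frameMap I 1 p).toLinearMap (frameMap I 0 p).toLinearMap
  have h3 := h ((frameMap I 2 p).toLinearMap.comp A) ((frameMap I 0 p).toLinearMap.comp A)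
  rw [← LinearMap.comp_assoc, ← LinearMap.comp_assoc, ← LinearMap.comp_assoc,
    ← LinearMap.comp_assoc, sharp_comp_pairing hnd hA hs, sharp_comp_pairing hnd hA hs] at h3
  have h4 : conjBivector e e' p δ = (1 / 2 : ℝ) *
      (∑ i, wedge ![frameMap I 1 p (e i), frameMap I 2 p (e' i)] δ -
        ∑ i, wedge ![frameMap I 1 p (e i), frameMap I 0 p (e' i)] δ -
        ∑ i, wedge ![frameMap I 2 p (A (e i)), frameMap I 0 p (A (e' i))] δ) := by
    simp only [conjBivector, inSecond_mulInvariantVectorField, inSecond_rightInvariantVectorField,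
      inFirst_mulInvariantVectorField, inFirst_rightInvariantVectorField, actionMap_leftMulFst,
      AlternatingMap.smul_apply, MultiVec.sum_apply, AlternatingMap.sub_apply,
      ← Finset.sum_sub_distrib, smul_eq_mul]
    rfl
  refine h4.trans ?_
  refine (congrArg₂ (fun a b => (1 / 2 : ℝ) * (a - b)) (congrArg₂ (· - ·) h1 h2) h3).trans ?_
  simp only [Fin.sum_univ_three, frameCoeff, Matrix.cons_val_zero, Matrix.cons_val_one,
    Matrix.cons_val, coframe]
  ring

end ConjBivector

theorem sum_prod_four {κ ι : Type*} [Fintype κ] [Fintype ι]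
    (T : κ × ι → κ × ι → κ × ι → κ × ι → ℝ) :
    ∑ a, ∑ b, ∑ c, ∑ d, T a b c d = ∑ r, ∑ s, ∑ t, ∑ q, ∑ i, ∑ j, ∑ k, ∑ l,
      T (r, i) (s, j) (t, k) (q, l) := by
  have h2 : ∀ A : ι → ι → κ → ℝ, ∑ i, ∑ j, ∑ t, A i j t = ∑ t, ∑ i, ∑ j, A i j t := fun A =>
    (Finset.sum_congr rfl fun i _ => Finset.sum_comm).trans Finset.sum_comm
  have h3 : ∀ A : ι → ι → ι → κ → ℝ, ∑ i, ∑ j, ∑ k, ∑ t, A i j k t = ∑ t, ∑ i, ∑ j, ∑ k, A i j k t :=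
    fun A => (Finset.sum_congr rfl fun i _ => h2 _).trans Finset.sum_comm
  simp only [Fintype.sum_prod_type]
  refine Finset.sum_congr rfl fun r _ => Finset.sum_comm.trans ?_
  refine Finset.sum_congr rfl fun s _ => (h2 _).trans ?_
  refine Finset.sum_congr rfl fun t _ => (h3 _).trans ?_
  rfl

theorem frameCoeff_antisymm (r s : Fin 3) : frameCoeff r s = -frameCoeff s r := by
  fin_cases r <;> fin_cases s <;> simp [frameCoeff] <;> norm_num

/-! ### Computation of [Π, Π] -/

section Brackets

variable {E : Type*} [NormedAddCommGroup E] [NormedSpace ℝ E] [FiniteDimensional ℝ E]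
  {H : Type*} [TopologicalSpace H]
  {I : ModelWithCorners ℝ E H} {G : Type*} [TopologicalSpace G] [ChartedSpace H G] [Group G]
  [LieGroup I ∞ G] [I.Boundaryless] [PreconnectedSpace G]
  {K : LinearMap.BilinForm ℝ (GroupLieAlgebra I G)} (hnd : K.Nondegenerate)
  (hK : K.IsSymm) (hinv : ∀ x y z, K ⁅x, y⁆ z = K x ⁅y, z⁆)
  {ι : Type*} [Fintype ι] [DecidableEq ι] {e : Module.Basis ι ℝ (GroupLieAlgebra I G)}
  {e' : ι → GroupLieAlgebra I G} (he : ∀ i j, K (e i) (e' j) = if i = j then 1 else 0)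

omit [I.Boundaryless] [PreconnectedSpace G] in
theorem sharp_comp_actionMap_conjMul (p : G × G) (δ : Module.Dual ℝ (TangentSpace (I.prod I) p)) :
    sharp hnd (δ.comp (actionMap I (I.prod I) conjMul p).toLinearMap) =
      coframe hnd 0 p δ + coframe hnd 1 p δ - coframe hnd 2 p δ := by
  rw [coframe, coframe, coframe, ← map_add, ← map_sub]
  congr 1
  ext u
  refine (congrArg δ (actionMap_conjMul p u)).trans ?_
  rw [map_sub, map_add]
  rfl

include hinv in
-- The relation z₁ = Ad_{s⁻¹} z₂, dual to `frameMap_two`.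
theorem adjointAction_sharp_comp_frameMap (p : G × G) (δ : Module.Dual ℝ (TangentSpace (I.prod I) p)) :
    adjointAction I p.2⁻¹ (coframe hnd 2 p δ) = coframe hnd 1 p δ := by
  have h : coframe hnd 2 p δ = sharp hnd ((δ.comp (frameMap I 1 p).toLinearMap).comp
      (adjointAction I p.2⁻¹).toLinearMap) := by
    rw [coframe]
    congr 1
    ext u
    exact congrArg δ (frameMap_two p u)
  rw [h]
  exact apply_sharp_comp hnd (A := (adjointAction I p.2⁻¹).toLinearMap) (bilinForm_adjointAction K hinv p.2⁻¹)
    (adjointAction_surjective p.2⁻¹) _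

include hinv in
theorem adjointAction_sharp_comp_leftMulFst (p : G × G)
    (δ : Module.Dual ℝ (TangentSpace (I.prod I) p)) :
    adjointAction I p.1⁻¹ (sharp hnd (δ.comp (actionMap I (I.prod I) leftMulFst p).toLinearMap)) =
      coframe hnd 0 p δ := by
  have h : sharp hnd (δ.comp (actionMap I (I.prod I) leftMulFst p).toLinearMap) =
      sharp hnd ((δ.comp (frameMap I 0 p).toLinearMap).comp
      (adjointAction I p.1⁻¹).toLinearMap) := by
    congr 1
    ext u
    exact congrArg δ (actionMap_leftMulFst p u)
  rw [h]
  exact apply_sharp_comp hnd (A := (adjointAction I p.1⁻¹).toLinearMap) (bilinForm_adjointAction K hinv p.1⁻¹)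
    (adjointAction_surjective p.1⁻¹) _

theorem bilinForm_lie_adjointAction [CompleteSpace E] (hinv : ∀ x y z, K ⁅x, y⁆ z = K x ⁅y, z⁆)
    (g : G) (u v w : GroupLieAlgebra I G) :
    K (adjointAction I g u) ⁅adjointAction I g v, adjointAction I g w⁆ = K u ⁅v, w⁆ := by
  rw [← adjointAction_lie, bilinForm_adjointAction K hinv]

omit [I.Boundaryless] [PreconnectedSpace G] in
theorem leftInvariant_cartanSection_apply (x : G × G)
    (δ : Fin 3 → Module.Dual ℝ (TangentSpace (I.prod I) x)) :
    leftInvariant (cartanSection K hnd hinv) x δ =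
      1 / 4 * K (sharp hnd ((δ 0).comp (actionMap I (I.prod I) conjMul x).toLinearMap))
        ⁅sharp hnd ((δ 1).comp (actionMap I (I.prod I) conjMul x).toLinearMap),
          sharp hnd ((δ 2).comp (actionMap I (I.prod I) conjMul x).toLinearMap)⁆ := by
  have h : ∀ n, (((δ n).comp (leftTranslation (I.prod I) I (conjGroupoid G) x)).comp
      (constantSection ((conjGroupoid G).src x)) : Module.Dual ℝ (GroupLieAlgebra I G)) =
      (δ n).comp (actionMap I (I.prod I) conjMul x).toLinearMap := fun n =>
    LinearMap.ext fun u => congrArg (δ n) (leftTranslation_constantSection x u)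
  rw [← h, ← h, ← h]
  rfl

theorem rightInvariant_cartanSection_apply [CompleteSpace E] (x : G × G)
    (δ : Fin 3 → Module.Dual ℝ (TangentSpace (I.prod I) x)) :
    rightInvariant (cartanSection K hnd hinv) x δ =
      1 / 4 * K (coframe hnd 0 x (δ 0)) ⁅coframe hnd 0 x (δ 1), coframe hnd 0 x (δ 2)⁆ := by
  have h : ∀ n, (((δ n).comp (rightTranslation (I.prod I) I (conjGroupoid G) x)).comp
      (constantSection ((conjGroupoid G).tgt x)) : Module.Dual ℝ (GroupLieAlgebra I G)) =
      (δ n).comp (actionMap I (I.prod I) leftMulFst x).toLinearMap := fun n =>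
    LinearMap.ext fun u => congrArg (δ n) (rightTranslation_constantSection x u)
  have h' := adjointAction_sharp_comp_leftMulFst hnd hinv x
  rw [← h', ← h', ← h', bilinForm_lie_adjointAction hinv, ← h, ← h, ← h]
  rfl

include hnd hK hinv he

omit [LieGroup I ∞ G] [I.Boundaryless] [PreconnectedSpace G] hinv in
theorem sum_frameCoeff_gram (α β : Fin 3 → Module.Dual ℝ (GroupLieAlgebra I G)) :
    ∑ a : Fin 3 × ι, ∑ b : Fin 3 × ι, frameCoeff a.1 b.1 * K (e' a.2) (e' b.2) *
      (α a.1 (e a.2) * β b.1 (e b.2)) =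
    ∑ r, ∑ s, frameCoeff r s * K (sharp hnd (α r)) (sharp hnd (β s)) := by
  simp only [Fintype.sum_prod_type]
  refine Finset.sum_congr rfl fun r _ => ?_
  rw [Finset.sum_comm]
  refine Finset.sum_congr rfl fun s _ => ?_
  rw [← sum_sum_gram hnd hK he, Finset.mul_sum]
  refine Finset.sum_congr rfl fun i _ => ?_
  rw [Finset.mul_sum]
  exact Finset.sum_congr rfl fun j _ => mul_assoc _ _ _

theorem conjBivector_eq_sum (p : G × G) (δ : Fin 2 → Module.Dual ℝ (TangentSpace (I.prod I) p)) :
    conjBivector e e' p δ = ∑ a : Fin 3 × ι, ∑ b : Fin 3 × ι,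
      frameCoeff a.1 b.1 * K (e' a.2) (e' b.2) *
        (δ 0 (frameMap I a.1 p (e a.2)) * δ 1 (frameMap I b.1 p (e b.2))) :=
  (conjBivector_apply hnd hK hinv he p δ).trans
    (sum_frameCoeff_gram hnd hK he (fun r => (δ 0).comp (frameMap I r p).toLinearMap)
      fun r => (δ 1).comp (frameMap I r p).toLinearMap).symm

theorem isSmooth_conjBivector : (conjBivector (I := I) e e').IsSmooth :=
  isSmooth_bivector (fun a : Fin 3 × ι => isSmoothField_actionMap (contMDiff_frameAction a.1)
    (frameAction_one a.1) (e a.2)) (conjBivector_eq_sum hnd hK hinv he)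

theorem schouten_conjBivector_self [CompleteSpace E] :
    IsSchoutenBracket (k := 1) (l := 1) (conjBivector (I := I) e e') (conjBivector e e')
    ((2 : ℝ) • (leftInvariant (cartanSection K hnd hinv) -
      rightInvariant (cartanSection K hnd hinv))) := by
  intro U hU f hf x hx
  rw [schouten_bivector_self (fun a : Fin 3 × ι => isSmoothField_actionMap
    (contMDiff_frameAction a.1) (frameAction_one a.1) (e a.2))
    (fun a b => ?_) (conjBivector_eq_sum hnd hK hinv he) hU hf hx]
  · have h1 := sum_perm_frameCoeff hK hinv
      (fun r n => coframe hnd r x (differential (I.prod I) (f n) x)) (by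
        simp only [← adjointAction_sharp_comp_frameMap hnd hinv x]
        exact bilinForm_lie_adjointAction hinv _ _ _ _)
    have h2 := leftInvariant_cartanSection_apply hnd hinv x fun i => differential (I.prod I) (f i) x
    have h3 := rightInvariant_cartanSection_apply hnd hinv x fun i => differential (I.prod I) (f i) x
    simp only [sharp_comp_actionMap_conjMul] at h2
    refine Eq.trans ?_ (h1.trans (congrArg₂ (fun a b => (2 : ℝ) * (a - b)) h2.symm h3.symm))
    refine Finset.sum_congr rfl fun σ _ => ?_
    congr 1
    rw [sum_prod_four]
    refine Finset.sum_congr rfl fun r _ => Finset.sum_congr rfl fun s _ => ?_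
    rw [Finset.sum_comm]
    refine Finset.sum_congr rfl fun q _ => ?_
    simp only [fieldDeriv_frameMap_comm hU (hf _) hx]
    -- Fields of different index commute, so only commutators within one family survive.
    rw [Finset.sum_eq_single s]
    · set α := fun r n => (differential (I.prod I) (f n) x).comp (frameMap I r x).toLinearMap with hα
      -- The two Gram matrices are contracted with the bilinear map (u, v) ↦ α_s([u, v]).
      have h4 := sum_gram_gram hnd hK he (α r (σ 0)) (α q (σ 2))
        (LinearMap.compr₂ (LieModule.toEnd ℝ (GroupLieAlgebra I G) (GroupLieAlgebra I G) :
          GroupLieAlgebra I G →ₗ[ℝ] GroupLieAlgebra I G →ₗ[ℝ] GroupLieAlgebra I G) (α s (σ 1)))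
      have h5 : K (coframe hnd s x (differential (I.prod I) (f (σ 1)) x))
          ⁅coframe hnd r x (differential (I.prod I) (f (σ 0)) x),
            coframe hnd q x (differential (I.prod I) (f (σ 2)) x)⁆ = _ :=
        (sharp_left hnd (α s (σ 1)) _).trans h4.symm
      rw [h5]
      simp only [Finset.mul_sum, if_true]
      refine Finset.sum_congr rfl fun i _ => Finset.sum_congr rfl fun j _ =>
        Finset.sum_congr rfl fun k _ => Finset.sum_congr rfl fun l _ => ?_
      have h6 : ∀ t n v, fieldDeriv (fun p => frameMap I t p v) (f n) x = α t n v :=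
        fun _ _ _ => rfl
      have h7 : (LinearMap.compr₂ (LieModule.toEnd ℝ (GroupLieAlgebra I G) (GroupLieAlgebra I G) :
          GroupLieAlgebra I G →ₗ[ℝ] GroupLieAlgebra I G →ₗ[ℝ] GroupLieAlgebra I G) (α s (σ 1)))
          (e j) (e k) = α s (σ 1) ⁅e j, e k⁆ := rfl
      rw [h6, h6, h6, h7]
      ring
    · intro t _ hts
      simp [hts.symm]
    · simp
  · rw [frameCoeff_antisymm, hK.eq, neg_mul]

end Brackets

theorem sharp_lie_sharp_eq_sum {V : Type*} [LieRing V] [LieAlgebra ℝ V] [FiniteDimensional ℝ V]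
    {K : LinearMap.BilinForm ℝ V} (hnd : K.Nondegenerate) (hK : K.IsSymm)
    {ι : Type*} [Fintype ι] [DecidableEq ι] {e : Module.Basis ι ℝ V} {e' : ι → V}
    (he : ∀ i j, K (e i) (e' j) = if i = j then 1 else 0) (α β γ : Module.Dual ℝ V) :
    K (sharp hnd α) ⁅sharp hnd β, sharp hnd γ⁆ =
      ∑ i, ∑ j, ∑ k, K (e' i) ⁅e' j, e' k⁆ * (α (e i) * β (e j) * γ (e k)) := by
  rw [sharp_eq_sum hnd hK he α, map_sum K, LinearMap.sum_apply]
  refine Finset.sum_congr rfl fun i _ => ?_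
  rw [sharp_eq_sum hnd hK he β, sum_lie, map_sum]
  refine Finset.sum_congr rfl fun j _ => ?_
  rw [sharp_eq_sum hnd hK he γ, lie_sum, map_sum]
  refine Finset.sum_congr rfl fun k _ => ?_
  rw [map_smul, LinearMap.smul_apply, smul_lie, map_smul, lie_smul, map_smul]
  simp only [smul_eq_mul]
  ring

/-! ### Computation of [Π, ←Ω] -/

section BracketSection

variable {E : Type*} [NormedAddCommGroup E] [NormedSpace ℝ E] {H : Type*} [TopologicalSpace H]
  {I : ModelWithCorners ℝ E H} {G : Type*} [TopologicalSpace G] [ChartedSpace H G] [Group G]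
  [LieGroup I ∞ G]

theorem fieldDeriv_conjMul (f : G × G → ℝ) (p : G × G) (u : GroupLieAlgebra I G) :
    fieldDeriv (fun p => actionMap I (I.prod I) conjMul p u) f p =
      ∑ r, frameSign r * fieldDeriv (fun p => frameMap I r p u) f p := by
  refine (congrArg (differential (I.prod I) f p) (actionMap_conjMul p u)).trans ?_
  rw [map_sub, map_add, Fin.sum_univ_three]
  simp only [frameSign, Matrix.cons_val_zero, Matrix.cons_val_one, Matrix.cons_val, fieldDeriv]
  ring

/-- In Y = ∑ ε_r X_r only the r = s term contributes, with factor ε_s² = 1, so Y(u) acts on all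
three families by ad u without signs. -/
theorem fieldDeriv_conjMul_frameMap_comm [I.Boundaryless] [CompleteSpace E] {U : Set (G × G)}
    (hU : IsOpen U) {f : G × G → ℝ} (hf : ContMDiffOn (I.prod I) 𝓘(ℝ, ℝ) ∞ f U) {p : G × G}
    (hp : p ∈ U) (s : Fin 3) (u v : GroupLieAlgebra I G) :
    fieldDeriv (fun p => actionMap I (I.prod I) conjMul p u)
        (fieldDeriv (fun p => frameMap I s p v) f) p -
      fieldDeriv (fun p => frameMap I s p v)
        (fieldDeriv (fun p => actionMap I (I.prod I) conjMul p u) f) p =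
      fieldDeriv (fun p => frameMap I s p ⁅u, v⁆) f p := by
  have hd : ∀ r, MDifferentiableAt (I.prod I) 𝓘(ℝ, ℝ)
      (fieldDeriv (fun p => frameMap I r p u) f) p := fun r =>
    mdifferentiableAt_of_contMDiffOn hU (contMDiffOn_fieldDeriv_actionMap
      (contMDiff_frameAction r) (frameAction_one r) hU hf u) hp
  have h1 : fieldDeriv (fun p => actionMap I (I.prod I) conjMul p u) f =
      fun p => ∑ r, frameSign r * fieldDeriv (fun p => frameMap I r p u) f p :=
    funext fun p => fieldDeriv_conjMul f p u
  have h2 : ∀ r ∈ Finset.univ, MDifferentiableAt (I.prod I) 𝓘(ℝ, ℝ)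
      ((fun r p => frameSign r * fieldDeriv (fun p => frameMap I r p u) f p) r) p :=
    fun r _ => mdifferentiableAt_const.mul (hd r)
  rw [fieldDeriv_conjMul, h1, (mdifferentiableAt_sum Finset.univ h2).2, ← Finset.sum_sub_distrib,
    Finset.sum_eq_single s]
  · rw [fieldDeriv_const_mul _ _ (hd s), ← mul_sub, fieldDeriv_frameMap_comm hU hf hp, if_pos rfl,
      ← mul_assoc]
    have : frameSign s * frameSign s = 1 := by fin_cases s <;> simp [frameSign]
    rw [this, one_mul]
  · intro r _ hr
    rw [fieldDeriv_const_mul _ _ (hd r), ← mul_sub, fieldDeriv_frameMap_comm hU hf hp, if_neg hr,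
      mul_zero]
  · simp

variable [FiniteDimensional ℝ E] [I.Boundaryless] [CompleteSpace E] [PreconnectedSpace G]
  {K : LinearMap.BilinForm ℝ (GroupLieAlgebra I G)} (hnd : K.Nondegenerate)
  (hK : K.IsSymm) (hinv : ∀ x y z, K ⁅x, y⁆ z = K x ⁅y, z⁆)
  {ι : Type*} [Fintype ι] [DecidableEq ι] {e : Module.Basis ι ℝ (GroupLieAlgebra I G)}
  {e' : ι → GroupLieAlgebra I G} (he : ∀ i j, K (e i) (e' j) = if i = j then 1 else 0)

include hnd hK hinv he

theorem schouten_conjBivector_cartanSection :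
    IsSchoutenBracket (k := 1) (l := 2) (conjBivector (I := I) e e')
      (leftInvariant (cartanSection K hnd hinv)) 0 := by
  intro U hU f hf x hx
  refine (schouten_bivector_trivector (X := fun a : Fin 3 × ι => fun p => frameMap I a.1 p (e a.2))
    (m := fun a b => frameCoeff a.1 b.1 * K (e' a.2) (e' b.2))
    (Y := fun i p => actionMap I (I.prod I) conjMul p (e i))
    (q := fun i j k => 1 / 4 * K (e' i) ⁅e' j, e' k⁆)
    (fun a => isSmoothField_actionMap
      (contMDiff_frameAction a.1) (frameAction_one a.1) (e a.2))
    (fun i => isSmoothField_actionMap contMDiff_conjMul conjMul_one (e i))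
    (conjBivector_eq_sum hnd hK hinv he) (fun x δ => ?_) (fun i j k => ?_) (fun i j k => ?_)
    hU (fun f g hf hg x hx k => ?_) (fun a b => ?_) hf hx).trans rfl
  · rw [leftInvariant_cartanSection_apply, sharp_lie_sharp_eq_sum hnd hK he]
    simp only [Finset.mul_sum]
    refine Finset.sum_congr rfl fun i _ => Finset.sum_congr rfl fun j _ =>
      Finset.sum_congr rfl fun k _ => ?_
    exact (mul_assoc _ _ _).symm
  · rw [invariant_rotate hK hinv (e' i), invariant_swap (e' j) (e' i), mul_neg, neg_neg]
  · rw [invariant_rotate hK hinv]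
  · rw [← sub_eq_zero]
    set α : (G × G → ℝ) → Fin 3 → Module.Dual ℝ (GroupLieAlgebra I G) := fun h r =>
      (differential (I.prod I) h x).comp (frameMap I r x).toLinearMap with hα
    set ad : GroupLieAlgebra I G →ₗ[ℝ] GroupLieAlgebra I G :=
      LieModule.toEnd ℝ (GroupLieAlgebra I G) (GroupLieAlgebra I G) (e k) with had
    have h1 := sum_frameCoeff_gram hnd hK he (fun r => (α f r).comp ad) (α g)
    have h2 := sum_frameCoeff_gram hnd hK he (α f) (fun r => (α g r).comp ad)
    -- The operator ad(e_k) is skew for K; this is the infinitesimal invariance of Π under Y(e_k).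
    have h3 : ∀ r s, K (sharp hnd ((α f r).comp ad)) (sharp hnd (α g s)) +
        K (sharp hnd (α f r)) (sharp hnd ((α g s).comp ad)) = 0 := by
      intro r s
      have e1 : K (sharp hnd ((α f r).comp ad)) (sharp hnd (α g s)) =
          K (sharp hnd (α f r)) ⁅e k, sharp hnd (α g s)⁆ := by
        rw [sharp_left, sharp_left]; rfl
      have e2 : K (sharp hnd (α f r)) (sharp hnd ((α g s).comp ad)) =
          K (sharp hnd (α g s)) ⁅e k, sharp hnd (α f r)⁆ := by
        rw [hK.eq, sharp_left, sharp_left]; rfl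
      rw [e1, e2, ← invariant_rotate hK hinv, invariant_swap, neg_add_cancel]
    have h4 : ∑ a : Fin 3 × ι, ∑ b : Fin 3 × ι, frameCoeff a.1 b.1 * K (e' a.2) (e' b.2) *
        (((α f a.1).comp ad) (e a.2) * α g b.1 (e b.2)) +
        ∑ a : Fin 3 × ι, ∑ b : Fin 3 × ι, frameCoeff a.1 b.1 * K (e' a.2) (e' b.2) *
        (α f a.1 (e a.2) * ((α g b.1).comp ad) (e b.2)) = 0 := by
      rw [h1, h2]
      simp only [← Finset.sum_add_distrib, ← mul_add, h3, mul_zero, Finset.sum_const_zero]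
    rw [← h4]
    simp only [← Finset.sum_add_distrib, ← Finset.sum_sub_distrib]
    refine Finset.sum_congr rfl fun a _ => Finset.sum_congr rfl fun b _ => ?_
    have e1 := fieldDeriv_conjMul_frameMap_comm hU hf hx a.1 (e k) (e a.2)
    have e2 := fieldDeriv_conjMul_frameMap_comm hU hg hx b.1 (e k) (e b.2)
    have e3 : ((α f a.1).comp ad) (e a.2) = fieldDeriv (fun p => frameMap I a.1 p ⁅e k, e a.2⁆) f x :=
      rfl
    have e4 : ((α g b.1).comp ad) (e b.2) = fieldDeriv (fun p => frameMap I b.1 p ⁅e k, e b.2⁆) g x :=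
      rfl
    have e5 : ∀ h (c : Fin 3 × ι), α h c.1 (e c.2) = fieldDeriv (fun p => frameMap I c.1 p (e c.2)) h x :=
      fun _ _ => rfl
    rw [e3, e4, e5, e5, ← e1, ← e2]
    ring
  · rw [frameCoeff_antisymm, hK.eq, neg_mul]

end BracketSection

/-! ### Smoothness of the section -/

section SmoothSection

variable {E : Type*} [NormedAddCommGroup E] [NormedSpace ℝ E] [FiniteDimensional ℝ E]
  {H : Type*} [TopologicalSpace H]
  {I : ModelWithCorners ℝ E H} {G : Type*} [TopologicalSpace G] [ChartedSpace H G] [Group G]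
  [LieGroup I ∞ G] {K : LinearMap.BilinForm ℝ (GroupLieAlgebra I G)}

theorem isSmooth_cartanSection [CompleteSpace E] (hnd : K.Nondegenerate) (hK : K.IsSymm)
    (hinv : ∀ x y z, K ⁅x, y⁆ z = K x ⁅y, z⁆)
    {ι : Type*} [Fintype ι] [DecidableEq ι] {e : Module.Basis ι ℝ (GroupLieAlgebra I G)}
    {e' : ι → GroupLieAlgebra I G} (he : ∀ i j, K (e i) (e' j) = if i = j then 1 else 0) :
    (cartanSection K hnd hinv).IsSmooth := by
  intro U hU f hf
  have h1 : ∀ s : G, ((cartanSection K hnd hinv s).map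
      (algebroidFiber (I.prod I) I (conjGroupoid G) s).subtype
        fun i => differential (I.prod I) (f i) ((conjGroupoid G).one s)) =
      1 / 4 * ∑ i, ∑ j, ∑ k, K (e' i) ⁅e' j, e' k⁆ *
        (fieldDeriv (fun p => actionMap I (I.prod I) conjMul p (e i)) (f 0) ((1 : G), s) *
        fieldDeriv (fun p => actionMap I (I.prod I) conjMul p (e j)) (f 1) ((1 : G), s) *
        fieldDeriv (fun p => actionMap I (I.prod I) conjMul p (e k)) (f 2) ((1 : G), s)) := by
    intro s
    have h2 : ∀ n, (((differential (I.prod I) (f n) ((conjGroupoid G).one s)).comp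
        (algebroidFiber (I.prod I) I (conjGroupoid G) s).subtype).comp (constantSection s) :
        Module.Dual ℝ (GroupLieAlgebra I G)) = (differential (I.prod I) (f n) ((1 : G), s)).comp
        (actionMap I (I.prod I) conjMul ((1 : G), s)).toLinearMap := fun n =>
      LinearMap.ext fun u => congrArg (differential (I.prod I) (f n) ((1 : G), s))
        (constantVector_eq s u)
    refine Eq.trans ?_ (congrArg (1 / 4 * ·) (sharp_lie_sharp_eq_sum hnd hK he
      ((differential (I.prod I) (f 0) ((1 : G), s)).comp
        (actionMap I (I.prod I) conjMul ((1 : G), s)).toLinearMap)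
      ((differential (I.prod I) (f 1) ((1 : G), s)).comp
        (actionMap I (I.prod I) conjMul ((1 : G), s)).toLinearMap)
      ((differential (I.prod I) (f 2) ((1 : G), s)).comp
        (actionMap I (I.prod I) conjMul ((1 : G), s)).toLinearMap)))
    rw [← h2, ← h2, ← h2]
    rfl
  have h3 : ∀ i n, ContMDiffOn I 𝓘(ℝ, ℝ) ∞
      (fun s => fieldDeriv (fun p => actionMap I (I.prod I) conjMul p (e i)) (f n) ((1 : G), s))
      ((conjGroupoid G).one ⁻¹' U) := fun i n =>
    ContMDiffOn.comp (contMDiffOn_fieldDeriv_actionMap contMDiff_conjMul conjMul_one hU (hf n) (e i))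
      (contMDiff_const.prodMk contMDiff_id).contMDiffOn fun s hs => hs
  refine ContMDiffOn.congr ?_ fun s _ => h1 s
  refine contMDiffOn_const.mul ?_
  refine contMDiffOn_finsetSum fun i _ => contMDiffOn_finsetSum fun j _ =>
    contMDiffOn_finsetSum fun k _ => ?_
  exact contMDiffOn_const.mul (((h3 i 0).mul (h3 j 1)).mul (h3 k 2))

end SmoothSection

/-! ### Multiplicativity of Π -/

section Multiplicative

variable {E : Type*} [NormedAddCommGroup E] [NormedSpace ℝ E] [FiniteDimensional ℝ E]
  {H : Type*} [TopologicalSpace H]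
  {I : ModelWithCorners ℝ E H} {G : Type*} [TopologicalSpace G] [ChartedSpace H G] [Group G]
  [LieGroup I ∞ G] [I.Boundaryless] [PreconnectedSpace G]
  {K : LinearMap.BilinForm ℝ (GroupLieAlgebra I G)} (hnd : K.Nondegenerate)
  (hinv : ∀ x y z, K ⁅x, y⁆ z = K x ⁅y, z⁆)

section

variable {x y : G × G} (hxy : (conjGroupoid G).src x = (conjGroupoid G).tgt y)
  {ξ : Module.Dual ℝ (TangentSpace (I.prod I) x)} {η : Module.Dual ℝ (TangentSpace (I.prod I) y)}
  {δ : Module.Dual ℝ (TangentSpace (I.prod I) ((conjGroupoid G).mul x y))}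
  (hc : CotangentComp (I.prod I) I (conjGroupoid G) x y ξ η δ)
include hinv hxy hc

/-- For y = (h, t), moving only x by right translation of its first factor preserves composability,
and g k h = g h (h⁻¹ k h). -/
theorem coframe_zero_mul :
    adjointAction I y.1⁻¹ (coframe hnd 0 x ξ) =
      coframe hnd 0 ((conjGroupoid G).mul x y) δ := by
  have h : (ξ.comp (frameMap I 0 x).toLinearMap : Module.Dual ℝ (GroupLieAlgebra I G)) =
      (δ.comp (frameMap I 0 ((conjGroupoid G).mul x y)).toLinearMap).comp
      (adjointAction I y.1⁻¹).toLinearMap := by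
    ext u
    have h1 := cotangentComp_mfderiv (c₁ := frameAction 0 x) (c₂ := fun _ => y)
      ((contMDiff_action_right (contMDiff_frameAction 0) _).contMDiffAt.mdifferentiableAt (by simp))
      mdifferentiableAt_const (frameAction_one _ _) rfl (fun _ => hxy) hc u
    have h2 : (mfderiv I (I.prod I)
        (fun k => (conjGroupoid G).mul (frameAction 0 x k) y) 1 u : E × E) = _ :=
      mfderiv_comp_conj (d := frameAction 0 ((conjGroupoid G).mul x y))
        ((contMDiff_action_right (contMDiff_frameAction 0) _).contMDiffAt.mdifferentiableAt (by simp))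
        y.1⁻¹ (fun k => by simp [conjGroupoid, frameAction, rightMulFst, mul_assoc]) u
    have h3 : η (mfderiv I (I.prod I) (fun _ : G => y) 1 u : E × E) = 0 :=
      (congrArg η (mfderiv_const_apply y (1 : G) u)).trans (map_zero η)
    rw [h3, add_zero] at h1
    exact h1.trans (congrArg δ h2)
  rw [coframe, h]
  exact apply_sharp_comp hnd (A := (adjointAction I y.1⁻¹).toLinearMap)
    (bilinForm_adjointAction K hinv y.1⁻¹) (adjointAction_surjective y.1⁻¹) _

/-- Translating the second factor of x by k and that of y by h⁻¹ k h preserves x.2 = h t h⁻¹ and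
translates the product by h⁻¹ k h as well. -/
theorem coframe_mul {r : Fin 3} (hr : r ≠ 0) :
    adjointAction I y.1⁻¹ (coframe hnd r x ξ) + coframe hnd r y η =
      coframe hnd r ((conjGroupoid G).mul x y) δ := by
  have hsrc : ∀ k, (conjGroupoid G).src (frameAction r x k) =
      (conjGroupoid G).tgt (frameAction r y (y.1⁻¹ * k * y.1⁻¹⁻¹)) := by
    intro k
    have hx : x.2 = y.1 * y.2 * y.1⁻¹ := hxy
    have h : r = 1 ∨ r = 2 := by omega
    rcases h with rfl | rfl <;>
      simp [conjGroupoid, frameAction, rightMulSnd, leftMulSnd, hx, mul_assoc]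
  have hmul : ∀ k, (conjGroupoid G).mul (frameAction r x k)
      (frameAction r y (y.1⁻¹ * k * y.1⁻¹⁻¹)) =
      frameAction r ((conjGroupoid G).mul x y) (y.1⁻¹ * k * y.1⁻¹⁻¹) := by
    intro k
    have h : r = 1 ∨ r = 2 := by omega
    rcases h with rfl | rfl <;> simp [conjGroupoid, frameAction, rightMulSnd, leftMulSnd]
  have hd : ∀ z : G × G, ContMDiff I (I.prod I) ∞ (frameAction r z) := fun z =>
    contMDiff_action_right (contMDiff_frameAction r) z
  have h : (ξ.comp (frameMap I r x).toLinearMap : Module.Dual ℝ (GroupLieAlgebra I G)) =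
      (δ.comp (frameMap I r ((conjGroupoid G).mul x y)).toLinearMap -
        η.comp (frameMap I r y).toLinearMap).comp (adjointAction I y.1⁻¹).toLinearMap := by
    ext u
    have h1 := cotangentComp_mfderiv (c₁ := frameAction r x)
      (c₂ := fun k => frameAction r y (y.1⁻¹ * k * y.1⁻¹⁻¹))
      ((hd x).contMDiffAt.mdifferentiableAt (by simp))
      (((hd y).comp (contMDiff_conj y.1⁻¹)).contMDiffAt.mdifferentiableAt (by simp))
      (frameAction_one _ _) (by simp [frameAction_one]) hsrc hc u
    have h2 := mfderiv_comp_conj ((hd y).contMDiffAt.mdifferentiableAt (by simp)) y.1⁻¹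
      (fun k => rfl) u
    have h3 := mfderiv_comp_conj ((hd ((conjGroupoid G).mul x y)).contMDiffAt.mdifferentiableAt
      (by simp)) y.1⁻¹ hmul u
    exact eq_sub_of_add_eq ((congrArg (fun z => ξ (frameMap I r x u) + z) (congrArg η h2)).symm.trans
      (h1.trans (congrArg δ h3)))
  rw [coframe, h, ← eq_sub_iff_add_eq, coframe, coframe, ← map_sub]
  exact apply_sharp_comp hnd (A := (adjointAction I y.1⁻¹).toLinearMap)
    (bilinForm_adjointAction K hinv y.1⁻¹) (adjointAction_surjective y.1⁻¹) _

/-- Inserting k and k⁻¹ between the two factors does not change the product, so the pairings with ξ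
and η cancel. -/
theorem coframe_conjMul_eq :
    adjointAction I y.1⁻¹ (coframe hnd 0 x ξ + coframe hnd 1 x ξ - coframe hnd 2 x ξ) =
      coframe hnd 0 y η := by
  rw [← sharp_comp_actionMap_conjMul]
  have hl : ContMDiff I (I.prod I) ∞ (leftMulFst y) := contMDiff_action_right contMDiff_leftMulFst y
  have h : (ξ.comp (actionMap I (I.prod I) conjMul x).toLinearMap :
      Module.Dual ℝ (GroupLieAlgebra I G)) =
      (η.comp (frameMap I 0 y).toLinearMap).comp (adjointAction I y.1⁻¹).toLinearMap := by
    ext u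
    have h1 := cotangentComp_mfderiv (c₁ := conjMul x) (c₂ := fun k => leftMulFst y k⁻¹)
      ((contMDiff_action_right contMDiff_conjMul _).contMDiffAt.mdifferentiableAt (by simp))
      ((hl.comp contMDiff_id.inv).contMDiffAt.mdifferentiableAt (by simp))
      (conjMul_one _) (by simp [leftMulFst_one]) (fun k => by
        have hx : x.2 = y.1 * y.2 * y.1⁻¹ := hxy
        simp [conjGroupoid, conjMul, leftMulFst, hx, mul_assoc]) hc u
    have h2 := mfderiv_comp_inv hl.contMDiffAt u
    have h3 : (fun k => (conjGroupoid G).mul (conjMul x k) (leftMulFst y k⁻¹)) =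
        fun _ => (conjGroupoid G).mul x y := by
      funext k; simp [conjGroupoid, conjMul, leftMulFst]
    rw [h3] at h1
    have h4 : δ (mfderiv I (I.prod I) (fun _ : G => (conjGroupoid G).mul x y) 1 u : E × E) = 0 :=
      (congrArg δ (mfderiv_const_apply _ (1 : G) u)).trans (map_zero δ)
    have h5 : ξ (actionMap I (I.prod I) conjMul x u) + -η (actionMap I (I.prod I) leftMulFst y u) = 0 := by
      refine Eq.trans ?_ (h1.trans h4)
      refine congrArg (fun z => ξ (actionMap I (I.prod I) conjMul x u) + z) ?_
      exact (map_neg η _).symm.trans (congrArg η h2).symm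
    exact (add_neg_eq_zero.1 h5).trans (congrArg η (actionMap_leftMulFst y u))
  rw [h]
  exact apply_sharp_comp hnd (A := (adjointAction I y.1⁻¹).toLinearMap)
    (bilinForm_adjointAction K hinv y.1⁻¹) (adjointAction_surjective y.1⁻¹) _

end

theorem isMultiplicative_conjBivector (hK : K.IsSymm)
    {ι : Type*} [Fintype ι] [DecidableEq ι] {e : Module.Basis ι ℝ (GroupLieAlgebra I G)}
    {e' : ι → GroupLieAlgebra I G} (he : ∀ i j, K (e i) (e' j) = if i = j then 1 else 0)
    (hnd : K.Nondegenerate) (hinv : ∀ x y z, K ⁅x, y⁆ z = K x ⁅y, z⁆) :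
    IsMultiplicative (I.prod I) I (conjGroupoid G) (conjBivector e e') := by
  intro x y hxy ξ η δ hc
  have hD : ∀ g u v, K (adjointAction I g u) (adjointAction I g v) = K u v :=
    bilinForm_adjointAction K hinv
  rw [conjBivector_apply hnd hK hinv he, conjBivector_apply hnd hK hinv he,
    conjBivector_apply hnd hK hinv he]
  simp only [← coframe_zero_mul hnd hinv hxy (hc _), Fin.sum_univ_three,
    ← coframe_mul hnd hinv hxy (hc _) (r := 1) (by decide),
    ← coframe_mul hnd hinv hxy (hc _) (r := 2) (by decide),
    ← coframe_conjMul_eq hnd hinv hxy (hc _)]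
  have hs : ∀ i, adjointAction I y.1⁻¹ (coframe hnd 1 x (ξ i)) =
      adjointAction I y.2⁻¹ (adjointAction I y.1⁻¹ (coframe hnd 2 x (ξ i))) := by
    intro i
    have hx : x.2 = y.1 * y.2 * y.1⁻¹ := hxy
    rw [← adjointAction_sharp_comp_frameMap hnd hinv x, ← adjointAction_mul, ← adjointAction_mul, hx]
    simp [mul_assoc]
  -- Both the transported x-components and the y-components with index 1 arise from those with index
  -- 2 by the same Ad_{t⁻¹}, an isometry.
  have e1 : ∀ i j, K (adjointAction I y.1⁻¹ (coframe hnd 1 x (ξ i))) (coframe hnd 1 y (η j)) =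
      K (adjointAction I y.1⁻¹ (coframe hnd 2 x (ξ i))) (coframe hnd 2 y (η j)) := fun i j => by
    rw [hs, ← adjointAction_sharp_comp_frameMap hnd hinv y, hD]
  have e2 := e1 0 1
  have e3 := e1 1 0
  rw [hK.eq, hK.eq (adjointAction I y.1⁻¹ (coframe hnd 2 x (ξ 1)))] at e3
  simp only [← hD y.1⁻¹ (coframe hnd _ x (ξ 0)), frameCoeff, Matrix.cons_val_zero,
    Matrix.cons_val_one, Matrix.cons_val, map_add, map_sub, LinearMap.add_apply,
    LinearMap.sub_apply]
  -- After substitution the surplus of the product over the two factors consists of the pairings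
  -- between x and y with equal index 1 or 2.
  linear_combination (1 / 2 : ℝ) * e3 - (1 / 2 : ℝ) * e2

end Multiplicative

end QuasiPoisson

end

theorem mainTheorem7 {E : Type*} [NormedAddCommGroup E] [NormedSpace ℝ E] [FiniteDimensional ℝ E]
    {H : Type*} [TopologicalSpace H] {I : ModelWithCorners ℝ E H} [I.Boundaryless]
    {G : Type*} [TopologicalSpace G] [ChartedSpace H G] [Group G] [LieGroup I ∞ G]
    [SimplyConnectedSpace G]
    (K : LinearMap.BilinForm ℝ (GroupLieAlgebra I G)) (hK : K.IsSymm) (hnd : K.Nondegenerate)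
    (hinv : ∀ x y z, K ⁅x, y⁆ z = K x ⁅y, z⁆)
    {ι : Type*} [Fintype ι] [DecidableEq ι] (e : Module.Basis ι ℝ (GroupLieAlgebra I G))
    (e' : ι → GroupLieAlgebra I G) (he : ∀ i j, K (e i) (e' j) = if i = j then 1 else 0) :
    (∀ (g : G) (u v w : GroupLieAlgebra I G),
        cartanForm K hinv ![adjointAction I g u, adjointAction I g v, adjointAction I g w] =
          cartanForm K hinv ![u, v, w]) ∧
      IsQuasiPoissonGroupoid (I.prod I) I (conjGroupoid G) (conjBivector e e')
        (cartanSection K hnd hinv) := by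
  have : CompleteSpace E := FiniteDimensional.complete ℝ E
  exact ⟨fun g u v w => congrArg (1 / 4 * ·) (bilinForm_lie_adjointAction hinv g u v w),
    isLieGroupoid_conjGroupoid, isSmooth_conjBivector hnd hK hinv he,
    isSmooth_cartanSection hnd hK hinv he, isMultiplicative_conjBivector hK he hnd hinv,
    schouten_conjBivector_self hnd hK hinv he, schouten_conjBivector_cartanSection hnd hK hinv he⟩
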